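/- Let $n\ge 1$ and let $A$ be a real $n\times n$ matrix all of whose complex eigenvalues have modulus greater than $1$; put $b=|\det A|$. Let $\Delta\subset\mathbb R^n$ be an open ellipsoid centred at the origin with $|\Delta|=1$ and $\Delta\subset r_0\Delta\subset A\Delta$ for some $r_0>1$. Put $B_k=A^k\Delta$ for $k\in\mathbb Z$, let $\sigma$ be the minimum integer with $2B_0\subset B_\sigma$, and let $\rho$ be the step homogeneous quasi-norm: $\rho(x)=b^k$ if $x\in B_{k+1}\setminus B_k$, and $\rho(0)=0$. For $p\in(1,\infty)$, a non-negative measurable function $w$ on $\mathbb R^n$ belongs to $\mathcal A_p(A)$ if $$\sup_{x\in\mathbb R^n,\,k\in\mathbb Z}\Big\{\frac1{|B_k|}\int_{x+B_k}w(y)\,dy\Big\}\Big\{\frac1{|B_k|}\int_{x+B_k}w(y)^{-1/(p-1)}\,dy\Big\}^{p-1}<\infty,$$ and to $\mathcal A_1(A)$ if $$\sup_{x\in\mathbb R^n,\,k\in\mathbb Z}\Big\{\frac1{|B_k|}\int_{x+B_k}w(y)\,dy\Big\}\ \operatorname*{ess\,sup}_{y\in x+B_k}w(y)^{-1}<\infty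 .$$ Let $\mathcal B_1,\mathcal B_2$ be complex Banach spaces, let $r\in(1,\infty)$, and let $\mathcal T$ be a bounded linear operator from $L^r(\mathbb R^n,\mathcal B_1)$ to $L^r(\mathbb R^n,\mathcal B_2)$. Suppose that $\mathcal T$ is a Calderón–Zygmund operator: there are a kernel $\mathcal K$, defined off the diagonal of $\mathbb R^n\times\mathbb R^n$ with values in the space $L(\mathcal B_1,\mathcal B_2)$ of bounded linear operators, and constants $C,\epsilon>0$ such that 1. for every $f\in L^\infty(\mathbb R^n,\mathcal B_1)$ with compact support and almost every $x\notin\operatorname{supp}f$, $\ \mathcal T(f)(x)=\int_{\mathbb R^n}\mathcal K(x,y)f(y)\,dy$; 2. for all $x\ne y$, $\ \|\mathcal K(x,y)\|\le C/\rho(x-y)$; 3. for all $x,y,z$ with $x\neq y$ and $\rho(z-y)\le b^{-2\sigma}\rho(x-y)$, $$\|\mathcal K(y,x)-\mathcal K(z,x)\|+\|\mathcal K(x,y)-\mathcal K(x,z)\|\le C\,\frac{\rho(z-y)^\epsilon}{\rho(x-y)^{1+\epsilon}} .$$ Then the following hold, where $L^p_w$ denotes the $L^p$ space with respect to $w(x)\,dx$.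 (a) If $p\in(1,\infty)$ and $w\in\mathcal A_p(A)$, then $\mathcal T$ is bounded from $L^p_w(\mathbb R^n,\mathcal B_1)$ to $L^p_w(\mathbb R^n,\mathcal B_2)$; that is, there is a unique bounded linear operator from $L^p_w(\mathbb R^n,\mathcal B_1)$ to $L^p_w(\mathbb R^n,\mathcal B_2)$ that agrees with $\mathcal T$ on $L^r(\mathbb R^n,\mathcal B_1)\cap L^p_w(\mathbb R^n,\mathcal B_1)$. (b) If $w\in\mathcal A_1(A)$, then $\mathcal T$ is bounded from $L^1_w(\mathbb R^n,\mathcal B_1)$ to $L^{1,\infty}_w(\mathbb R^n,\mathcal B_2)$; that is, there is a unique linear operator $S$ from $L^1_w(\mathbb R^n,\mathcal B_1)$ to the $\mathcal B_2$-valued measurable functions (modulo equality $w(x)\,dx$-almost everywhere) that agrees with $\mathcal T$ on $L^r(\mathbb R^n,\mathcal B_1)\cap L^1_w(\mathbb R^n,\mathcal B_1)$ and for which there is a finite constant $C'$ such that, for all $f\in L^1_w(\mathbb R^n,\mathcal B_1)$, $$\sup_{t>0}\,t\,w\big(\{x\in\mathbb R^n:\|S f(x)\|_{\mathcal B_2}>t\}\big)\le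 C'\int_{\mathbb R^n}\|f(x)\|_{\mathcal B_1}w(x)\,dx .$$ -/

import Mathlib

open MeasureTheory Set
open scoped ENNReal NNReal Pointwise

namespace Anisotropic

/-- An expansive dilation: every complex eigenvalue `μ` of `A` satisfies `|μ| > 1`. -/
def IsExpansive {n : ℕ} (A : Matrix (Fin n) (Fin n) ℝ) : Prop :=
  ∀ μ ∈ spectrum ℂ (A.map (algebraMap ℝ ℂ)), 1 < ‖μ‖

/-- `Δ` is an admissible ellipsoid for `A`: it is an open ellipsoid centred at the origin, of
Lebesgue measure `1`, and `Δ ⊆ rΔ ⊆ AΔ` for some `r > 1`. -/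
structure IsAdmissibleEllipsoid {n : ℕ} (A : Matrix (Fin n) (Fin n) ℝ)
    (Δ : Set (EuclideanSpace ℝ (Fin n))) : Prop where
  ellipsoid : ∃ P : Matrix (Fin n) (Fin n) ℝ, P.det ≠ 0 ∧
    Δ = {x | ‖Matrix.toEuclideanLin P x‖ < 1}
  nested : ∃ r : ℝ, 1 < r ∧ Δ ⊆ r • Δ ∧ r • Δ ⊆ Matrix.toEuclideanLin A '' Δ
  volume_eq_one : volume Δ = 1

/-- The dilated ball `B_k = A^k Δ`, for an integer `k`. -/
def dilatedBall {n : ℕ} (A : Matrix (Fin n) (Fin n) ℝ) (Δ : Set (EuclideanSpace ℝ (Fin n)))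
    (k : ℤ) : Set (EuclideanSpace ℝ (Fin n)) :=
  Matrix.toEuclideanLin (A ^ k) '' Δ

/-- The number `b = |det A|`. -/
noncomputable def dilationFactor {n : ℕ} (A : Matrix (Fin n) (Fin n) ℝ) : ℝ := |A.det|

/-- The minimum integer `σ` with `2 B_0 ⊆ A^σ B_0 = B_σ`. -/
noncomputable def doublingIndex {n : ℕ} (A : Matrix (Fin n) (Fin n) ℝ)
    (Δ : Set (EuclideanSpace ℝ (Fin n))) : ℤ :=
  sInf {s : ℤ | (2 : ℝ) • dilatedBall A Δ 0 ⊆ dilatedBall A Δ s}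

open Classical in
/-- The step homogeneous quasi-norm: `ρ(x) = b^k` if `x ∈ B_{k+1} \ B_k`, and `ρ(0) = 0`.
The sets `B_{k+1} \ B_k` are pairwise disjoint and cover exactly the nonzero vectors. -/
noncomputable def stepQuasiNorm {n : ℕ} (A : Matrix (Fin n) (Fin n) ℝ)
    (Δ : Set (EuclideanSpace ℝ (Fin n))) (x : EuclideanSpace ℝ (Fin n)) : ℝ :=
  if h : ∃ k : ℤ, x ∈ dilatedBall A Δ (k + 1) \ dilatedBall A Δ k then
    dilationFactor A ^ h.choose
  else 0

/-- The anisotropic Muckenhoupt class `𝒜_p(A)`, `1 ≤ p < ∞`. All quantities are computed in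
`[0, ∞]`; in particular a negative power of `0` is `∞`. -/
structure IsMuckenhoupt {n : ℕ} (A : Matrix (Fin n) (Fin n) ℝ)
    (Δ : Set (EuclideanSpace ℝ (Fin n))) (p : ℝ) (w : EuclideanSpace ℝ (Fin n) → ℝ≥0) :
    Prop where
  aemeasurable : AEMeasurable w volume
  bound : ∃ C : ℝ≥0, ∀ (x : EuclideanSpace ℝ (Fin n)) (k : ℤ),
    (⨍⁻ y in x +ᵥ dilatedBall A Δ k, (w y : ℝ≥0∞) ∂volume) *
      (if p = 1 then
        essSup (fun y => (w y : ℝ≥0∞)⁻¹) (volume.restrict (x +ᵥ dilatedBall A Δ k))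
      else
        (⨍⁻ y in x +ᵥ dilatedBall A Δ k, (w y : ℝ≥0∞) ^ (-1 / (p - 1)) ∂volume) ^ (p - 1)) ≤ C

/-- The measure `w(x) dx`; thus `L^p_w(ℝⁿ, ℬ)` is `Lp ℬ p (weightMeasure w)`. -/
noncomputable def weightMeasure {n : ℕ} (w : EuclideanSpace ℝ (Fin n) → ℝ≥0) :
    Measure (EuclideanSpace ℝ (Fin n)) :=
  volume.withDensity fun x => (w x : ℝ≥0∞)

/-- The `L^{1,∞}(μ)` quasi-norm `sup_{t > 0} t μ({‖g‖ > t})`, with values in `[0, ∞]`. -/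
noncomputable def weakL1Norm {α F : Type*} [MeasurableSpace α] [NormedAddCommGroup F]
    (g : α → F) (μ : Measure α) : ℝ≥0∞ :=
  ⨆ t : ℝ≥0, (t : ℝ≥0∞) * μ {x | (t : ℝ) < ‖g x‖}

/-- A standard kernel with values in `L(ℬ₁, ℬ₂)`. It is a function off the diagonal; its values
on the diagonal are irrelevant. -/
def IsStandardKernel {n : ℕ} (A : Matrix (Fin n) (Fin n) ℝ)
    (Δ : Set (EuclideanSpace ℝ (Fin n))) {B₁ B₂ : Type*}
    [NormedAddCommGroup B₁] [NormedSpace ℂ B₁] [NormedAddCommGroup B₂] [NormedSpace ℂ B₂]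
    (K : EuclideanSpace ℝ (Fin n) → EuclideanSpace ℝ (Fin n) → B₁ →L[ℂ] B₂) : Prop :=
  ∃ C ε : ℝ, 0 < C ∧ 0 < ε ∧
    (∀ x y, x ≠ y → ‖K x y‖ ≤ C / stepQuasiNorm A Δ (x - y)) ∧
    (∀ x y z, x ≠ y →
      stepQuasiNorm A Δ (z - y) ≤
        dilationFactor A ^ (-2 * doublingIndex A Δ) * stepQuasiNorm A Δ (x - y) →
      ‖K y x - K z x‖ + ‖K x y - K x z‖ ≤
        C * (stepQuasiNorm A Δ (z - y) ^ ε / stepQuasiNorm A Δ (x - y) ^ (1 + ε)))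

/-- A bounded linear operator `T` from `L^r(ℝⁿ, ℬ₁)` to `L^r(ℝⁿ, ℬ₂)` is a Calderón–Zygmund
operator if there is a standard kernel `K` such that `T f(x) = ∫ K(x, y) f(y) dy` for every
`f ∈ L^∞_c(ℝⁿ, ℬ₁)` and (almost) every `x ∉ supp f`. -/
def IsCalderonZygmund {n : ℕ} (A : Matrix (Fin n) (Fin n) ℝ)
    (Δ : Set (EuclideanSpace ℝ (Fin n))) {B₁ B₂ : Type*}
    [NormedAddCommGroup B₁] [NormedSpace ℂ B₁] [NormedAddCommGroup B₂] [NormedSpace ℂ B₂]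
    {r : ℝ≥0∞} [Fact (1 ≤ r)]
    (T : Lp B₁ r (volume : Measure (EuclideanSpace ℝ (Fin n))) →L[ℂ]
      Lp B₂ r (volume : Measure (EuclideanSpace ℝ (Fin n)))) : Prop :=
  ∃ K : EuclideanSpace ℝ (Fin n) → EuclideanSpace ℝ (Fin n) → B₁ →L[ℂ] B₂,
    IsStandardKernel A Δ K ∧
    ∀ f : EuclideanSpace ℝ (Fin n) → B₁, MemLp f ∞ volume → HasCompactSupport f →
      ∀ hf : MemLp f r volume,
        ∀ᵐ x ∂volume, x ∉ tsupport f → T (hf.toLp f) x = ∫ y, K x y (f y)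

end Anisotropic

/-! Only a few properties of the sets `B_k` matter: they are open, bounded, symmetric and nested,
they shrink to the origin and exhaust the space, `B_k + B_k ⊆ B_{k+σ}`, and `|B_k| = b^k`. These
make ℝⁿ a space of homogeneous type with integer radii. The Vitali lemma holds with the radius index
enlarged by `1 + 2σ`.

Let `μ = w dx`, let `|F|` be Lebesgue measure and `M` the uncentred maximal operator over the balls.
The weight acts on sets through `μ(U)|F|^p ≤ C|U|^p μ(F)` for `F` inside a ball `U`, which is
Hölder's inequality combined with the `𝒜_p` condition. It gives doubling and, after an iteration
(`exists_decay`), the `A_∞` property `exists_small`: a small share of Lebesgue measure is a small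
share of `μ`. No reverse Hölder inequality is involved.

`M` is bounded on `L^p_w` by Lerner's argument. With `S = W^{-1/(p-1)}` and `ν = S dx` one has
`(Mf)^{p-1} ≤ C M_μ(M_ν(f/S)^{p-1}/W)`, and maximal operators of doubling measures are bounded on
`L^q` for `q > 1`. For `p = 1` one has `Mf ≤ C M_μ f`, hence the weak type.

For the operator, a Calderón–Zygmund decomposition gives the unweighted weak type (1,1) estimate
(`exists_weak_one_one`). The main step is the good-λ inequality `μ{‖Tf‖ > 4t, Mf ≤ γt} ≤ η μ{‖Tf‖ >
t}` (`exists_good_lambda`), proved for `T` itself and not for its maximal truncations. An open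
neighbourhood of `{‖Tf‖ > t}` is covered by balls of which a fixed share lies outside it. On each
ball the distant part of `f` contributes almost a constant, and a point outside the neighbourhood,
where `‖Tf‖ ≤ t`, bounds that constant. The exceptional set is then small in Lebesgue measure, and
`A_∞` makes it small in `μ`. Summing over dyadic levels bounds `Tf` by `Mf` in `L^p_w`, and a
supremum does so in weak `L¹_w`. The finiteness needed for absorption comes from `‖Tf‖ ≤ C Mf` off a
large ball.

These bounds are proved for bounded functions of bounded support, pass to `L^r` by Fatou, and then
extend. For `p > 1` this is extension by continuity; for weak `L¹`, which has only a quasi-norm, the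
limit is built by Borel–Cantelli. A Muckenhoupt weight is null or positive almost everywhere. In the
first case both claims are trivial; in the second `μ` and Lebesgue measure have the same null sets.
-/

namespace Anisotropic

/-! ### Ball families and the Vitali covering lemma -/

section Geometry

variable {E : Type*} [NormedAddCommGroup E] [MeasureSpace E]

/-- A family of nested symmetric open neighbourhoods of the origin which behaves like the
dilates `A ^ k Δ` of an ellipsoid. -/
structure IsBallFamily (b : ℝ≥0) (σ : ℤ) (B : ℤ → Set E) : Prop where
  one_lt : 1 < b
  one_le : 1 ≤ σ
  isOpen : ∀ k, IsOpen (B k)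
  isBounded : ∀ k, Bornology.IsBounded (B k)
  zero_mem : ∀ k, (0 : E) ∈ B k
  neg_mem : ∀ k x, x ∈ B k → -x ∈ B k
  mono : Monotone B
  add_mem : ∀ k x y, x ∈ B k → y ∈ B k → x + y ∈ B (k + σ)
  exists_subset_ball : ∀ ε : ℝ, 0 < ε → ∃ k, B k ⊆ Metric.ball 0 ε
  exists_ball_subset : ∀ R : ℝ, ∃ k, Metric.ball 0 R ⊆ B k
  volume_eq : ∀ x k, volume {y | y - x ∈ B k} = ((b ^ k : ℝ≥0) : ℝ≥0∞)

/-- The translate `x + B k`. -/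
def bl (B : ℤ → Set E) (x : E) (k : ℤ) : Set E := {y | y - x ∈ B k}

namespace IsBallFamily

variable {b : ℝ≥0} {σ : ℤ} {B : ℤ → Set E} (h : IsBallFamily b σ B)
include h

theorem volume_bl (x : E) (k : ℤ) : volume (bl B x k) = ((b ^ k : ℝ≥0) : ℝ≥0∞) :=
  h.volume_eq x k

theorem pos : 0 < b := zero_lt_one.trans h.one_lt

theorem zpow_pos' (k : ℤ) : 0 < b ^ k := zpow_pos h.pos k

theorem ennreal_zpow_ne_zero (k : ℤ) : ((b ^ k : ℝ≥0) : ℝ≥0∞) ≠ 0 := by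
  simpa using (h.zpow_pos' k).ne'

theorem zpow_le_iff {k l : ℤ} : b ^ k ≤ b ^ l ↔ k ≤ l := zpow_le_zpow_iff_right₀ h.one_lt

theorem ennreal_zpow_add (k l : ℤ) :
    ((b ^ (k + l) : ℝ≥0) : ℝ≥0∞) = ((b ^ k : ℝ≥0) : ℝ≥0∞) * ((b ^ l : ℝ≥0) : ℝ≥0∞) := by
  rw [zpow_add₀ h.pos.ne', ENNReal.coe_mul]

theorem volume_bl_add (x y : E) (k l : ℤ) :
    volume (bl B x (k + l)) = ((b ^ l : ℝ≥0) : ℝ≥0∞) * volume (bl B y k) := by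
  rw [h.volume_bl, h.volume_bl, h.ennreal_zpow_add, mul_comm]

theorem volume_bl_ne_top (x : E) (k : ℤ) : volume (bl B x k) ≠ ∞ := by
  rw [h.volume_bl]; exact ENNReal.coe_ne_top

theorem volume_bl_ne_zero (x : E) (k : ℤ) : volume (bl B x k) ≠ 0 := by
  rw [h.volume_bl]; exact h.ennreal_zpow_ne_zero k

theorem mem_self (x : E) (k : ℤ) : x ∈ bl B x k := by
  simpa [bl] using h.zero_mem k

theorem mem_symm {x y : E} {k : ℤ} (hy : y ∈ bl B x k) : x ∈ bl B y k := by
  simpa [bl] using h.neg_mem k _ hy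

theorem bl_mono (x : E) {k l : ℤ} (hkl : k ≤ l) : bl B x k ⊆ bl B x l :=
  fun _ hy => h.mono hkl hy

theorem mem_trans {x y z : E} {k : ℤ} (hy : y ∈ bl B x k) (hz : z ∈ bl B y k) :
    z ∈ bl B x (k + σ) := by
  simpa [bl] using h.add_mem k _ _ hz hy

theorem isOpen_bl (x : E) (k : ℤ) : IsOpen (bl B x k) :=
  (h.isOpen k).preimage (continuous_id.sub continuous_const)

theorem measurableSet_bl [BorelSpace E] (x : E) (k : ℤ) : MeasurableSet (bl B x k) :=
  (h.isOpen_bl x k).measurableSet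

theorem isBounded_bl (x : E) (k : ℤ) : Bornology.IsBounded (bl B x k) := by
  obtain ⟨R, hR⟩ := (h.isBounded k).subset_ball 0
  refine (Metric.isBounded_ball (x := x) (r := R)).subset fun y hy => ?_
  simpa [dist_eq_norm] using hR hy

/-- A ball of index `k` about a point of the closure meets `bl B x k`; symmetry and one
quasi-triangle inequality then cost one `σ`. -/
theorem closure_bl_subset (x : E) (k : ℤ) : closure (bl B x k) ⊆ bl B x (k + σ) := by
  intro z hz
  obtain ⟨y, hy, hyx⟩ := mem_closure_iff.1 hz _ (h.isOpen_bl z k) (h.mem_self z k)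
  exact h.mem_trans hyx (h.mem_symm hy)

theorem exists_bl_subset {O : Set E} (hO : IsOpen O) {x : E} (hx : x ∈ O) :
    ∃ k, bl B x k ⊆ O := by
  obtain ⟨ε, hε, hεO⟩ := Metric.isOpen_iff.1 hO x hx
  obtain ⟨k, hk⟩ := h.exists_subset_ball ε hε
  refine ⟨k, fun y hy => hεO ?_⟩
  simpa [dist_eq_norm] using hk hy

theorem exists_subset_bl {s : Set E} (hs : Bornology.IsBounded s) (x : E) :
    ∃ k, s ⊆ bl B x k := by
  obtain ⟨R, hR⟩ := hs.subset_ball x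
  obtain ⟨k, hk⟩ := h.exists_ball_subset R
  refine ⟨k, fun y hy => hk ?_⟩
  simpa [dist_eq_norm] using hR hy

theorem iUnion_bl (x : E) : ⋃ k : ℕ, bl B x k = univ := by
  refine eq_univ_of_forall fun y => ?_
  obtain ⟨k, hk⟩ := h.exists_subset_bl (Bornology.isBounded_singleton (x := y)) x
  exact mem_iUnion.2 ⟨k.toNat, h.bl_mono x (Int.self_le_toNat k) (hk rfl)⟩

theorem exists_le_zpow (M : ℝ≥0) : ∃ k : ℤ, M ≤ b ^ k := by
  obtain ⟨n, hn⟩ := pow_unbounded_of_one_lt M h.one_lt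
  exact ⟨n, by simpa using hn.le⟩

/-- If `x ∉ x₀ + B k` then `x` lies in a shell `(x₀ + B (l + 1)) \ (x₀ + B l)` with `k ≤ l`. -/
theorem exists_shell {x₀ x : E} {k : ℤ} (hx : x ∉ bl B x₀ k) :
    ∃ i : ℕ, x ∉ bl B x₀ (k + i) ∧ x ∈ bl B x₀ (k + i + 1) := by
  classical
  have hex : ∃ i : ℕ, x ∈ bl B x₀ (k + i + 1) := by
    obtain ⟨l, hl⟩ := h.exists_subset_bl (Bornology.isBounded_singleton (x := x)) x₀
    exact ⟨(l - k).toNat, h.bl_mono x₀ (by lia) (hl rfl)⟩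
  refine ⟨Nat.find hex, ?_, Nat.find_spec hex⟩
  rcases Nat.eq_zero_or_pos (Nat.find hex) with h0 | h0
  · rw [h0]; simpa using hx
  · have := Nat.find_min hex (Nat.sub_lt h0 one_pos)
    convert this using 2
    rw [Nat.cast_sub (by lia)]; push_cast; ring_nf

/-- The Vitali covering lemma. -/
theorem exists_vitali [ProperSpace E] (t : Set (E × ℤ)) (K : ℤ) (hK : ∀ a ∈ t, a.2 ≤ K) :
    ∃ u ⊆ t, u.Countable ∧ u.PairwiseDisjoint (fun a => bl B a.1 a.2) ∧
      ∀ a ∈ t, ∃ c ∈ u, bl B a.1 a.2 ⊆ bl B c.1 (c.2 + (1 + 2 * σ)) := by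
  have hb1 : (1 : ℝ) < b := by exact_mod_cast h.one_lt
  obtain ⟨u, hut, hd, hu⟩ := Vitali.exists_disjoint_subfamily_covering_enlargement
    (fun a : E × ℤ => bl B a.1 a.2) t (fun a => (b : ℝ) ^ a.2) b hb1
    (fun a _ => by positivity) ((b : ℝ) ^ K)
    (fun a ha => zpow_le_zpow_right₀ hb1.le (hK a ha)) (fun a _ => ⟨a.1, h.mem_self _ _⟩)
  refine ⟨u, hut, hd.countable_of_isOpen (fun a _ => h.isOpen_bl _ _)
    (fun a _ => ⟨a.1, h.mem_self _ _⟩), hd, fun a ha => ?_⟩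
  obtain ⟨c, hc, ⟨p, hpa, hpc⟩, hle⟩ := hu a ha
  -- Radii are compared up to the ratio `b`, so the selected ball may be one index smaller; two
  -- quasi-triangle inequalities add `2σ`. Hence the enlargement `1 + 2σ`.
  have hle' : a.2 ≤ c.2 + 1 := by
    have : (b : ℝ) ^ a.2 ≤ (b : ℝ) ^ (c.2 + 1) := by
      rw [zpow_add₀ (by positivity), zpow_one, mul_comm]; exact hle
    exact (zpow_le_zpow_iff_right₀ hb1).1 this
  have hσ := h.one_le
  refine ⟨c, hc, fun z hz => ?_⟩
  have h1 : z ∈ bl B p (a.2 + σ) := h.mem_trans (h.mem_symm hpa) hz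
  have h2 : z ∈ bl B c.1 (c.2 + 1 + σ + σ) :=
    h.mem_trans (h.bl_mono _ (by lia) hpc) (h.bl_mono _ (by lia) h1)
  exact h.bl_mono _ (by lia) h2

theorem isLocallyFiniteMeasure (μ : Measure E) (hμ : ∀ x k, μ (bl B x k) ≠ ∞) :
    IsLocallyFiniteMeasure μ :=
  ⟨fun x => ⟨bl B x 0, (h.isOpen_bl x 0).mem_nhds (h.mem_self x 0), (hμ x 0).lt_top⟩⟩

end IsBallFamily

end Geometry

/-! ### Discrete layer-cake formula over the levels `4 ^ k` -/

section Dyadic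

/-- The dyadic levels `4 ^ k`. -/
noncomputable def lev (k : ℤ) : ℝ≥0∞ := (((4 : ℝ≥0) ^ k : ℝ≥0) : ℝ≥0∞)

theorem lev_ne_zero (k : ℤ) : lev k ≠ 0 :=
  ENNReal.coe_ne_zero.2 (zpow_ne_zero k (by norm_num))

theorem lev_ne_top (k : ℤ) : lev k ≠ ∞ := ENNReal.coe_ne_top

theorem lev_succ (k : ℤ) : lev (k + 1) = 4 * lev k := by
  simp only [lev]
  rw [zpow_add₀ (by norm_num), zpow_one, mul_comm, ENNReal.coe_mul]; rfl

theorem lev_mono : Monotone lev := fun _ _ hkl =>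
  ENNReal.coe_le_coe.2 (zpow_le_zpow_right₀ (by norm_num) hkl)

theorem lev_sub_natCast_rpow (m : ℤ) (i : ℕ) (p : ℝ) :
    lev (m - i) ^ p = lev m ^ p * ((4 : ℝ≥0∞)⁻¹ ^ p) ^ i := by
  induction i with
  | zero => simp
  | succ i ih =>
    have h1 : lev (m - i) = 4 * lev (m - (i + 1 : ℕ)) := by
      rw [← lev_succ]; congr 1; push_cast; ring
    have h2 : lev (m - (i + 1 : ℕ)) = 4⁻¹ * lev (m - i) := by
      rw [h1, ← mul_assoc, ENNReal.inv_mul_cancel (by norm_num) (by norm_num), one_mul]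
    rw [h2, ENNReal.mul_rpow_of_ne_top (by simp) (lev_ne_top _), ih, pow_succ]
    ring

theorem exists_lev {a : ℝ≥0∞} (h0 : a ≠ 0) (ht : a ≠ ∞) : ∃ m, lev m < a ∧ a ≤ lev (m + 1) := by
  lift a to ℝ≥0 using ht
  obtain ⟨m, hm⟩ := exists_mem_Ioc_zpow (y := (4 : ℝ≥0))
    (pos_iff_ne_zero.2 (by simpa using h0) : 0 < a) (by norm_num)
  exact ⟨m, by simpa only [lev, ENNReal.coe_lt_coe] using hm.1, by simpa only [lev, ENNReal.coe_le_coe] using hm.2⟩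

/-- A dyadic substitute for `a ^ p`. -/
noncomputable def dyadicSum (p : ℝ) (a : ℝ≥0∞) : ℝ≥0∞ :=
  ∑' k : ℤ, (Ioi (lev k)).indicator (fun _ => lev k ^ p) a

/-- If `4^m < a ≤ 4^{m+1}`, the single term of index `m` is already at least `a^p / 4^p`. For `a =
∞` all terms are present and the sum exceeds every finite bound. -/
theorem rpow_le_dyadicSum {p : ℝ} (hp : 0 < p) (a : ℝ≥0∞) :
    a ^ p ≤ 4 ^ p * dyadicSum p a := by
  rcases eq_or_ne a 0 with rfl | h0
  · simp [ENNReal.zero_rpow_of_pos hp]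
  have key : ∀ m, lev m < a → (lev (m + 1)) ^ p ≤ 4 ^ p * dyadicSum p a := by
    intro m hm
    rw [lev_succ, ENNReal.mul_rpow_of_nonneg _ _ hp.le]
    gcongr
    refine le_trans ?_ (ENNReal.le_tsum m)
    rw [indicator_of_mem (show a ∈ Ioi (lev m) from hm)]
  rcases eq_or_ne a ∞ with rfl | ht
  · refine le_of_forall_lt fun c hc => ?_
    have hc' : c ≠ ∞ := (hc.trans_le le_top).ne
    obtain ⟨n, hn⟩ : ∃ n : ℕ, c ^ p⁻¹ < (4 : ℝ≥0∞) ^ n := by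
      have hcf : c ^ p⁻¹ ≠ ∞ := ENNReal.rpow_ne_top_of_nonneg (by positivity) hc'
      lift c ^ p⁻¹ to ℝ≥0 using hcf with d
      obtain ⟨n, hn⟩ := pow_unbounded_of_one_lt d (show (1 : ℝ≥0) < 4 by norm_num)
      exact ⟨n, by exact_mod_cast hn⟩
    refine lt_of_lt_of_le ?_ (key ((n : ℤ) - 1) (lev_ne_top _).lt_top)
    have h4 : lev ((n : ℤ) - 1 + 1) = 4 ^ n := by simp [lev]
    rw [h4]
    have := ENNReal.rpow_lt_rpow hn hp
    rwa [← ENNReal.rpow_mul, inv_mul_cancel₀ hp.ne', ENNReal.rpow_one] at this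
  · obtain ⟨m, hm, hm'⟩ := exists_lev h0 ht
    exact (ENNReal.rpow_le_rpow hm' hp.le).trans (key m hm)

theorem inv_four_rpow_lt_one {p : ℝ} (hp : 0 < p) : (4 : ℝ≥0∞)⁻¹ ^ p < 1 :=
  ENNReal.rpow_lt_one (by norm_num) hp

/-- Only the levels below `a` contribute; going down from the highest one they form a geometric
series of ratio `4^{-p}`. -/
theorem dyadicSum_le {p : ℝ} (hp : 0 < p) (a : ℝ≥0∞) :
    dyadicSum p a ≤ (1 - (4 : ℝ≥0∞)⁻¹ ^ p)⁻¹ * a ^ p := by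
  rcases eq_or_ne a 0 with rfl | h0
  · simp [dyadicSum]
  rcases eq_or_ne a ∞ with rfl | ht
  · rw [ENNReal.top_rpow_of_pos hp, ENNReal.mul_top]
    · exact le_top
    · exact ENNReal.inv_ne_zero.2 ((tsub_le_self.trans_lt ENNReal.one_lt_top).ne)
  obtain ⟨m, hm, hm'⟩ := exists_lev h0 ht
  have hinj : Function.Injective (fun i : ℕ => m - (i : ℤ)) := fun i j hij => by
    simpa using hij
  have hsupp : Function.support (fun k : ℤ => (Ioi (lev k)).indicator (fun _ => lev k ^ p) a) ⊆
      range (fun i : ℕ => m - (i : ℤ)) := by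
    intro k hk
    have hka : lev k < a := by
      by_contra hcon
      exact hk (indicator_of_notMem (show a ∉ Ioi (lev k) from hcon) _)
    have : k ≤ m := by
      by_contra hcon
      exact absurd (hka.trans_le hm') (not_lt.2 (lev_mono (by lia)))
    exact ⟨(m - k).toNat, by simp; lia⟩
  calc dyadicSum p a
      = ∑' i : ℕ, (Ioi (lev (m - i))).indicator (fun _ => lev (m - i) ^ p) a :=
        (hinj.tsum_eq hsupp).symm
    _ ≤ ∑' i : ℕ, a ^ p * ((4 : ℝ≥0∞)⁻¹ ^ p) ^ i := by
        refine ENNReal.tsum_le_tsum fun i => (indicator_le_self _ _ _).trans ?_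
        rw [lev_sub_natCast_rpow]
        gcongr
    _ = (1 - (4 : ℝ≥0∞)⁻¹ ^ p)⁻¹ * a ^ p := by
        rw [ENNReal.tsum_mul_left, ENNReal.tsum_geometric, mul_comm]

theorem measurable_dyadicSum (p : ℝ) : Measurable (dyadicSum p) :=
  Measurable.tsum fun _ => measurable_const.indicator measurableSet_Ioi

/-- Only a countable sum and an integral are interchanged, so no σ-finiteness of `μ` is needed. -/
theorem lintegral_dyadicSum {α : Type*} [MeasurableSpace α] {μ : Measure α} (p : ℝ)
    {g : α → ℝ≥0∞} (hg : AEMeasurable g μ) :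
    ∫⁻ x, dyadicSum p (g x) ∂μ = ∑' k, lev k ^ p * μ {x | lev k < g x} := by
  simp only [dyadicSum]
  rw [lintegral_tsum (f := fun k x => (Ioi (lev k)).indicator (fun _ => lev k ^ p) (g x)) fun k =>
    (measurable_const.indicator measurableSet_Ioi).comp_aemeasurable hg]
  congr with k
  have : ∀ x, (Ioi (lev k)).indicator (fun _ => lev k ^ p) (g x) =
      {x | lev k < g x}.indicator (fun _ => lev k ^ p) x := fun x => rfl
  simp only [this]
  rw [lintegral_indicator_const₀ (nullMeasurableSet_lt aemeasurable_const hg)]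

end Dyadic

/-! ### Maximal operators of doubling measures -/

section Maximal

variable {E : Type*} [NormedAddCommGroup E] [MeasureSpace E]

/-- The uncentred maximal function associated with a family of balls and a measure. -/
noncomputable def maxFn (B : ℤ → Set E) (μ : Measure E) (f : E → ℝ≥0∞) (x : E) : ℝ≥0∞ :=
  ⨆ (y : E) (k : ℤ) (_ : x ∈ bl B y k), (∫⁻ z in bl B y k, f z ∂μ) / μ (bl B y k)

/-- The doubling condition for the measure `μ`. -/
def IsDoublingFor (B : ℤ → Set E) (σ : ℤ) (μ : Measure E) (D : ℝ≥0) : Prop :=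
  ∀ x k, μ (bl B x (k + (1 + 2 * σ))) ≤ D * μ (bl B x k)

variable {B : ℤ → Set E} {μ : Measure E}

theorem lintegral_div_le_maxFn (f : E → ℝ≥0∞) {x y : E} {k : ℤ} (hx : x ∈ bl B y k) :
    (∫⁻ z in bl B y k, f z ∂μ) / μ (bl B y k) ≤ maxFn B μ f x :=
  le_iSup_of_le y (le_iSup_of_le k (le_iSup_of_le hx le_rfl))

theorem lt_maxFn_iff {f : E → ℝ≥0∞} {x : E} {t : ℝ≥0∞} : t < maxFn B μ f x ↔
    ∃ y k, x ∈ bl B y k ∧ t < (∫⁻ z in bl B y k, f z ∂μ) / μ (bl B y k) := by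
  simp [maxFn, lt_iSup_iff]

theorem maxFn_le_iff {f : E → ℝ≥0∞} {x : E} {t : ℝ≥0∞} : maxFn B μ f x ≤ t ↔
    ∀ y k, x ∈ bl B y k → (∫⁻ z in bl B y k, f z ∂μ) / μ (bl B y k) ≤ t := by
  simp [maxFn]

theorem maxFn_congr {f g : E → ℝ≥0∞} (hfg : f =ᵐ[μ] g) : maxFn B μ f = maxFn B μ g := by
  ext x
  simp only [maxFn]
  refine iSup_congr fun y => iSup_congr fun k => iSup_congr fun _ => ?_
  congr 1
  exact lintegral_congr_ae (ae_restrict_of_ae hfg)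

theorem maxFn_le_add {f g : E → ℝ≥0∞} {s : ℝ≥0∞} (hfg : ∀ x, f x ≤ g x + s) (x : E) :
    maxFn B μ f x ≤ maxFn B μ g x + s := by
  refine maxFn_le_iff.2 fun y k hx => ?_
  calc (∫⁻ z in bl B y k, f z ∂μ) / μ (bl B y k)
      ≤ ((∫⁻ z in bl B y k, g z ∂μ) + s * μ (bl B y k)) / μ (bl B y k) := by
        gcongr
        refine (lintegral_mono hfg).trans ?_
        rw [lintegral_add_right _ measurable_const, setLIntegral_const]
    _ ≤ maxFn B μ g x + s := by
        rw [ENNReal.add_div]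
        gcongr
        · exact lintegral_div_le_maxFn g hx
        · exact ENNReal.div_le_of_le_mul le_rfl

namespace IsBallFamily

variable {b : ℝ≥0} {σ : ℤ} (h : IsBallFamily b σ B)
include h

theorem isOpen_lt_maxFn (f : E → ℝ≥0∞) (t : ℝ≥0∞) : IsOpen {x | t < maxFn B μ f x} := by
  have : {x | t < maxFn B μ f x} = ⋃ (y : E) (k : ℤ)
      (_ : t < (∫⁻ z in bl B y k, f z ∂μ) / μ (bl B y k)), bl B y k := by
    ext x
    simp only [mem_ofPred_eq, lt_maxFn_iff, mem_iUnion]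
    refine exists_congr fun y => exists_congr fun k => ?_
    rw [exists_prop, and_comm]
  rw [this]
  exact isOpen_iUnion fun y => isOpen_iUnion fun k => isOpen_iUnion fun _ => h.isOpen_bl y k

variable [ProperSpace E] [BorelSpace E]

omit [ProperSpace E] in
theorem measurable_maxFn (f : E → ℝ≥0∞) : Measurable (maxFn B μ f) :=
  measurable_of_Ioi fun t => (h.isOpen_lt_maxFn f t).measurableSet

/-- The Vitali lemma is applied to the balls on which the average of `f` exceeds `t`. It requires
bounded radii, so the superlevel set is exhausted by the sets `S K` that use only indices up to `K`.
-/
theorem maxFn_weak {D : ℝ≥0} (hD : IsDoublingFor B σ μ D) (f : E → ℝ≥0∞) (t : ℝ≥0∞) :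
    t * μ {x | t < maxFn B μ f x} ≤ D * ∫⁻ x, f x ∂μ := by
  let S : ℕ → Set E := fun K => {x | ∃ y k, k ≤ (K : ℤ) ∧ x ∈ bl B y k ∧
    t < (∫⁻ z in bl B y k, f z ∂μ) / μ (bl B y k)}
  have hS : {x | t < maxFn B μ f x} = ⋃ K, S K := by
    ext x
    simp only [mem_ofPred_eq, lt_maxFn_iff, mem_iUnion, S]
    constructor
    · rintro ⟨y, k, hx⟩
      exact ⟨k.toNat, y, k, Int.self_le_toNat k, hx⟩
    · rintro ⟨K, y, k, -, hx⟩
      exact ⟨y, k, hx⟩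
  have hmono : Monotone S := by
    rintro K L hKL x ⟨y, k, hk, hx⟩
    exact ⟨y, k, hk.trans (by exact_mod_cast hKL), hx⟩
  rw [hS, hmono.measure_iUnion, ENNReal.mul_iSup]
  refine iSup_le fun K => ?_
  let T : Set (E × ℤ) := {a | a.2 ≤ (K : ℤ) ∧
    t < (∫⁻ z in bl B a.1 a.2, f z ∂μ) / μ (bl B a.1 a.2)}
  obtain ⟨u, huT, huc, hud, hu⟩ := h.exists_vitali T K fun a ha => ha.1
  have hcov : S K ⊆ ⋃ c ∈ u, bl B c.1 (c.2 + (1 + 2 * σ)) := by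
    rintro x ⟨y, k, hk, hx, hlt⟩
    obtain ⟨c, hc, hsub⟩ := hu (y, k) ⟨hk, hlt⟩
    exact mem_biUnion hc (hsub hx)
  have : Countable u := huc.to_subtype
  calc t * μ (S K) ≤ t * ∑' c : u, μ (bl B c.1.1 (c.1.2 + (1 + 2 * σ))) := by
        gcongr
        exact (measure_mono hcov).trans (measure_biUnion_le μ huc _)
    _ ≤ t * ∑' c : u, D * μ (bl B c.1.1 c.1.2) := by
        gcongr; exact hD _ _
    _ = D * ∑' c : u, t * μ (bl B c.1.1 c.1.2) := by
        rw [ENNReal.tsum_mul_left, ENNReal.tsum_mul_left]; ring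
    _ ≤ D * ∑' c : u, ∫⁻ z in bl B c.1.1 c.1.2, f z ∂μ := by
        gcongr with c
        exact ENNReal.mul_le_of_le_div (huT c.2).2.le
    _ = D * ∫⁻ z in ⋃ c ∈ u, bl B c.1 c.2, f z ∂μ := by
        rw [lintegral_biUnion huc (fun c _ => h.measurableSet_bl _ _) hud]
    _ ≤ D * ∫⁻ z, f z ∂μ := by
        exact mul_le_mul' le_rfl (setLIntegral_le_lintegral _ _)

/-- Marcinkiewicz interpolation in discrete form. The part of `f` below `4^k` adds at most `4^k` to
the maximal function, so at level `4^{k+1}` the weak type bound is needed only for the part above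
`4^k`. Summation over `k` recovers `f * dyadicSum (q - 1) f`, which is comparable to `f^q`. -/
theorem lintegral_maxFn_rpow_le {D : ℝ≥0} (hD : IsDoublingFor B σ μ D) {q : ℝ} (hq : 1 < q) :
    ∃ C : ℝ≥0, ∀ f : E → ℝ≥0∞, AEMeasurable f μ →
      ∫⁻ x, maxFn B μ f x ^ q ∂μ ≤ C * ∫⁻ x, f x ^ q ∂μ := by
  have hq0 : 0 < q := by linarith
  have hq1 : 0 < q - 1 := by linarith
  obtain ⟨C, hC⟩ : ∃ C : ℝ≥0, (C : ℝ≥0∞) =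
      4 ^ q * (D * 4 ^ q * (1 - (4 : ℝ≥0∞)⁻¹ ^ (q - 1))⁻¹) := by
    have h1 : (1 - (4 : ℝ≥0∞)⁻¹ ^ (q - 1))⁻¹ ≠ ∞ :=
      ENNReal.inv_ne_top.2 (tsub_pos_of_lt (inv_four_rpow_lt_one hq1)).ne'
    have h2 : (4 : ℝ≥0∞) ^ q ≠ ∞ := ENNReal.rpow_ne_top_of_nonneg hq0.le (by norm_num)
    exact ⟨_, ENNReal.coe_toNNReal (ENNReal.mul_ne_top h2
      (ENNReal.mul_ne_top (ENNReal.mul_ne_top ENNReal.coe_ne_top h2) h1))⟩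
  suffices H : ∀ f : E → ℝ≥0∞, Measurable f →
      ∫⁻ x, maxFn B μ f x ^ q ∂μ ≤ C * ∫⁻ x, f x ^ q ∂μ by
    refine ⟨C, fun f hf => ?_⟩
    have h1 : ∫⁻ x, f x ^ q ∂μ = ∫⁻ x, hf.mk f x ^ q ∂μ :=
      lintegral_congr_ae (hf.ae_eq_mk.mono fun x hx => congrArg (· ^ q) hx)
    rw [maxFn_congr hf.ae_eq_mk, h1]
    exact H _ hf.measurable_mk
  intro f hf
  have hterm : ∀ k : ℤ, lev (k + 1) ^ q * μ {x | lev (k + 1) < maxFn B μ f x} ≤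
      D * 4 ^ q * (lev k ^ (q - 1) * ∫⁻ x, (Ioi (lev k)).indicator id (f x) ∂μ) := by
    intro k
    have hsub : {x | lev (k + 1) < maxFn B μ f x} ⊆
        {x | lev k < maxFn B μ (fun x => (Ioi (lev k)).indicator id (f x)) x} := by
      intro x hx
      by_contra hcon
      have hcon' : maxFn B μ (fun x => (Ioi (lev k)).indicator id (f x)) x ≤ lev k := not_lt.1 hcon
      have hle : maxFn B μ f x ≤ lev k + lev k := by
        refine (maxFn_le_add (s := lev k) (fun z => ?_) x).trans (by gcongr)
        by_cases hz : lev k < f z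
        · rw [indicator_of_mem (show f z ∈ Ioi (lev k) from hz)]; exact le_self_add
        · rw [indicator_of_notMem (show f z ∉ Ioi (lev k) from hz), zero_add]
          exact not_lt.1 hz
      refine absurd (lt_of_lt_of_le hx hle) (not_lt.2 ?_)
      rw [lev_succ, ← two_mul]
      gcongr
      norm_num
    have hw := h.maxFn_weak hD (fun x => (Ioi (lev k)).indicator id (f x)) (lev k)
    have hlev : lev k ^ q = lev k ^ (q - 1) * lev k := by
      conv_lhs => rw [show q = (q - 1) + 1 by ring]
      rw [ENNReal.rpow_add _ _ (lev_ne_zero k) (lev_ne_top k), ENNReal.rpow_one]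
    calc lev (k + 1) ^ q * μ {x | lev (k + 1) < maxFn B μ f x}
        ≤ (4 ^ q * lev k ^ q) *
          μ {x | lev k < maxFn B μ (fun x => (Ioi (lev k)).indicator id (f x)) x} := by
          rw [lev_succ, ENNReal.mul_rpow_of_nonneg _ _ hq0.le]
          rw [← lev_succ]
          exact mul_le_mul' le_rfl (measure_mono hsub)
      _ = 4 ^ q * lev k ^ (q - 1) * (lev k *
          μ {x | lev k < maxFn B μ (fun x => (Ioi (lev k)).indicator id (f x)) x}) := by
          rw [hlev]; ring
      _ ≤ 4 ^ q * lev k ^ (q - 1) * (D * ∫⁻ x, (Ioi (lev k)).indicator id (f x) ∂μ) := by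
          gcongr
      _ = _ := by ring
  have hind : ∀ k, Measurable fun x => (Ioi (lev k)).indicator id (f x) := fun k =>
    (measurable_id.indicator measurableSet_Ioi).comp hf
  calc ∫⁻ x, maxFn B μ f x ^ q ∂μ
      ≤ ∫⁻ x, 4 ^ q * dyadicSum q (maxFn B μ f x) ∂μ :=
        lintegral_mono fun x => rpow_le_dyadicSum hq0 _
    _ = 4 ^ q * ∑' k, lev k ^ q * μ {x | lev k < maxFn B μ f x} := by
        rw [lintegral_const_mul (f := fun x => dyadicSum q (maxFn B μ f x)) _
            ((measurable_dyadicSum q).comp (h.measurable_maxFn f)),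
          lintegral_dyadicSum q (h.measurable_maxFn f).aemeasurable]
    _ = 4 ^ q * ∑' k, lev (k + 1) ^ q * μ {x | lev (k + 1) < maxFn B μ f x} := by
        rw [← (Equiv.addRight (1 : ℤ)).tsum_eq]; rfl
    _ ≤ 4 ^ q * ∑' k, D * 4 ^ q *
        (lev k ^ (q - 1) * ∫⁻ x, (Ioi (lev k)).indicator id (f x) ∂μ) := by
        exact mul_le_mul' le_rfl (ENNReal.tsum_le_tsum hterm)
    _ = 4 ^ q * (D * 4 ^ q * ∫⁻ x, f x * dyadicSum (q - 1) (f x) ∂μ) := by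
        rw [ENNReal.tsum_mul_left]
        congr 2
        have : ∀ x, f x * dyadicSum (q - 1) (f x) =
            ∑' k, lev k ^ (q - 1) * (Ioi (lev k)).indicator id (f x) := by
          intro x
          rw [dyadicSum, ← ENNReal.tsum_mul_left]
          congr with k
          by_cases hk : f x ∈ Ioi (lev k)
          · simp [indicator_of_mem hk, mul_comm]
          · simp [indicator_of_notMem hk]
        simp only [this]
        rw [lintegral_tsum fun k => ((hind k).const_mul _).aemeasurable]
        congr with k
        rw [lintegral_const_mul _ (hind k)]
    _ ≤ 4 ^ q * (D * 4 ^ q * ∫⁻ x, (1 - (4 : ℝ≥0∞)⁻¹ ^ (q - 1))⁻¹ * f x ^ q ∂μ) := by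
        refine mul_le_mul' le_rfl (mul_le_mul' le_rfl (lintegral_mono fun x => ?_))
        calc f x * dyadicSum (q - 1) (f x)
            ≤ f x * ((1 - (4 : ℝ≥0∞)⁻¹ ^ (q - 1))⁻¹ * f x ^ (q - 1)) := by
              gcongr; exact dyadicSum_le hq1 _
          _ = (1 - (4 : ℝ≥0∞)⁻¹ ^ (q - 1))⁻¹ * (f x ^ (1 : ℝ) * f x ^ (q - 1)) := by
              rw [ENNReal.rpow_one]; ring
          _ = _ := by
              rw [← ENNReal.rpow_add_of_nonneg _ _ zero_le_one hq1.le, add_sub_cancel]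
    _ = C * ∫⁻ x, f x ^ q ∂μ := by
        rw [lintegral_const_mul _ (hf.pow_const q), hC]; ring

end IsBallFamily

end Maximal

/-! ### Doubling and the `A_∞` property -/

section Comparable

variable {E : Type*} [NormedAddCommGroup E] [MeasureSpace E]

/-- The geometric consequence of the `𝒜_p` condition on the measure `μ = w dx`. -/
structure IsComparable (B : ℤ → Set E) (μ : Measure E) (p : ℝ) (C : ℝ≥0) : Prop where
  nonneg : 0 ≤ p
  ac : μ ≪ volume
  ne_top : ∀ x k, μ (bl B x k) ≠ ∞
  le : ∀ x k F, MeasurableSet F → F ⊆ bl B x k →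
    μ (bl B x k) * volume F ^ p ≤ C * volume (bl B x k) ^ p * μ F

variable {B : ℤ → Set E} {μ : Measure E} {b : ℝ≥0} {σ : ℤ} {p : ℝ} {C : ℝ≥0}

namespace IsBallFamily

variable (h : IsBallFamily b σ B)
include h

/-- The form in which comparability is used: a fixed share of the Lebesgue measure of a ball carries
a fixed share of its `μ`-measure. The factor `|U|^p`, neither zero nor infinite, is cancelled. -/
theorem measure_bl_le (hμ : IsComparable B μ p C) {x : E} {k : ℤ} {F : Set E}
    (hF : MeasurableSet F) (hFs : F ⊆ bl B x k) {c : ℝ≥0}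
    (hc : volume (bl B x k) ≤ c * volume F) :
    μ (bl B x k) ≤ (C * c ^ p : ℝ≥0) * μ F := by
  have hp := hμ.nonneg
  have hV0 : volume (bl B x k) ^ p ≠ 0 := by
    simp [ENNReal.rpow_eq_zero_iff, h.volume_bl_ne_zero, h.volume_bl_ne_top]
  have hVt : volume (bl B x k) ^ p ≠ ∞ :=
    ENNReal.rpow_ne_top_of_nonneg hp (h.volume_bl_ne_top _ _)
  rw [← ENNReal.mul_le_mul_iff_left hV0 hVt]
  calc μ (bl B x k) * volume (bl B x k) ^ p
      ≤ μ (bl B x k) * (c * volume F) ^ p := by gcongr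
    _ = c ^ p * (μ (bl B x k) * volume F ^ p) := by
        rw [ENNReal.mul_rpow_of_nonneg _ _ hp]; ring
    _ ≤ c ^ p * (C * volume (bl B x k) ^ p * μ F) := mul_le_mul' le_rfl (hμ.le x k F hF hFs)
    _ = _ := by
        rw [ENNReal.coe_mul, ENNReal.coe_rpow_of_nonneg _ hp]; ring

variable [BorelSpace E]

theorem measure_bl_add_le (hμ : IsComparable B μ p C) (x : E) (k : ℤ) {l : ℤ} (hl : 0 ≤ l) :
    μ (bl B x (k + l)) ≤ (C * (b ^ l) ^ p : ℝ≥0) * μ (bl B x k) :=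
  h.measure_bl_le hμ (h.measurableSet_bl x k) (h.bl_mono x (by lia)) (h.volume_bl_add x x k l).le

theorem isDoublingFor (hμ : IsComparable B μ p C) :
    IsDoublingFor B σ μ (C * (b ^ (1 + 2 * σ)) ^ p) := fun x k =>
  h.measure_bl_add_le hμ x k (by linarith [h.one_le])

variable [ProperSpace E]

/-- Selection of a Whitney type covering of an open set of finite measure by balls of which
both the interior and the exterior parts are a fixed proportion. -/
theorem exists_selection {O : Set E} (hO : IsOpen O) (hfin : volume O ≠ ∞) :
    ∃ u : Set (E × ℤ), u.Countable ∧ u.PairwiseDisjoint (fun a => bl B a.1 a.2) ∧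
      O ⊆ ⋃ c ∈ u, bl B c.1 (c.2 + (1 + 2 * σ)) ∧
      ∀ c ∈ u, c.1 ∈ O ∧
        volume (bl B c.1 c.2) ≤ (2 * b : ℝ≥0) * volume (bl B c.1 c.2 ∩ O) ∧
        volume (bl B c.1 c.2) ≤ (2 : ℝ≥0) * volume (bl B c.1 c.2 \ O) := by
  obtain ⟨K, hK⟩ := h.exists_le_zpow (2 * b * (volume O).toNNReal)
  have hbd : ∀ x k, volume (bl B x k) ≤ (2 * b : ℝ≥0) * volume (bl B x k ∩ O) → k ≤ K := by
    intro x k hxk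
    have h1 : ((b ^ k : ℝ≥0) : ℝ≥0∞) ≤ ((2 * b * (volume O).toNNReal : ℝ≥0) : ℝ≥0∞) := by
      rw [← h.volume_bl x k, ENNReal.coe_mul, ENNReal.coe_toNNReal hfin]
      exact hxk.trans (mul_le_mul' le_rfl (measure_mono inter_subset_right))
    exact h.zpow_le_iff.1 ((ENNReal.coe_le_coe.1 h1).trans hK)
  let t : Set (E × ℤ) := {c | c.1 ∈ O ∧
    volume (bl B c.1 c.2) ≤ (2 * b : ℝ≥0) * volume (bl B c.1 c.2 ∩ O) ∧
        volume (bl B c.1 c.2) ≤ (2 : ℝ≥0) * volume (bl B c.1 c.2 \ O)}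
  have ht : ∀ x ∈ O, ∃ m, (x, m) ∈ t := by
    intro x hx
    have hb := h.one_lt
    -- Take the last index at which at least half of the ball lies in `O`. One index further the
    -- inner share is still at least `1/(2b)`, and the outer share exceeds one half.
    obtain ⟨k, hk, hmax⟩ := Int.exists_greatest_of_bdd
      (P := fun k => volume (bl B x k) ≤ 2 * volume (bl B x k ∩ O)) ⟨K, fun k hk => by
        refine hbd x k (hk.trans (mul_le_mul' ?_ le_rfl))
        rw [ENNReal.coe_mul]
        exact le_mul_of_one_le_right' (by exact_mod_cast hb.le)⟩ (by
        obtain ⟨k, hk⟩ := h.exists_bl_subset hO hx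
        refine ⟨k, ?_⟩
        rw [inter_eq_left.2 hk, two_mul]
        exact le_self_add)
    refine ⟨k + 1, hx, ?_, ?_⟩
    · calc volume (bl B x (k + 1)) = b * volume (bl B x k) := by
            rw [h.volume_bl_add x x, zpow_one]
        _ ≤ b * (2 * volume (bl B x k ∩ O)) := by gcongr
        _ ≤ b * (2 * volume (bl B x (k + 1) ∩ O)) := by
            gcongr; exact h.bl_mono x (by lia)
        _ = _ := by push_cast; ring
    · have h1 : 2 * volume (bl B x (k + 1) ∩ O) < volume (bl B x (k + 1)) := by
        by_contra hcon
        have := hmax (k + 1) (not_lt.1 hcon)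
        lia
      have h2 := measure_inter_add_sdiff (μ := volume) (bl B x (k + 1)) hO.measurableSet
      have hV := h.volume_bl_ne_top x (k + 1)
      have h3 : volume (bl B x (k + 1) ∩ O) ≠ ∞ :=
        ((measure_mono inter_subset_left).trans_lt hV.lt_top).ne
      have h4 : volume (bl B x (k + 1) \ O) ≠ ∞ :=
        ((measure_mono sdiff_subset).trans_lt hV.lt_top).ne
      show volume (bl B x (k + 1)) ≤ (2 : ℝ≥0) * volume (bl B x (k + 1) \ O)
      rw [← h2] at h1 ⊢
      lift volume (bl B x (k + 1) ∩ O) to ℝ≥0 using h3 with I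
      lift volume (bl B x (k + 1) \ O) to ℝ≥0 using h4 with J
      norm_cast at h1 ⊢
      have : (2 * I : ℝ) < I + J := by exact_mod_cast h1
      have h5 : (I + J : ℝ) ≤ 2 * J := by linarith
      exact_mod_cast h5
  obtain ⟨u, hut, huc, hud, hu⟩ := h.exists_vitali t K fun c hc => hbd _ _ hc.2.1
  refine ⟨u, huc, hud, fun x hx => ?_, fun c hc => hut hc⟩
  obtain ⟨m, hm⟩ := ht x hx
  obtain ⟨c, hc, hsub⟩ := hu _ hm
  exact mem_biUnion hc (hsub (h.mem_self x m))

/-- One step of the iteration behind `exists_small`: the selected balls are added to `O`. They are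
disjoint and each has a fixed share in `O`, so the volume grows by a bounded factor; by doubling and
comparability, their outer parts carry a fixed share of `μ O`. The bound on the volume of `O` limits
the radii, which keeps `O'` close to `O`. -/
theorem exists_expansion (hμ : IsComparable B μ p C) {O : Set E} (hO : IsOpen O) {L : ℤ}
    (hL : (2 * b : ℝ≥0) * volume O ≤ ((b ^ L : ℝ≥0) : ℝ≥0∞)) :
    ∃ O', IsOpen O' ∧ O ⊆ O' ∧ volume O' ≤ (1 + 2 * b : ℝ≥0) * volume O ∧
      μ O ≤ (C * (b ^ (1 + 2 * σ)) ^ p * (C * 2 ^ p) : ℝ≥0) * μ (O' \ O) ∧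
      ∀ z ∈ O', ∃ y ∈ O, z ∈ bl B y L := by
  have hb0 := h.pos
  have hfin : volume O ≠ ∞ := by
    intro hcon
    rw [hcon, ENNReal.mul_top (by simpa using hb0.ne')] at hL
    exact ENNReal.coe_ne_top (top_le_iff.1 hL)
  obtain ⟨u, huc, hud, hcov, hu⟩ := h.exists_selection hO hfin
  have : Countable u := huc.to_subtype
  have hm : ∀ c ∈ u, MeasurableSet (bl B c.1 c.2) := fun c _ => h.measurableSet_bl _ _
  refine ⟨O ∪ ⋃ c ∈ u, bl B c.1 c.2,
    hO.union (isOpen_biUnion fun c _ => h.isOpen_bl _ _), subset_union_left, ?_, ?_, ?_⟩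
  · calc volume (O ∪ ⋃ c ∈ u, bl B c.1 c.2)
        ≤ volume O + ∑' c : u, volume (bl B c.1.1 c.1.2) :=
          (measure_union_le _ _).trans (add_le_add le_rfl (measure_biUnion_le _ huc _))
      _ ≤ volume O + ∑' c : u, (2 * b : ℝ≥0) * volume (bl B c.1.1 c.1.2 ∩ O) :=
          add_le_add le_rfl (ENNReal.tsum_le_tsum fun c => (hu c c.2).2.1)
      _ ≤ volume O + (2 * b : ℝ≥0) * volume O := by
          rw [ENNReal.tsum_mul_left]
          gcongr
          rw [← measure_biUnion huc (hud.mono fun c => inter_subset_left)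
            fun c hc => (hm c hc).inter hO.measurableSet]
          exact measure_mono (iUnion₂_subset fun c _ => inter_subset_right)
      _ = _ := by push_cast; ring
  · calc μ O ≤ ∑' c : u, μ (bl B c.1.1 (c.1.2 + (1 + 2 * σ))) :=
          (measure_mono hcov).trans (measure_biUnion_le _ huc _)
      _ ≤ ∑' c : u, (C * (b ^ (1 + 2 * σ)) ^ p * (C * 2 ^ p) : ℝ≥0) *
            μ (bl B c.1.1 c.1.2 \ O) := by
          refine ENNReal.tsum_le_tsum fun c => ?_
          rw [ENNReal.coe_mul, mul_assoc]
          refine (h.isDoublingFor hμ _ _).trans (mul_le_mul' le_rfl ?_)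
          exact h.measure_bl_le hμ ((hm c c.2).diff hO.measurableSet) sdiff_subset
            (hu c c.2).2.2
      _ ≤ _ := by
          rw [ENNReal.tsum_mul_left]
          gcongr
          rw [← measure_biUnion huc (hud.mono fun c => sdiff_subset)
            fun c hc => (hm c hc).diff hO.measurableSet]
          refine measure_mono (iUnion₂_subset fun c hc => ?_)
          have hsub : bl B c.1 c.2 ⊆ ⋃ c ∈ u, bl B c.1 c.2 := fun z hz => mem_biUnion hc hz
          exact sdiff_subset_sdiff_left (hsub.trans subset_union_right)
  · rintro z (hz | hz)
    · exact ⟨z, hz, h.mem_self _ _⟩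
    · obtain ⟨c, hc, hzc⟩ := mem_iUnion₂.1 hz
      refine ⟨c.1, (hu c hc).1, h.bl_mono _ ?_ hzc⟩
      have := (hu c hc).2.1.trans
        ((mul_le_mul' le_rfl (measure_mono inter_subset_right)).trans hL)
      rw [h.volume_bl] at this
      exact h.zpow_le_iff.1 (ENNReal.coe_le_coe.1 this)

/-- Comparability applied to a complement only gives some fraction below one; iteration makes the
fraction as small as desired. From `μ O ≤ D μ(O' \ O)` follows `μ O ≤ D/(1+D) μ O'`, and `m`
expansions give the `m`-th power. Each expansion loses one `σ` in the distance to the ball, which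
accounts for the index `k - m * σ`. -/
theorem exists_decay (hμ : IsComparable B μ p C) (D : ℝ≥0)
    (hD : D = C * (b ^ (1 + 2 * σ)) ^ p * (C * 2 ^ p)) (m : ℕ) :
    ∃ ε : ℝ≥0, 0 < ε ∧ ∀ (x : E) (k : ℤ) (O : Set E), IsOpen O →
      (∀ z ∈ O, ∃ y ∈ bl B x k, z ∈ bl B y (k - m * σ)) →
      volume O ≤ ε * volume (bl B x k) →
      μ O ≤ ((D / (1 + D)) ^ m : ℝ≥0) * μ (bl B x (k + σ)) := by
  have hb0 := h.pos
  induction m with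
  | zero =>
    refine ⟨1, one_pos, fun x k O _ hsub _ => ?_⟩
    rw [pow_zero, ENNReal.coe_one, one_mul]
    refine measure_mono fun z hz => ?_
    obtain ⟨y, hy, hzy⟩ := hsub z hz
    exact h.mem_trans hy (by simpa using hzy)
  | succ m ih =>
    obtain ⟨ε, hε, H⟩ := ih
    -- The first entry keeps the volume of the expanded set below the threshold of stage `m`; the
    -- second yields `2b|O| ≤ b^{k-(m+1)σ}`, which bounds the radii in the expansion.
    refine ⟨min (ε / (1 + 2 * b)) ((b ^ ((m + 1) * σ))⁻¹ / (2 * b)),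
      lt_min (by positivity) (by positivity), fun x k O hO hsub hvol => ?_⟩
    have hv1 : volume O ≤ (ε / (1 + 2 * b) : ℝ≥0) * volume (bl B x k) :=
      hvol.trans (mul_le_mul' (ENNReal.coe_le_coe.2 (min_le_left _ _)) le_rfl)
    have hv2 : volume O ≤ ((b ^ ((m + 1) * σ))⁻¹ / (2 * b) : ℝ≥0) * volume (bl B x k) :=
      hvol.trans (mul_le_mul' (ENNReal.coe_le_coe.2 (min_le_right _ _)) le_rfl)
    obtain ⟨O', hO', hOO', hvol', hμ', hnear⟩ :=
      h.exists_expansion hμ hO (L := k - (m + 1 : ℕ) * σ) (by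
        refine (mul_le_mul' le_rfl hv2).trans ?_
        rw [h.volume_bl, ← ENNReal.coe_mul, ← ENNReal.coe_mul, ENNReal.coe_le_coe,
          ← mul_assoc, mul_div_cancel₀ _ (by positivity), sub_eq_add_neg, zpow_add₀ hb0.ne',
          zpow_neg, mul_comm]
        push_cast
        rfl)
    have hO'b : μ O' ≤ ((D / (1 + D)) ^ m : ℝ≥0) * μ (bl B x (k + σ)) := by
      refine H x k O' hO' (fun z hz => ?_) ?_
      · obtain ⟨y, hy, hzy⟩ := hnear z hz
        obtain ⟨y', hy', hyy'⟩ := hsub y hy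
        refine ⟨y', hy', h.bl_mono _ (le_of_eq ?_) (h.mem_trans hyy' hzy)⟩
        push_cast; ring
      · refine (hvol'.trans (mul_le_mul' le_rfl hv1)).trans ?_
        rw [← mul_assoc, ← ENNReal.coe_mul, mul_div_cancel₀ _ (by positivity)]
    have hone : ((1 + D : ℝ≥0) : ℝ≥0∞) * μ O ≤ D * μ O' := by
      have h1 : μ (O' \ O) + μ O = μ O' := by
        rw [← measure_sdiff_add_inter O' hO.measurableSet, inter_eq_right.2 hOO']
      rw [← hD] at hμ'
      rw [← h1, ENNReal.coe_add, ENNReal.coe_one, add_mul, one_mul, mul_add]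
      gcongr
    have hq : μ O ≤ (D / (1 + D) : ℝ≥0) * μ O' := by
      rw [div_eq_inv_mul, ENNReal.coe_mul, mul_assoc, ENNReal.coe_inv (by positivity)]
      rw [mul_comm, ← div_eq_mul_inv, ENNReal.le_div_iff_mul_le (by simp) (by simp), mul_comm]
      exact hone
    calc μ O ≤ (D / (1 + D) : ℝ≥0) * (((D / (1 + D)) ^ m : ℝ≥0) * μ (bl B x (k + σ))) :=
          hq.trans (mul_le_mul' le_rfl hO'b)
      _ = _ := by rw [pow_succ', ENNReal.coe_mul, mul_assoc]

/-- The `𝒜_∞` property: sets of small relative Lebesgue measure have small relative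
`μ`-measure. -/
theorem exists_small (hμ : IsComparable B μ p C) {η : ℝ≥0} (hη : 0 < η) :
    ∃ ε : ℝ≥0, 0 < ε ∧ ∀ (x : E) (k : ℤ) (F : Set E), F ⊆ bl B x k →
      volume F ≤ ε * volume (bl B x k) → μ F ≤ η * μ (bl B x k) := by
  obtain ⟨D, hD⟩ : ∃ D : ℝ≥0, D = C * (b ^ (1 + 2 * σ)) ^ p * (C * 2 ^ p) := ⟨_, rfl⟩
  set D₁ : ℝ≥0 := C * (b ^ σ) ^ p with hD₁
  obtain ⟨m, hm⟩ : ∃ m : ℕ, (D / (1 + D)) ^ m * D₁ ≤ η := by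
    have hq : D / (1 + D) < 1 := by
      rw [div_lt_one (by positivity)]; exact lt_one_add D
    obtain ⟨m, hm⟩ := exists_pow_lt_of_lt_one (show 0 < η / (D₁ + 1) by positivity) hq
    refine ⟨m, (mul_le_mul' hm.le (le_self_add : D₁ ≤ D₁ + 1)).trans ?_⟩
    rw [div_mul_cancel₀ _ (by positivity)]
  obtain ⟨ε, hε, H⟩ := h.exists_decay hμ D hD m
  have : IsLocallyFiniteMeasure (volume : Measure E) :=
    h.isLocallyFiniteMeasure _ h.volume_bl_ne_top
  -- Halving `ε` leaves room to enclose `F` in an open set by outer regularity, so `F` need not be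
  -- measurable.
  refine ⟨ε / 2, by positivity, fun x k F hF hvol => ?_⟩
  have hlt : volume F < ε * volume (bl B x k) := by
    refine hvol.trans_lt ?_
    refine ENNReal.mul_lt_mul_left (h.volume_bl_ne_zero _ _) (h.volume_bl_ne_top _ _) ?_
    exact ENNReal.coe_lt_coe.2 (half_lt_self hε)
  obtain ⟨U, hFU, hU, hUlt⟩ := F.exists_isOpen_lt_of_lt _ hlt
  have hdec := H x k (U ∩ bl B x k) (hU.inter (h.isOpen_bl x k))
    (fun z hz => ⟨z, hz.2, h.mem_self _ _⟩) ((measure_mono inter_subset_left).trans hUlt.le)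
  calc μ F ≤ μ (U ∩ bl B x k) := measure_mono (subset_inter hFU hF)
    _ ≤ ((D / (1 + D)) ^ m : ℝ≥0) * (D₁ * μ (bl B x k)) :=
        hdec.trans (mul_le_mul' le_rfl (h.measure_bl_add_le hμ x k (by linarith [h.one_le])))
    _ ≤ η * μ (bl B x k) := by
        rw [← mul_assoc, ← ENNReal.coe_mul]
        gcongr

end IsBallFamily

end Comparable

/-! ### Muckenhoupt weights: comparability and maximal inequalities -/

section Weights

variable {E : Type*} [NormedAddCommGroup E] [MeasureSpace E]

/-- A weight `W` together with its dual weight `S = W ^ (-1 / (p - 1))`, satisfying the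
`𝒜_p` condition. -/
structure IsDualPair (B : ℤ → Set E) (p : ℝ) (W S : E → ℝ≥0∞) (C : ℝ≥0) : Prop where
  one_lt : 1 < p
  aemeasurable : AEMeasurable W volume
  aemeasurable' : AEMeasurable S volume
  mul_eq : ∀ᵐ x, W x * S x ^ (p - 1) = 1
  le : ∀ x k, (∫⁻ y in bl B x k, W y) * (∫⁻ y in bl B x k, S y) ^ (p - 1) ≤
    C * volume (bl B x k) ^ p

variable {B : ℤ → Set E} {b : ℝ≥0} {σ : ℤ} {p : ℝ} {C : ℝ≥0} {W S : E → ℝ≥0∞}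

theorem eq_rpow_of_mul_rpow_eq_one {p : ℝ} (hp : 1 < p) {u v : ℝ≥0∞} (huv : u * v ^ (p - 1) = 1) :
    u ≠ 0 ∧ u ≠ ∞ ∧ v ≠ 0 ∧ v ≠ ∞ ∧ u = v ^ (-(p - 1)) ∧ v = u ^ (-(1 / (p - 1))) := by
  have hp1 : 0 < p - 1 := by linarith
  have hu0 : u ≠ 0 := by rintro rfl; simp at huv
  have hv0 : v ≠ 0 := by
    rintro rfl; simp [ENNReal.zero_rpow_of_pos hp1] at huv
  have hvt : v ≠ ∞ := by
    rintro rfl; rw [ENNReal.top_rpow_of_pos hp1, ENNReal.mul_top hu0] at huv; simp at huv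
  have hu : u = v ^ (-(p - 1)) := by
    rw [ENNReal.rpow_neg]; exact ENNReal.eq_inv_of_mul_eq_one_left huv
  have hut : u ≠ ∞ := by
    rw [hu]; exact ENNReal.rpow_ne_top_of_ne_zero hv0 hvt
  refine ⟨hu0, hut, hv0, hvt, hu, ?_⟩
  rw [hu, ← ENNReal.rpow_mul]
  rw [show -(p - 1) * -(1 / (p - 1)) = 1 by field_simp, ENNReal.rpow_one]

namespace IsDualPair

/-- Both conditions are raised to the power `1/(p-1)`, which equals `q - 1` for the dual exponent `q
= p/(p-1)`. -/
theorem symm (hW : IsDualPair B p W S C) :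
    IsDualPair B (p / (p - 1)) S W (C ^ (1 / (p - 1))) := by
  have hp := hW.one_lt
  have hp1 : 0 < p - 1 := by linarith
  have hq : p / (p - 1) - 1 = 1 / (p - 1) := by field_simp; ring
  refine ⟨(one_lt_div hp1).2 (by linarith), hW.aemeasurable', hW.aemeasurable, ?_, ?_⟩
  · filter_upwards [hW.mul_eq] with x hx
    have := congrArg (· ^ (1 / (p - 1))) hx
    rw [ENNReal.mul_rpow_of_nonneg _ _ (by positivity), ← ENNReal.rpow_mul,
      mul_one_div_cancel hp1.ne', ENNReal.rpow_one, ENNReal.one_rpow] at this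
    rw [hq, mul_comm]; exact this
  · intro x k
    have := ENNReal.rpow_le_rpow (hW.le x k) (show 0 ≤ 1 / (p - 1) by positivity)
    rw [ENNReal.mul_rpow_of_nonneg _ _ (by positivity), ← ENNReal.rpow_mul,
      mul_one_div_cancel hp1.ne', ENNReal.rpow_one,
      ENNReal.mul_rpow_of_nonneg _ _ (by positivity), ← ENNReal.rpow_mul,
      ← ENNReal.coe_rpow_of_nonneg _ (by positivity), mul_one_div] at this
    rw [hq, mul_comm]; exact this

/-- Hölder's inequality for `1 = W^{1/p} S^{(p-1)/p}`. -/
theorem measure_le_rpow [BorelSpace E] (hW : IsDualPair B p W S C) (F : Set E) :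
    volume F ^ p ≤ (∫⁻ y in F, W y) * (∫⁻ y in F, S y) ^ (p - 1) := by
  have hp := hW.one_lt
  have hp0 : 0 < p := by linarith
  have hp1 : 0 < p - 1 := by linarith
  have hpq : p.HolderConjugate (p / (p - 1)) := Real.HolderConjugate.conjExponent hp
  have hq0 : 0 < p / (p - 1) := by positivity
  have hH := ENNReal.lintegral_mul_le_Lp_mul_Lq (volume.restrict F) hpq
    (f := fun x => W x ^ (1 / p)) (g := fun x => S x ^ (1 / (p / (p - 1))))
    (hW.aemeasurable.restrict.pow_const _) (hW.aemeasurable'.restrict.pow_const _)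
  have h1 : ∫⁻ x in F, ((fun x => W x ^ (1 / p)) * fun x => S x ^ (1 / (p / (p - 1)))) x =
      volume F := by
    rw [← setLIntegral_one]
    refine lintegral_congr_ae (ae_restrict_of_ae (hW.mul_eq.mono fun x hx => ?_))
    have := congrArg (· ^ (1 / p)) hx
    rw [ENNReal.mul_rpow_of_nonneg _ _ (by positivity), ← ENNReal.rpow_mul,
      ENNReal.one_rpow] at this
    simp only [Pi.mul_apply]
    rw [← this]; congr 2; field_simp
  simp only [← ENNReal.rpow_mul] at hH
  rw [h1, one_div_mul_cancel hp0.ne', one_div_mul_cancel hq0.ne'] at hH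
  simp only [ENNReal.rpow_one] at hH
  refine (ENNReal.rpow_le_rpow hH hp0.le).trans (le_of_eq ?_)
  rw [ENNReal.mul_rpow_of_nonneg _ _ hp0.le, ← ENNReal.rpow_mul, ← ENNReal.rpow_mul,
    one_div_mul_cancel hp0.ne', ENNReal.rpow_one]
  congr 2; field_simp

end IsDualPair

namespace IsBallFamily

variable (h : IsBallFamily b σ B)
include h

theorem lintegral_dual_ne_zero [BorelSpace E] (hW : IsDualPair B p W S C) (x : E) (k : ℤ) :
    ∫⁻ y in bl B x k, S y ≠ 0 := by
  intro h0
  have hp1 : 0 < p - 1 := by linarith [hW.one_lt]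
  have := hW.measure_le_rpow (bl B x k)
  rw [h0, ENNReal.zero_rpow_of_pos hp1, mul_zero, nonpos_iff_eq_zero,
    ENNReal.rpow_eq_zero_iff_of_pos (by linarith)] at this
  exact h.volume_bl_ne_zero x k this

/-- The other factor of the `𝒜_p` product is nonzero by Hölder, so an infinite integral of `W` would
make the product infinite. -/
theorem lintegral_weight_ne_top [BorelSpace E] (hW : IsDualPair B p W S C) (x : E) (k : ℤ) :
    ∫⁻ y in bl B x k, W y ≠ ∞ := by
  intro h0
  have hp1 : 0 < p - 1 := by linarith [hW.one_lt]
  have := hW.le x k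
  rw [h0, ENNReal.top_mul] at this
  · exact ENNReal.mul_ne_top ENNReal.coe_ne_top (ENNReal.rpow_ne_top_of_nonneg
      (by linarith) (h.volume_bl_ne_top x k)) (top_le_iff.1 this)
  · rw [Ne, ENNReal.rpow_eq_zero_iff_of_pos hp1]
    exact h.lintegral_dual_ne_zero hW x k

variable [BorelSpace E]

/-- Hölder on `F`, then the integral of `S` over `F` is enlarged to the whole ball, where the `𝒜_p`
condition absorbs it. -/
theorem isComparable_of_isDualPair (hW : IsDualPair B p W S C) :
    IsComparable B (volume.withDensity W) p C := by
  have hp := hW.one_lt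
  refine ⟨by linarith, withDensity_absolutelyContinuous _ _, fun x k => ?_,
    fun x k F hF hFs => ?_⟩
  · rw [withDensity_apply _ (h.measurableSet_bl x k)]
    exact h.lintegral_weight_ne_top hW x k
  · rw [withDensity_apply _ (h.measurableSet_bl x k), withDensity_apply _ hF]
    calc (∫⁻ y in bl B x k, W y) * volume F ^ p
        ≤ (∫⁻ y in bl B x k, W y) *
          ((∫⁻ y in F, W y) * (∫⁻ y in bl B x k, S y) ^ (p - 1)) := by
          refine mul_le_mul' le_rfl ((hW.measure_le_rpow F).trans ?_)
          refine mul_le_mul' le_rfl (ENNReal.rpow_le_rpow (lintegral_mono_set hFs) ?_)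
          linarith
      _ = ((∫⁻ y in bl B x k, W y) * (∫⁻ y in bl B x k, S y) ^ (p - 1)) *
          ∫⁻ y in F, W y := by ring
      _ ≤ _ := mul_le_mul' (hW.le x k) le_rfl

variable [ProperSpace E]

omit [ProperSpace E] in
/-- The pointwise bound behind Lerner's proof of Muckenhoupt's theorem. -/
theorem maxFn_rpow_le (hW : IsDualPair B p W S C) {f : E → ℝ≥0∞} (hf : AEMeasurable f volume)
    (x : E) :
    maxFn B volume f x ^ (p - 1) ≤ C * maxFn B (volume.withDensity W) (fun y =>
      maxFn B (volume.withDensity S) (fun z => f z * (S z)⁻¹) y ^ (p - 1) * (W y)⁻¹) x := by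
  have hp1 : 0 < p - 1 := by linarith [hW.one_lt]
  set μ := volume.withDensity W with hμ
  set ν := volume.withDensity S with hν
  set φ := maxFn B ν (fun z => f z * (S z)⁻¹) with hφ
  have hφm : Measurable φ := h.measurable_maxFn _
  suffices H : maxFn B volume f x ≤
      (C * maxFn B μ (fun y => φ y ^ (p - 1) * (W y)⁻¹) x) ^ (1 / (p - 1)) by
    rwa [one_div, ENNReal.le_rpow_inv_iff hp1] at H
  refine maxFn_le_iff.2 fun y k hx => ?_
  rw [one_div, ENNReal.le_rpow_inv_iff hp1]
  set U := bl B y k with hU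
  have hUm : MeasurableSet U := h.measurableSet_bl y k
  have hWae : ∀ᵐ z ∂(volume.restrict U), W z * S z ^ (p - 1) = 1 := ae_restrict_of_ae hW.mul_eq
  have hνU : ν U = ∫⁻ z in U, S z := withDensity_apply _ hUm
  have hμU : μ U = ∫⁻ z in U, W z := withDensity_apply _ hUm
  have hA : ∫⁻ z in U, f z * (S z)⁻¹ ∂ν = ∫⁻ z in U, f z := by
    rw [hν, restrict_withDensity hUm, lintegral_withDensity_eq_lintegral_mul₀
      (g := fun z => f z * (S z)⁻¹) hW.aemeasurable'.restrict (hf.restrict.mul hW.aemeasurable'.restrict.inv)]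
    refine lintegral_congr_ae (hWae.mono fun z hz => ?_)
    obtain ⟨-, -, h0, ht, -⟩ := eq_rpow_of_mul_rpow_eq_one hW.one_lt hz
    simp only [Pi.mul_apply]
    rw [mul_comm (f z), ← mul_assoc, ENNReal.mul_inv_cancel h0 ht, one_mul]
  have hG : ∫⁻ z in U, φ z ^ (p - 1) * (W z)⁻¹ ∂μ = ∫⁻ z in U, φ z ^ (p - 1) := by
    rw [hμ, restrict_withDensity hUm, lintegral_withDensity_eq_lintegral_mul₀
      (g := fun z => φ z ^ (p - 1) * (W z)⁻¹) hW.aemeasurable.restrict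
        (((hφm.pow_const _).aemeasurable).mul hW.aemeasurable.restrict.inv)]
    refine lintegral_congr_ae (hWae.mono fun z hz => ?_)
    obtain ⟨h0, ht, -⟩ := eq_rpow_of_mul_rpow_eq_one hW.one_lt hz
    simp only [Pi.mul_apply]
    rw [mul_comm (φ z ^ (p - 1)), ← mul_assoc, ENNReal.mul_inv_cancel h0 ht, one_mul]
  -- The `ν`-average of `f/S` over `U` is at most `φ` at every point of `U`; its power is integrated
  -- over `U` in Lebesgue measure.
  have hlow : volume U * ((∫⁻ z in U, f z) / ν U) ^ (p - 1) ≤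
      ∫⁻ z in U, φ z ^ (p - 1) * (W z)⁻¹ ∂μ := by
    rw [hG, mul_comm, ← setLIntegral_const]
    refine setLIntegral_mono (hφm.pow_const _) fun z hz => ?_
    gcongr
    rw [← hA]
    exact lintegral_div_le_maxFn _ hz
  have hν0 : ν U ≠ 0 := by rw [hνU]; exact h.lintegral_dual_ne_zero hW y k
  have hνt : ν U ≠ ∞ := by rw [hνU]; exact h.lintegral_weight_ne_top hW.symm y k
  have hμ0 : μ U ≠ 0 := by rw [hμU]; exact h.lintegral_dual_ne_zero hW.symm y k
  have hμt : μ U ≠ ∞ := by rw [hμU]; exact h.lintegral_weight_ne_top hW y k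
  have hV0 : volume U ≠ 0 := h.volume_bl_ne_zero y k
  have hVt : volume U ≠ ∞ := h.volume_bl_ne_top y k
  have hle : μ U * ν U ^ (p - 1) ≤ C * volume U ^ p := by
    rw [hμU, hνU]; exact hW.le y k
  -- The `𝒜_p` condition solved for `|U|^{-(p-1)}`; it trades the Lebesgue average for a `ν`-average
  -- inside a `μ`-average.
  have hconst : (volume U ^ (p - 1))⁻¹ ≤ C * (volume U * (ν U ^ (p - 1))⁻¹ / μ U) := by
    have hn0 : ν U ^ (p - 1) ≠ 0 := by
      simp [ENNReal.rpow_eq_zero_iff, hν0, hνt]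
    have hnt : ν U ^ (p - 1) ≠ ∞ := ENNReal.rpow_ne_top_of_nonneg hp1.le hνt
    have hv0 : volume U ^ (p - 1) ≠ 0 := by
      simp [ENNReal.rpow_eq_zero_iff, hV0, hVt]
    have hvt : volume U ^ (p - 1) ≠ ∞ := ENNReal.rpow_ne_top_of_nonneg hp1.le hVt
    have hvp : volume U ^ p = volume U * volume U ^ (p - 1) := by
      conv_lhs => rw [show p = 1 + (p - 1) by ring]
      rw [ENNReal.rpow_add _ _ hV0 hVt, ENNReal.rpow_one]
    rw [hvp] at hle
    have : C * (volume U * (ν U ^ (p - 1))⁻¹ / μ U) = C * volume U / (μ U * ν U ^ (p - 1)) := by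
      rw [div_eq_mul_inv, div_eq_mul_inv, ENNReal.mul_inv (Or.inl hμ0) (Or.inl hμt)]; ring
    rw [this, ENNReal.le_div_iff_mul_le (Or.inl (mul_ne_zero hμ0 hn0))
      (Or.inl (ENNReal.mul_ne_top hμt hnt)), mul_comm, ← div_eq_mul_inv]
    exact ENNReal.div_le_of_le_mul (by rw [mul_assoc]; exact hle)
  calc ((∫⁻ z in U, f z) / volume U) ^ (p - 1)
      = (∫⁻ z in U, f z) ^ (p - 1) * (volume U ^ (p - 1))⁻¹ := by
        rw [ENNReal.div_rpow_of_nonneg _ _ hp1.le, div_eq_mul_inv]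
    _ ≤ (∫⁻ z in U, f z) ^ (p - 1) * (C * (volume U * (ν U ^ (p - 1))⁻¹ / μ U)) := by
        gcongr
    _ = C * (volume U * ((∫⁻ z in U, f z) / ν U) ^ (p - 1) / μ U) := by
        rw [ENNReal.div_rpow_of_nonneg _ _ hp1.le, div_eq_mul_inv, div_eq_mul_inv,
          div_eq_mul_inv]; ring
    _ ≤ C * ((∫⁻ z in U, φ z ^ (p - 1) * (W z)⁻¹ ∂μ) / μ U) := by gcongr
    _ ≤ _ := mul_le_mul' le_rfl (lintegral_div_le_maxFn _ hx)

/-- Muckenhoupt's theorem. -/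
theorem exists_lintegral_maxFn_le (hW : IsDualPair B p W S C) :
    ∃ C' : ℝ≥0, ∀ f : E → ℝ≥0∞, AEMeasurable f volume →
      ∫⁻ x, maxFn B volume f x ^ p ∂(volume.withDensity W) ≤
        C' * ∫⁻ x, f x ^ p ∂(volume.withDensity W) := by
  have hp := hW.one_lt
  have hp0 : 0 < p := by linarith
  have hp1 : 0 < p - 1 := by linarith
  set q := p / (p - 1) with hq
  have hq1 : 1 < q := hW.symm.one_lt
  have hq0 : 0 < q := by linarith
  have hqp : (p - 1) * q = p := by rw [hq]; field_simp
  set μ := volume.withDensity W with hμ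
  set ν := volume.withDensity S with hν
  obtain ⟨C₁, hC₁⟩ := h.lintegral_maxFn_rpow_le
    (h.isDoublingFor (h.isComparable_of_isDualPair hW)) hq1
  obtain ⟨C₂, hC₂⟩ := h.lintegral_maxFn_rpow_le
    (h.isDoublingFor (h.isComparable_of_isDualPair hW.symm)) hp
  refine ⟨C ^ q * C₁ * C₂, fun f hf => ?_⟩
  set φ := maxFn B ν (fun z => f z * (S z)⁻¹) with hφ
  have hφm : Measurable φ := h.measurable_maxFn _
  have hGm : AEMeasurable (fun y => φ y ^ (p - 1) * (W y)⁻¹) volume :=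
    (hφm.pow_const _).aemeasurable.mul hW.aemeasurable.inv
  have hfS : AEMeasurable (fun z => f z * (S z)⁻¹) volume := hf.mul hW.aemeasurable'.inv
  -- Since `q - 1 = 1/(p-1)`, one has `W^{1-q} = S`; similarly `S^{1-p} = W` below. These two
  -- changes of weight link the bound of `M_μ` on `L^q(μ)` to that of `M_ν` on `L^p(ν)`, and the
  -- latter to the norm of `f` in `L^p(μ)`.
  have hGq : ∫⁻ y, (φ y ^ (p - 1) * (W y)⁻¹) ^ q ∂μ = ∫⁻ y, φ y ^ p ∂ν := by
    rw [hμ, hν, lintegral_withDensity_eq_lintegral_mul₀ hW.aemeasurable (hGm.pow_const q),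
      lintegral_withDensity_eq_lintegral_mul₀ hW.aemeasurable' (hφm.pow_const p).aemeasurable]
    refine lintegral_congr_ae (hW.mul_eq.mono fun z hz => ?_)
    obtain ⟨h0, ht, -, -, -, hS⟩ := eq_rpow_of_mul_rpow_eq_one hp hz
    simp only [Pi.mul_apply]
    rw [ENNReal.mul_rpow_of_nonneg _ _ hq0.le, ← ENNReal.rpow_mul, hqp, hS,
      ← ENNReal.rpow_neg_one, ← ENNReal.rpow_mul]
    have : W z * W z ^ (-1 * q) = W z ^ (-(1 / (p - 1))) := by
      conv_lhs => rw [← ENNReal.rpow_one (W z), ← ENNReal.rpow_mul, ← ENNReal.rpow_add _ _ h0 ht]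
      congr 1; rw [hq]; field_simp; ring
    rw [← this]; ring
  have hfp : ∫⁻ z, (f z * (S z)⁻¹) ^ p ∂ν = ∫⁻ z, f z ^ p ∂μ := by
    rw [hμ, hν, lintegral_withDensity_eq_lintegral_mul₀ hW.aemeasurable (hf.pow_const p),
      lintegral_withDensity_eq_lintegral_mul₀ hW.aemeasurable' (hfS.pow_const p)]
    refine lintegral_congr_ae (hW.mul_eq.mono fun z hz => ?_)
    obtain ⟨-, -, h0, ht, hW', -⟩ := eq_rpow_of_mul_rpow_eq_one hp hz
    simp only [Pi.mul_apply]
    rw [ENNReal.mul_rpow_of_nonneg _ _ hp0.le, hW', ← ENNReal.rpow_neg_one, ← ENNReal.rpow_mul]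
    have : S z * S z ^ (-1 * p) = S z ^ (-(p - 1)) := by
      conv_lhs => rw [← ENNReal.rpow_one (S z), ← ENNReal.rpow_mul, ← ENNReal.rpow_add _ _ h0 ht]
      congr 1; ring
    rw [← this]; ring
  calc ∫⁻ x, maxFn B volume f x ^ p ∂μ
      ≤ ∫⁻ x, (C ^ q : ℝ≥0) * maxFn B μ (fun y => φ y ^ (p - 1) * (W y)⁻¹) x ^ q ∂μ := by
        refine lintegral_mono fun x => ?_
        have := ENNReal.rpow_le_rpow (h.maxFn_rpow_le hW hf x) hq0.le
        rwa [← ENNReal.rpow_mul, hqp, ENNReal.mul_rpow_of_nonneg _ _ hq0.le,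
          ← ENNReal.coe_rpow_of_nonneg _ hq0.le] at this
    _ = (C ^ q : ℝ≥0) * ∫⁻ x, maxFn B μ (fun y => φ y ^ (p - 1) * (W y)⁻¹) x ^ q ∂μ :=
        lintegral_const_mul _ ((h.measurable_maxFn _).pow_const q)
    _ ≤ (C ^ q : ℝ≥0) * (C₁ * (C₂ * ∫⁻ z, f z ^ p ∂μ)) := by
        refine mul_le_mul' le_rfl ((hC₁ _ (hGm.mono_ac
          (withDensity_absolutelyContinuous _ _))).trans (mul_le_mul' le_rfl ?_))
        rw [hGq, ← hfp]
        exact hC₂ _ (hfS.mono_ac (withDensity_absolutelyContinuous _ _))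
    _ = _ := by push_cast; ring

end IsBallFamily

/-- The `𝒜_1` condition for a weight which is positive and finite almost everywhere. -/
structure IsAOne (B : ℤ → Set E) (W : E → ℝ≥0∞) (C : ℝ≥0) : Prop where
  aemeasurable : AEMeasurable W volume
  pos : ∀ᵐ x, W x ≠ 0
  lt_top : ∀ᵐ x, W x ≠ ∞
  le : ∀ x k, (∫⁻ y in bl B x k, W y) *
    essSup (fun y => (W y)⁻¹) (volume.restrict (bl B x k)) ≤ C * volume (bl B x k)

namespace IsBallFamily

variable (h : IsBallFamily b σ B)
include h

omit h in
theorem one_le_essSup_mul (hW : IsAOne B W C) (x : E) (k : ℤ) :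
    ∀ᵐ y ∂(volume.restrict (bl B x k)),
      1 ≤ essSup (fun y => (W y)⁻¹) (volume.restrict (bl B x k)) * W y := by
  filter_upwards [ENNReal.ae_le_essSup (μ := volume.restrict (bl B x k)) (fun y => (W y)⁻¹),
    ae_restrict_of_ae hW.pos, ae_restrict_of_ae hW.lt_top] with y hy h0 ht
  rw [← ENNReal.inv_mul_cancel h0 ht]
  gcongr

variable [BorelSpace E]

/-- With `e` the essential supremum of `1/W` on the ball, `|F| ≤ e μ(F)`, while `μ(U) e ≤ C|U|`. If
`μ(U)` were infinite, `e` would have to vanish, which is impossible for a finite `W`. -/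
theorem isComparable_of_isAOne (hW : IsAOne B W C) :
    IsComparable B (volume.withDensity W) 1 C := by
  refine ⟨zero_le_one, withDensity_absolutelyContinuous _ _, fun x k => ?_,
    fun x k F hF hFs => ?_⟩
  · rw [withDensity_apply _ (h.measurableSet_bl x k)]
    intro htop
    have hle := hW.le x k
    rw [htop, ENNReal.top_mul] at hle
    · exact ENNReal.mul_ne_top ENNReal.coe_ne_top (h.volume_bl_ne_top x k) (top_le_iff.1 hle)
    · intro h0
      have h1 := one_le_essSup_mul hW x k
      rw [h0] at h1
      simp only [zero_mul, nonpos_iff_eq_zero, one_ne_zero] at h1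
      rw [ae_iff] at h1
      simp [h.volume_bl_ne_zero] at h1
  · rw [withDensity_apply _ (h.measurableSet_bl x k), withDensity_apply _ hF, ENNReal.rpow_one,
      ENNReal.rpow_one]
    set e := essSup (fun y => (W y)⁻¹) (volume.restrict (bl B x k)) with he
    have h1 : volume F ≤ e * ∫⁻ y in F, W y := by
      rw [← setLIntegral_one, ← lintegral_const_mul'' _ hW.aemeasurable.restrict]
      exact lintegral_mono_ae (ae_restrict_of_ae_restrict_of_subset hFs
        (one_le_essSup_mul hW x k))
    calc (∫⁻ y in bl B x k, W y) * volume F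
        ≤ (∫⁻ y in bl B x k, W y) * (e * ∫⁻ y in F, W y) := by gcongr
      _ = ((∫⁻ y in bl B x k, W y) * e) * ∫⁻ y in F, W y := by ring
      _ ≤ _ := mul_le_mul' (hW.le x k) le_rfl

variable [ProperSpace E]

/-- The `𝒜_1` condition gives the pointwise bound `Mf ≤ (C+1) M_μ f`, and `M_μ` has weak type
because `μ` is doubling. The constant is `C + 1` because it is divided by and `C` may be zero. -/
theorem exists_maxFn_weak_of_isAOne (hW : IsAOne B W C) :
    ∃ C' : ℝ≥0, ∀ f : E → ℝ≥0∞, AEMeasurable f volume → ∀ t : ℝ≥0∞,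
      t * volume.withDensity W {x | t < maxFn B volume f x} ≤
        C' * ∫⁻ x, f x ∂(volume.withDensity W) := by
  have hcomp := h.isComparable_of_isAOne hW
  set μ := volume.withDensity W with hμ
  have hC : ((C + 1 : ℝ≥0) : ℝ≥0∞) ≠ 0 := by simp
  refine ⟨(C + 1) * (C * (b ^ (1 + 2 * σ)) ^ (1 : ℝ)), fun f hf t => ?_⟩
  have hpt : ∀ x, maxFn B volume f x ≤ (C + 1 : ℝ≥0) * maxFn B μ f x := by
    intro x
    refine maxFn_le_iff.2 fun y k hx => ?_
    refine le_trans ?_ (mul_le_mul' le_rfl (lintegral_div_le_maxFn f hx))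
    have hUm := h.measurableSet_bl y k
    set e := essSup (fun z => (W z)⁻¹) (volume.restrict (bl B y k)) with he
    have h1 : ∫⁻ z in bl B y k, f z ≤ e * ∫⁻ z in bl B y k, f z ∂μ := by
      rw [hμ, restrict_withDensity hUm, lintegral_withDensity_eq_lintegral_mul₀
        hW.aemeasurable.restrict hf.restrict, ← lintegral_const_mul'' _
        (hW.aemeasurable.restrict.mul hf.restrict)]
      refine lintegral_mono_ae ((one_le_essSup_mul hW y k).mono fun z hz => ?_)
      simp only [Pi.mul_apply]
      rw [← mul_assoc]
      exact le_mul_of_one_le_left' hz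
    have hμU : μ (bl B y k) = ∫⁻ z in bl B y k, W z := withDensity_apply _ hUm
    have hμ0 : μ (bl B y k) ≠ 0 := by
      rw [hμU, Ne, lintegral_eq_zero_iff' hW.aemeasurable.restrict]
      intro h0
      have : ∀ᵐ z ∂(volume.restrict (bl B y k)), False := by
        filter_upwards [h0, ae_restrict_of_ae hW.pos] with z hz hz' using hz' hz
      rw [ae_iff] at this
      simp [h.volume_bl_ne_zero] at this
    have hμt : μ (bl B y k) ≠ ∞ := hcomp.ne_top y k
    have h2 : μ (bl B y k) * e ≤ (C + 1 : ℝ≥0) * volume (bl B y k) := by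
      rw [hμU]
      refine (hW.le y k).trans (mul_le_mul' ?_ le_rfl)
      exact ENNReal.coe_le_coe.2 le_self_add
    refine ENNReal.div_le_of_le_mul (h1.trans ?_)
    have h3 : e ≤ (C + 1 : ℝ≥0) * volume (bl B y k) / μ (bl B y k) := by
      rw [ENNReal.le_div_iff_mul_le (Or.inl hμ0) (Or.inl hμt), mul_comm]
      exact h2
    refine (mul_le_mul' h3 le_rfl).trans (le_of_eq ?_)
    rw [div_eq_mul_inv, div_eq_mul_inv]; ring
  have hsub : {x | t < maxFn B volume f x} ⊆ {x | t / (C + 1 : ℝ≥0) < maxFn B μ f x} := by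
    intro x hx
    refine ENNReal.div_lt_of_lt_mul ?_
    rw [mul_comm]
    exact lt_of_lt_of_le hx (hpt x)
  calc t * μ {x | t < maxFn B volume f x}
      ≤ ((C + 1 : ℝ≥0) * (t / (C + 1 : ℝ≥0))) * μ {x | t / (C + 1 : ℝ≥0) < maxFn B μ f x} := by
        rw [ENNReal.mul_div_cancel hC ENNReal.coe_ne_top]
        exact mul_le_mul' le_rfl (measure_mono hsub)
    _ ≤ (C + 1 : ℝ≥0) * ((C * (b ^ (1 + 2 * σ)) ^ (1 : ℝ) : ℝ≥0) * ∫⁻ x, f x ∂μ) := by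
        rw [mul_assoc]
        exact mul_le_mul' le_rfl (h.maxFn_weak (h.isDoublingFor hcomp) f _)
    _ = _ := by rw [ENNReal.coe_mul (C + 1), mul_assoc]

end IsBallFamily

end Weights

/-! ### Test functions, kernels and the operator away from the support -/

section Operators

set_option linter.unusedSectionVars false

variable {E : Type*} [NormedAddCommGroup E] [MeasureSpace E]
variable {B₁ B₂ : Type*} [NormedAddCommGroup B₁] [NormedSpace ℂ B₁]
  [NormedAddCommGroup B₂] [NormedSpace ℂ B₂]

/-- Bounded measurable functions with bounded support. -/
structure IsTest (f : E → B₁) : Prop where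
  memLp_top : MemLp f ∞ volume
  bounded : Bornology.IsBounded (Function.support f)

namespace IsTest

variable {f g : E → B₁}

omit [NormedSpace ℂ B₁] in
theorem aestronglyMeasurable (hf : IsTest f) : AEStronglyMeasurable f volume := hf.memLp_top.1

omit [NormedSpace ℂ B₁] in
theorem indicator (hf : IsTest f) {s : Set E} (hs : MeasurableSet s) : IsTest (s.indicator f) :=
  ⟨hf.memLp_top.indicator hs, hf.bounded.subset (by
    rw [Set.support_indicator]; exact inter_subset_right)⟩

omit [NormedSpace ℂ B₁] in
theorem add (hf : IsTest f) (hg : IsTest g) : IsTest (f + g) :=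
  ⟨hf.memLp_top.add hg.memLp_top, (hf.bounded.union hg.bounded).subset (Function.support_add f g)⟩

omit [NormedSpace ℂ B₁] in
theorem sub (hf : IsTest f) (hg : IsTest g) : IsTest (f - g) :=
  ⟨hf.memLp_top.sub hg.memLp_top, (hf.bounded.union hg.bounded).subset (Function.support_sub f g)⟩

omit [NormedSpace ℂ B₁] in
theorem zero : IsTest (0 : E → B₁) := ⟨MemLp.zero, by simp⟩

omit [NormedSpace ℂ B₁] in
theorem sum {ι : Type*} (s : Finset ι) {F : ι → E → B₁} (hF : ∀ i, IsTest (F i)) :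
    IsTest (∑ i ∈ s, F i) := by
  classical
  induction s using Finset.induction_on with
  | empty => simpa using zero
  | insert i s hi ih => rw [Finset.sum_insert hi]; exact (hF i).add ih

omit [NormedSpace ℂ B₁] in
theorem const_indicator {s : Set E} (hs : MeasurableSet s) (hb : Bornology.IsBounded s) (a : B₁) :
    IsTest (s.indicator fun _ => a) :=
  ⟨(memLp_top_const a).indicator hs, hb.subset Set.support_indicator_subset⟩

omit [NormedSpace ℂ B₁] in
theorem memLp [BorelSpace E] {b : ℝ≥0} {σ : ℤ} {B : ℤ → Set E} (h : IsBallFamily b σ B)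
    (hf : IsTest f) (μ : Measure E) (hμ : μ ≪ volume) (hfin : ∀ x k, μ (bl B x k) ≠ ∞)
    (p : ℝ≥0∞) : MemLp f p μ := by
  obtain ⟨k, hk⟩ := h.exists_subset_bl hf.bounded 0
  have h1 : (bl B (0 : E) k).indicator f = f := indicator_eq_self.2 hk
  rw [← h1, memLp_indicator_iff_restrict (h.measurableSet_bl 0 k)]
  have : IsFiniteMeasure (μ.restrict (bl B (0 : E) k)) :=
    ⟨by simpa using (hfin 0 k).lt_top⟩
  have h2 : MemLp f ∞ μ := by
    refine ⟨hf.memLp_top.1.mono_ac hμ, ?_⟩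
    have := hf.memLp_top.2
    rw [eLpNorm_exponent_top] at this ⊢
    exact (eLpNormEssSup_mono_measure f hμ).trans_lt this
  exact (h2.restrict _).mono_exponent le_top

omit [NormedSpace ℂ B₁] in
theorem memLp_volume [BorelSpace E] {b : ℝ≥0} {σ : ℤ} {B : ℤ → Set E} (h : IsBallFamily b σ B)
    (hf : IsTest f) (p : ℝ≥0∞) : MemLp f p volume :=
  hf.memLp h volume Measure.AbsolutelyContinuous.rfl h.volume_bl_ne_top p

end IsTest

/-- Size and regularity of a kernel, with `θ` in place of `b ^ (-ε)`. -/
structure IsKernel (B : ℤ → Set E) (b : ℝ≥0) (σ : ℤ) (K : E → E → B₁ →L[ℂ] B₂) (C θ : ℝ≥0) :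
    Prop where
  lt_one : θ < 1
  size : ∀ x y k, x ∉ bl B y k → ‖K x y‖₊ ≤ C * (b ^ k)⁻¹
  reg : ∀ c z x m (i : ℕ), z ∈ bl B c m → x ∉ bl B c (m + 2 * σ + i) →
    ‖K c x - K z x‖₊ + ‖K x c - K x z‖₊ ≤ C * (b ^ (m + 2 * σ + i))⁻¹ * θ ^ i

/-- The sum over shells that dominates the differences of a kernel. -/
noncomputable def shellSum (B : ℤ → Set E) (b : ℝ≥0) (σ : ℤ) (C θ : ℝ≥0) (c : E) (m : ℤ) (x : E) :
    ℝ≥0∞ :=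
  ∑' i : ℕ, (bl B c (m + 2 * σ + i + 1)).indicator
    (fun _ => ((C * (b ^ (m + 2 * σ + i))⁻¹ * θ ^ i : ℝ≥0) : ℝ≥0∞)) x

variable {B : ℤ → Set E} {b : ℝ≥0} {σ : ℤ} {K : E → E → B₁ →L[ℂ] B₂} {C θ : ℝ≥0}

namespace IsBallFamily

variable (h : IsBallFamily b σ B)
include h

theorem enorm_sub_le_shellSum (hK : IsKernel B b σ K C θ) {c z x : E} {m : ℤ}
    (hz : z ∈ bl B c m) (hx : x ∉ bl B c (m + 2 * σ)) :
    ‖K c x - K z x‖ₑ ≤ shellSum B b σ C θ c m x ∧ ‖K x c - K x z‖ₑ ≤ shellSum B b σ C θ c m x := by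
  obtain ⟨i, hi, hi'⟩ := h.exists_shell hx
  have h1 := hK.reg c z x m i hz hi
  have h2 : ((C * (b ^ (m + 2 * σ + i))⁻¹ * θ ^ i : ℝ≥0) : ℝ≥0∞) ≤ shellSum B b σ C θ c m x := by
    refine le_trans ?_ (ENNReal.le_tsum i)
    rw [indicator_of_mem hi']
  exact ⟨le_trans (ENNReal.coe_le_coe.2 (le_self_add.trans h1)) h2,
    le_trans (ENNReal.coe_le_coe.2 (le_add_self.trans h1)) h2⟩

variable [BorelSpace E]

/-- The ball of index `l + 1` has volume `b · b^l`, so the shell of index `i` contributes at most `C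
b s θ^i`, and the series is geometric. With `F = ‖f‖` the number `s` is a value of the maximal
function. -/
theorem lintegral_shellSum_mul_le (hθ : θ < 1) {F : E → ℝ≥0∞} (hF : AEMeasurable F volume)
    {c : E} {m : ℤ} {s : ℝ≥0∞}
    (hs : ∀ l, m ≤ l → ∫⁻ x in bl B c l, F x ≤ s * volume (bl B c l)) :
    ∫⁻ x, shellSum B b σ C θ c m x * F x ≤ (C * b * (1 - θ)⁻¹ : ℝ≥0) * s := by
  have hb0 := h.pos
  have hσ := h.one_le
  have h1 : ∀ x, shellSum B b σ C θ c m x * F x =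
      ∑' i : ℕ, ((C * (b ^ (m + 2 * σ + i))⁻¹ * θ ^ i : ℝ≥0) : ℝ≥0∞) *
        (bl B c (m + 2 * σ + i + 1)).indicator F x := by
    intro x
    rw [shellSum, ← ENNReal.tsum_mul_right]
    congr with i
    by_cases hx : x ∈ bl B c (m + 2 * σ + i + 1)
    · simp [indicator_of_mem hx]
    · simp [indicator_of_notMem hx]
  simp only [h1]
  rw [lintegral_tsum fun i => (hF.indicator (h.measurableSet_bl _ _)).const_mul _]
  calc ∑' i : ℕ, ∫⁻ x, ((C * (b ^ (m + 2 * σ + i))⁻¹ * θ ^ i : ℝ≥0) : ℝ≥0∞) *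
        (bl B c (m + 2 * σ + i + 1)).indicator F x
      ≤ ∑' i : ℕ, (C * b : ℝ≥0) * s * (θ : ℝ≥0∞) ^ i := by
        refine ENNReal.tsum_le_tsum fun i => ?_
        rw [lintegral_const_mul'' _ (hF.indicator (h.measurableSet_bl _ _)),
          lintegral_indicator (h.measurableSet_bl _ _)]
        refine (mul_le_mul' le_rfl (hs _ (by lia))).trans (le_of_eq ?_)
        have hz := (h.zpow_pos' (m + 2 * σ + i)).ne'
        have hcoef : C * (b ^ (m + 2 * σ + i))⁻¹ * θ ^ i * b ^ (m + 2 * σ + i + 1) =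
            C * b * θ ^ i := by
          rw [zpow_add₀ hb0.ne' _ 1, zpow_one]
          field_simp
        rw [h.volume_bl, mul_left_comm, ← ENNReal.coe_mul, hcoef]
        push_cast
        ring
    _ = _ := by
        rw [ENNReal.tsum_mul_left, ENNReal.tsum_geometric, ENNReal.coe_mul (C * b),
          ENNReal.coe_inv (tsub_pos_of_lt hθ).ne', ENNReal.coe_sub, ENNReal.coe_one]
        ring

theorem lintegral_shellSum_le (hθ : θ < 1) (c : E) (m : ℤ) :
    ∫⁻ x, shellSum B b σ C θ c m x ≤ (C * b * (1 - θ)⁻¹ : ℝ≥0) := by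
  simpa using h.lintegral_shellSum_mul_le (C := C) hθ (F := fun _ => 1) (c := c) (m := m) (s := 1)
    aemeasurable_const (fun l _ => by simp)

-- The kernel is not assumed measurable. Its regularity makes `K x` continuous off `x`, and this
-- supplies the measurability of `y ↦ K x y (f y)`. When `x ∉ bl B y k`, moving `y` within index `k
-- - i - 2σ` changes the kernel by at most `C b^{-k} θ^i`.
omit [BorelSpace E] in
theorem continuousOn_kernel (hK : IsKernel B b σ K C θ) (x : E) : ContinuousOn (K x) {x}ᶜ := by
  intro y hy
  have hxy : y - x ≠ 0 := sub_ne_zero.2 hy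
  obtain ⟨k, hk⟩ := h.exists_bl_subset (isOpen_compl_singleton (x := x)) hy
  have hxk : x ∉ bl B y k := fun hcon => hk hcon rfl
  refine ContinuousAt.continuousWithinAt ?_
  rw [Metric.continuousAt_iff']
  intro ε hε
  have hlim : Filter.Tendsto (fun i : ℕ => ((C * (b ^ k)⁻¹ * θ ^ i : ℝ≥0) : ℝ)) Filter.atTop
      (nhds 0) := by
    have : Filter.Tendsto (fun i : ℕ => (θ : ℝ) ^ i) Filter.atTop (nhds 0) :=
      tendsto_pow_atTop_nhds_zero_of_lt_one θ.2 (by exact_mod_cast hK.lt_one)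
    simpa using this.const_mul ((C * (b ^ k)⁻¹ : ℝ≥0) : ℝ)
  obtain ⟨i, hi⟩ := (hlim.eventually_lt_const hε).exists
  filter_upwards [(h.isOpen_bl y (k - i - 2 * σ)).mem_nhds (h.mem_self y _)] with z hz
  have h1 := hK.reg y z x (k - i - 2 * σ) i hz (by
    rwa [show k - i - 2 * σ + 2 * σ + i = k by ring])
  rw [show k - i - 2 * σ + 2 * σ + i = k by ring] at h1
  rw [dist_comm, dist_eq_norm]
  have h2 : ‖K x y - K x z‖₊ ≤ C * (b ^ k)⁻¹ * θ ^ i := le_add_self.trans h1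
  exact lt_of_le_of_lt (by exact_mod_cast h2) hi

variable [ProperSpace E]

theorem aestronglyMeasurable_kernel_apply (hK : IsKernel B b σ K C θ) (x : E) {f : E → B₁}
    (hf : AEStronglyMeasurable f volume) {k : ℤ} (hfk : ∀ y ∈ bl B x k, f y = 0) :
    AEStronglyMeasurable (fun y => K x y (f y)) volume := by
  have hm := h.measurableSet_bl x k
  have h1 : (fun y => K x y (f y)) = (bl B x k)ᶜ.indicator (fun y => K x y (f y)) := by
    refine (indicator_eq_self.2 fun y hy => ?_).symm
    intro hyk
    exact hy (by simp [hfk y hyk])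
  rw [h1, aestronglyMeasurable_indicator_iff hm.compl]
  have h2 : AEStronglyMeasurable (K x) (volume.restrict (bl B x k)ᶜ) :=
    ((h.continuousOn_kernel hK x).mono fun y hy hyx => by
      rw [mem_singleton_iff] at hyx
      exact hy (hyx ▸ h.mem_self x k)).aestronglyMeasurable hm.compl
  exact isBoundedBilinearMap_apply.continuous.comp_aestronglyMeasurable
    (h2.prodMk hf.restrict)

theorem integrable_kernel_apply (hK : IsKernel B b σ K C θ) (x : E) {f : E → B₁}
    (hf : Integrable f volume) {k : ℤ} (hfk : ∀ y ∈ bl B x k, f y = 0) :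
    Integrable (fun y => K x y (f y)) volume := by
  refine (hf.norm.const_mul ((C * (b ^ k)⁻¹ : ℝ≥0) : ℝ)).mono'
    (h.aestronglyMeasurable_kernel_apply hK x hf.1 hfk) (Filter.Eventually.of_forall fun y => ?_)
  by_cases hy : y ∈ bl B x k
  · simp [hfk y hy]
  · refine (ContinuousLinearMap.le_opNorm _ _).trans ?_
    gcongr
    exact_mod_cast hK.size x y k fun hxy => hy (h.mem_symm hxy)

end IsBallFamily

variable {r : ℝ≥0∞} [Fact (1 ≤ r)]

open Classical in
/-- The function `T f` for a function `f` (and `0` when `f` is not in `L^r`). -/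
noncomputable def opFn (T : Lp B₁ r (volume : Measure E) →L[ℂ] Lp B₂ r (volume : Measure E))
    (f : E → B₁) : E → B₂ :=
  if hf : MemLp f r volume then T (hf.toLp f) else 0

section

variable (T : Lp B₁ r (volume : Measure E) →L[ℂ] Lp B₂ r (volume : Measure E))

theorem opFn_of_memLp {f : E → B₁} (hf : MemLp f r volume) : opFn T f = T (hf.toLp f) := by
  simp [opFn, hf]

theorem opFn_stronglyMeasurable (f : E → B₁) : StronglyMeasurable (opFn T f) := by
  by_cases hf : MemLp f r volume
  · rw [opFn_of_memLp T hf]; exact Lp.stronglyMeasurable _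
  · simp only [opFn, hf, dite_false]; exact stronglyMeasurable_zero

theorem measurable_enorm_opFn (f : E → B₁) : Measurable fun x => ‖opFn T f x‖ₑ :=
  (opFn_stronglyMeasurable T f).enorm

theorem opFn_add {f g : E → B₁} (hf : MemLp f r volume) (hg : MemLp g r volume) :
    opFn T (f + g) =ᵐ[volume] opFn T f + opFn T g := by
  rw [opFn_of_memLp T hf, opFn_of_memLp T hg, opFn_of_memLp T (hf.add hg), MemLp.toLp_add hf hg,
    map_add]
  exact Lp.coeFn_add _ _

theorem opFn_sub {f g : E → B₁} (hf : MemLp f r volume) (hg : MemLp g r volume) :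
    opFn T (f - g) =ᵐ[volume] opFn T f - opFn T g := by
  rw [opFn_of_memLp T hf, opFn_of_memLp T hg, opFn_of_memLp T (hf.sub hg), MemLp.toLp_sub hf hg,
    map_sub]
  exact Lp.coeFn_sub _ _

theorem opFn_congr {f g : E → B₁} (hfg : f =ᵐ[volume] g) : opFn T f = opFn T g := by
  by_cases hf : MemLp f r volume
  · have hg := hf.ae_eq hfg
    rw [opFn_of_memLp T hf, opFn_of_memLp T hg, MemLp.toLp_congr hf hg hfg]
  · have hg : ¬ MemLp g r volume := fun hg => hf (hg.ae_eq hfg.symm)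
    simp [opFn, hf, hg]

theorem opFn_zero : opFn T (0 : E → B₁) =ᵐ[volume] 0 := by
  have h0 : MemLp (0 : E → B₁) r volume := MemLp.zero
  rw [opFn_of_memLp T h0, MemLp.toLp_zero, map_zero]
  exact Lp.coeFn_zero _ _ _

theorem opFn_sum {ι : Type*} (s : Finset ι) {F : ι → E → B₁} (hF : ∀ i, MemLp (F i) r volume) :
    opFn T (∑ i ∈ s, F i) =ᵐ[volume] ∑ i ∈ s, opFn T (F i) := by
  classical
  induction s using Finset.induction_on with
  | empty => simpa using opFn_zero T
  | insert i s hi ih =>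
    rw [Finset.sum_insert hi, Finset.sum_insert hi]
    exact (opFn_add T (hF i) (memLp_finsetSum' s fun i _ => hF i)).trans
      (Filter.EventuallyEq.rfl.add ih)

theorem eLpNorm_opFn_le {f : E → B₁} (hf : MemLp f r volume) :
    eLpNorm (opFn T f) r volume ≤ ‖T‖ₑ * eLpNorm f r volume := by
  rw [opFn_of_memLp T hf, ← Lp.enorm_def, ← Lp.enorm_toLp hf]
  exact T.le_opENorm _

theorem measure_lt_opFn_le (hr : 1 < r) (hr' : r < ∞) {f : E → B₁} (hf : MemLp f r volume)
    {t : ℝ≥0} (ht : 0 < t) :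
    (t : ℝ≥0∞) ^ r.toReal * volume {x | t < ‖opFn T f x‖ₑ} ≤
      ‖T‖ₑ ^ r.toReal * ∫⁻ x, ‖f x‖ₑ ^ r.toReal := by
  have hr0 : r ≠ 0 := (zero_lt_one.trans hr).ne'
  have hrr : 0 < r.toReal := ENNReal.toReal_pos hr0 hr'.ne
  have ht0 : (t : ℝ≥0∞) ≠ 0 := by simpa using ht.ne'
  have h1 := meas_ge_le_mul_pow_eLpNorm_enorm (volume : Measure E) hr0 hr'.ne
    (opFn_stronglyMeasurable T f).aestronglyMeasurable ht0 (by simp)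
  have h2 : eLpNorm (opFn T f) r volume ^ r.toReal ≤
      ‖T‖ₑ ^ r.toReal * ∫⁻ x, ‖f x‖ₑ ^ r.toReal := by
    refine (ENNReal.rpow_le_rpow (eLpNorm_opFn_le T hf) hrr.le).trans ?_
    rw [ENNReal.mul_rpow_of_nonneg _ _ hrr.le, eLpNorm_eq_lintegral_rpow_enorm_toReal hr0 hr'.ne,
      ← ENNReal.rpow_mul, one_div_mul_cancel hrr.ne', ENNReal.rpow_one]
  calc (t : ℝ≥0∞) ^ r.toReal * volume {x | t < ‖opFn T f x‖ₑ}
      ≤ (t : ℝ≥0∞) ^ r.toReal * ((t : ℝ≥0∞)⁻¹ ^ r.toReal *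
          eLpNorm (opFn T f) r volume ^ r.toReal) := by
        refine mul_le_mul' le_rfl ((measure_mono fun x hx => ?_).trans h1)
        exact le_of_lt (show (t : ℝ≥0∞) < _ from hx)
    _ = eLpNorm (opFn T f) r volume ^ r.toReal := by
        rw [← mul_assoc, ← ENNReal.mul_rpow_of_nonneg _ _ hrr.le,
          ENNReal.mul_inv_cancel ht0 ENNReal.coe_ne_top, ENNReal.one_rpow, one_mul]
    _ ≤ _ := h2

end

/-- `T` is represented by the kernel `K` away from the support. -/
def IsRepresentedBy (T : Lp B₁ r (volume : Measure E) →L[ℂ] Lp B₂ r (volume : Measure E))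
    (K : E → E → B₁ →L[ℂ] B₂) : Prop :=
  ∀ f : E → B₁, IsTest f → ∀ᵐ x, x ∉ tsupport f → opFn T f x = ∫ y, K x y (f y)

variable {T : Lp B₁ r (volume : Measure E) →L[ℂ] Lp B₂ r (volume : Measure E)}

namespace IsBallFamily

variable (h : IsBallFamily b σ B)
include h

variable [BorelSpace E] [ProperSpace E] [CompleteSpace B₁] [CompleteSpace B₂]

/-- As `f` has mean zero, `K x c` may be subtracted from the kernel. The shell sum bounds the
difference uniformly over the support of `f`, so `‖T f(x)‖` is at most the shell sum at `x` times
the `L¹` norm of `f`; no Fubini argument is needed. The margin `2σ` separates `x` from the closed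
support. -/
theorem lintegral_opFn_atom_le (hK : IsKernel B b σ K C θ) (hT : IsRepresentedBy T K)
    {f : E → B₁} (hf : IsTest f) {c : E} {m : ℤ} (hfs : Function.support f ⊆ bl B c m)
    (hf0 : ∫ x, f x = 0) :
    ∫⁻ x in (bl B c (m + 2 * σ))ᶜ, ‖opFn T f x‖ₑ ≤
      (C * b * (1 - θ)⁻¹ : ℝ≥0) * ∫⁻ x, ‖f x‖ₑ := by
  have hσ := h.one_le
  have hfi : Integrable f volume := memLp_one_iff_integrable.1 (hf.memLp_volume h 1)
  have hts : tsupport f ⊆ bl B c (m + σ) := (closure_mono hfs).trans (h.closure_bl_subset c m)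
  have hpt : ∀ᵐ x ∂(volume.restrict (bl B c (m + 2 * σ))ᶜ),
      ‖opFn T f x‖ₑ ≤ shellSum B b σ C θ c m x * ∫⁻ y, ‖f y‖ₑ := by
    filter_upwards [ae_restrict_of_ae (hT f hf),
      ae_restrict_mem (h.measurableSet_bl c (m + 2 * σ)).compl] with x hx hxm
    have hxm' : x ∉ bl B c (m + 2 * σ) := hxm
    rw [hx fun hcon => hxm' (h.bl_mono c (by lia) (hts hcon))]
    have hfx : ∀ y ∈ bl B x (m + σ), f y = 0 := by
      intro y hy
      by_contra hcon
      refine hxm' ?_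
      have := h.mem_trans (h.bl_mono c (by lia : m ≤ m + σ) (hfs hcon)) (h.mem_symm hy)
      exact h.bl_mono c (by lia) this
    have hint := h.integrable_kernel_apply hK x hfi hfx
    have h0 : ∫ y, K x c (f y) = 0 := by
      rw [ContinuousLinearMap.integral_comp_comm (K x c) hfi, hf0, map_zero]
    have heq : ∫ y, K x y (f y) = ∫ y, (K x y (f y) - K x c (f y)) := by
      rw [integral_sub hint ((K x c).integrable_comp hfi), h0, sub_zero]
    rw [heq, ← lintegral_const_mul'' _ hfi.1.enorm]
    refine (enorm_integral_le_lintegral_enorm _).trans (lintegral_mono fun y => ?_)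
    by_cases hy : f y = 0
    · simp [hy]
    · have h1 := (h.enorm_sub_le_shellSum hK (hfs hy) hxm').2
      calc ‖K x y (f y) - K x c (f y)‖ₑ = ‖(K x c - K x y) (f y)‖ₑ := by
            rw [← enorm_neg, neg_sub, _root_.sub_apply]
        _ ≤ ‖K x c - K x y‖ₑ * ‖f y‖ₑ := ContinuousLinearMap.le_opENorm _ _
        _ ≤ _ := mul_le_mul' h1 le_rfl
  have hfin : ∫⁻ y, ‖f y‖ₑ ≠ ∞ := hfi.2.ne
  calc ∫⁻ x in (bl B c (m + 2 * σ))ᶜ, ‖opFn T f x‖ₑ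
      ≤ ∫⁻ x in (bl B c (m + 2 * σ))ᶜ, shellSum B b σ C θ c m x * ∫⁻ y, ‖f y‖ₑ :=
        lintegral_mono_ae hpt
    _ ≤ ∫⁻ x, shellSum B b σ C θ c m x * ∫⁻ y, ‖f y‖ₑ := setLIntegral_le_lintegral _ _
    _ = (∫⁻ x, shellSum B b σ C θ c m x) * ∫⁻ y, ‖f y‖ₑ := lintegral_mul_const' _ _ hfin
    _ ≤ _ := mul_le_mul' (h.lintegral_shellSum_le hK.lt_one c m) le_rfl

end IsBallFamily

end Operators

/-! ### Calderón–Zygmund decomposition and the weak type (1,1) estimate -/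

theorem exists_disjoint_refinement {ι α : Type*} [Countable ι] [MeasurableSpace α] (U : ι → Set α)
    (hU : ∀ i, MeasurableSet (U i)) : ∃ P : ι → Set α, (∀ i, MeasurableSet (P i)) ∧
      (∀ i, P i ⊆ U i) ∧ Pairwise (fun i j => Disjoint (P i) (P j)) ∧ ⋃ i, P i = ⋃ i, U i := by
  classical
  obtain ⟨e, he⟩ := exists_injective_nat ι
  refine ⟨fun i => U i \ ⋃ (j) (_ : e j < e i), U j, fun i => (hU i).diff
    (MeasurableSet.iUnion fun j => MeasurableSet.iUnion fun _ => hU j), fun i => sdiff_subset,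
    fun i j hij => ?_, ?_⟩
  · refine disjoint_left.2 fun x hxi hxj => ?_
    rcases lt_trichotomy (e i) (e j) with hlt | heq | hlt
    · exact hxj.2 (mem_iUnion₂.2 ⟨i, hlt, hxi.1⟩)
    · exact hij (he heq)
    · exact hxi.2 (mem_iUnion₂.2 ⟨j, hlt, hxj.1⟩)
  · refine Subset.antisymm (iUnion_mono fun i => sdiff_subset) fun x hx => ?_
    have hex : ∃ n, ∃ i, e i = n ∧ x ∈ U i := by
      obtain ⟨i, hi⟩ := mem_iUnion.1 hx
      exact ⟨_, i, rfl, hi⟩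
    obtain ⟨i, hi, hxi⟩ := Nat.find_spec hex
    refine mem_iUnion.2 ⟨i, hxi, fun hcon => ?_⟩
    obtain ⟨j, hj, hxj⟩ := mem_iUnion₂.1 hcon
    exact Nat.find_min hex (hi ▸ hj) ⟨j, rfl, hxj⟩

section WeakType

set_option linter.unusedSectionVars false

variable {E : Type*} [NormedAddCommGroup E] [MeasureSpace E]
variable {B₁ B₂ : Type*} [NormedAddCommGroup B₁] [NormedSpace ℂ B₁]
  [NormedAddCommGroup B₂] [NormedSpace ℂ B₂]
variable {B : ℤ → Set E} {b : ℝ≥0} {σ : ℤ}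
variable [BorelSpace E] [ProperSpace E]

namespace IsBallFamily

variable (h : IsBallFamily b σ B)
include h

theorem isComparable_volume : IsComparable B (volume : Measure E) 1 1 :=
  ⟨zero_le_one, Measure.AbsolutelyContinuous.rfl, h.volume_bl_ne_top, fun x k F _ _ => by simp⟩

/-- The covering behind the Calderón–Zygmund decomposition of `F` at height `t`. -/
theorem exists_cz_covering {F : E → ℝ≥0∞} (hF : AEMeasurable F volume) (hF0 : ∫⁻ x, F x ≠ 0)
    (hFt : ∫⁻ x, F x ≠ ∞) {t : ℝ≥0} (ht : 0 < t) :
    ∃ (Ω : Set E) (u : Set (E × ℤ)) (P : u → Set E), IsOpen Ω ∧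
      t * volume Ω ≤ (b ^ (1 + 2 * σ) + 2 : ℝ≥0) * ∫⁻ x, F x ∧
      (∀ x ∉ Ω, F x ≤ t) ∧ u.Countable ∧ u.PairwiseDisjoint (fun a => bl B a.1 a.2) ∧
      (∀ c : u, bl B c.1.1 c.1.2 ⊆ Ω) ∧ (∀ c, MeasurableSet (P c)) ∧
      (∀ c : u, P c ⊆ bl B c.1.1 (c.1.2 + (1 + 2 * σ))) ∧
      Pairwise (fun c d => Disjoint (P c) (P d)) ∧ ⋃ c, P c = Ω ∧
      ∀ c : u, ∫⁻ x in bl B c.1.1 (c.1.2 + (1 + 2 * σ)), F x ≤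
        t * volume (bl B c.1.1 (c.1.2 + (1 + 2 * σ))) := by
  have hσ := h.one_le
  have ht0 : (t : ℝ≥0∞) ≠ 0 := by simpa using ht.ne'
  have hlf : IsLocallyFiniteMeasure (volume : Measure E) :=
    h.isLocallyFiniteMeasure _ h.volume_bl_ne_top
  -- An open neighbourhood of `{F > t}` is added to `{MF > t}`, so that `F ≤ t` off `Ω` without
  -- Lebesgue's differentiation theorem. The factor 2 makes the inequality strict, as outer
  -- regularity requires; this uses that the integral is nonzero.
  have hlt : volume {x | (t : ℝ≥0∞) < F x} < 2 * (∫⁻ x, F x) / t := by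
    refine lt_of_le_of_lt (b := (∫⁻ x, F x) / t) ?_ ?_
    · rw [ENNReal.le_div_iff_mul_le (Or.inl ht0) (Or.inl ENNReal.coe_ne_top), mul_comm]
      refine le_trans (mul_le_mul' le_rfl (measure_mono fun x hx => ?_))
        (mul_meas_ge_le_lintegral₀ hF t)
      exact le_of_lt (show (t : ℝ≥0∞) < _ from hx)
    · refine ENNReal.div_lt_div_right ht0 ENNReal.coe_ne_top ?_
      rw [two_mul]
      exact ENNReal.lt_add_right hFt hF0
  obtain ⟨O, hFO, hO, hOlt⟩ := Set.exists_isOpen_lt_of_lt _ _ hlt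
  set Ω : Set E := {x | (t : ℝ≥0∞) < maxFn B volume F x} ∪ O with hΩ
  have hΩo : IsOpen Ω := (h.isOpen_lt_maxFn F t).union hO
  have hvol : t * volume Ω ≤ (b ^ (1 + 2 * σ) + 2 : ℝ≥0) * ∫⁻ x, F x := by
    have h1 : t * volume {x | (t : ℝ≥0∞) < maxFn B volume F x} ≤
        ((b ^ (1 + 2 * σ) : ℝ≥0) : ℝ≥0∞) * ∫⁻ x, F x := by
      have := h.maxFn_weak (h.isDoublingFor h.isComparable_volume) F t
      simpa only [one_mul, NNReal.rpow_one] using this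
    have h2 : t * volume O ≤ 2 * ∫⁻ x, F x := by
      rw [mul_comm]; exact ENNReal.mul_le_of_le_div hOlt.le
    calc t * volume Ω ≤ t * (volume {x | (t : ℝ≥0∞) < maxFn B volume F x} + volume O) :=
          mul_le_mul' le_rfl (measure_union_le _ _)
      _ ≤ _ := by
          rw [mul_add, ENNReal.coe_add, add_mul]
          exact add_le_add h1 h2
  have hΩt : volume Ω ≠ ∞ := by
    intro hcon
    rw [hcon, ENNReal.mul_top ht0] at hvol
    exact ENNReal.mul_ne_top ENNReal.coe_ne_top hFt (top_le_iff.1 hvol)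
  obtain ⟨L, hL⟩ := h.exists_le_zpow (volume Ω).toNNReal
  have hbd : ∀ x k, bl B x k ⊆ Ω → k ≤ L := by
    intro x k hk
    have h1 : ((b ^ k : ℝ≥0) : ℝ≥0∞) ≤ ((volume Ω).toNNReal : ℝ≥0∞) := by
      rw [ENNReal.coe_toNNReal hΩt, ← h.volume_bl x k]; exact measure_mono hk
    exact h.zpow_le_iff.1 ((ENNReal.coe_le_coe.1 h1).trans hL)
  -- Balls inside `Ω` whose successor is not: the enlarged ball then contains a point where `MF ≤
  -- t`, which bounds the average of `F`.
  let s : Set (E × ℤ) := {c | bl B c.1 c.2 ⊆ Ω ∧ ¬ bl B c.1 (c.2 + 1) ⊆ Ω}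
  have hs : ∀ x ∈ Ω, ∃ k, (x, k) ∈ s := by
    intro x hx
    obtain ⟨k, hk, hmax⟩ := Int.exists_greatest_of_bdd (P := fun k => bl B x k ⊆ Ω)
      ⟨L, fun k hk => hbd x k hk⟩ (h.exists_bl_subset hΩo hx)
    exact ⟨k, hk, fun hcon => by have := hmax _ hcon; lia⟩
  obtain ⟨u, hus, huc, hud, hu⟩ := h.exists_vitali s L fun c hc => hbd _ _ hc.1
  have hcount : Countable u := huc.to_subtype
  obtain ⟨P, hPm, hPU, hPd, hPun⟩ := exists_disjoint_refinement
    (fun c : u => bl B c.1.1 (c.1.2 + (1 + 2 * σ)) ∩ Ω)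
    (fun c => (h.measurableSet_bl _ _).inter hΩo.measurableSet)
  refine ⟨Ω, u, P, hΩo, hvol, fun x hx => ?_, huc, hud, fun c => (hus c.2).1, hPm,
    fun c => (hPU c).trans inter_subset_left, hPd, ?_, fun c => ?_⟩
  · by_contra hcon
    exact hx (Or.inr (hFO (not_le.1 hcon)))
  · rw [hPun]
    refine Subset.antisymm (iUnion_subset fun c => inter_subset_right) fun x hx => ?_
    obtain ⟨k, hk⟩ := hs x hx
    obtain ⟨c, hc, hsub⟩ := hu _ hk
    exact mem_iUnion.2 ⟨⟨c, hc⟩, hsub (h.mem_self x k), hx⟩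
  · obtain ⟨y, hy, hyΩ⟩ := not_subset.1 (hus c.2).2
    have hMy : maxFn B volume F y ≤ t := by
      by_contra hcon
      exact hyΩ (Or.inl (not_le.1 hcon))
    have h1 := (lintegral_div_le_maxFn F (h.bl_mono _ (by lia) hy :
      y ∈ bl B c.1.1 (c.1.2 + (1 + 2 * σ)))).trans hMy
    exact (ENNReal.div_le_iff_le_mul (Or.inl (h.volume_bl_ne_zero _ _))
      (Or.inl (h.volume_bl_ne_top _ _))).1 h1

variable {K : E → E → B₁ →L[ℂ] B₂} {C θ : ℝ≥0} {r : ℝ≥0∞} [Fact (1 ≤ r)]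
  {T : Lp B₁ r (volume : Measure E) →L[ℂ] Lp B₂ r (volume : Measure E)}
  [CompleteSpace B₁] [CompleteSpace B₂]

/-- Chebyshev's inequality in `L^r` together with `‖g‖^r ≤ (ct)^{r-1}‖g‖`; the powers of `t` cancel
down to an `L¹` bound. -/
theorem measure_lt_opFn_le_of_bounded (hr : 1 < r) (hr' : r < ∞) {g : E → B₁}
    (hg : IsTest g) {t c : ℝ≥0} (ht : 0 < t) (hgt : ∀ x, ‖g x‖ₑ ≤ (c * t : ℝ≥0)) :
    t * volume {x | t < ‖opFn T g x‖ₑ} ≤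
      (‖T‖₊ ^ r.toReal * c ^ (r.toReal - 1) : ℝ≥0) * ∫⁻ x, ‖g x‖ₑ := by
  have hR : 1 < r.toReal := by
    rw [← ENNReal.toReal_one]; exact (ENNReal.toReal_lt_toReal (by simp) hr'.ne).2 hr
  set R := r.toReal with hRdef
  have hR0 : 0 < R := by linarith
  have hR1 : 0 < R - 1 := by linarith
  have ht0 : (t : ℝ≥0∞) ≠ 0 := by simpa using ht.ne'
  have hsplit : ∀ a : ℝ≥0∞, a ^ R = a ^ (R - 1) * a := by
    intro a
    conv_lhs => rw [show R = (R - 1) + 1 by ring]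
    rw [ENNReal.rpow_add_of_nonneg _ _ hR1.le zero_le_one, ENNReal.rpow_one]
  have h1 := measure_lt_opFn_le T hr hr' (hg.memLp_volume h r) ht
  rw [← hRdef] at h1
  have h2 : ∫⁻ x, ‖g x‖ₑ ^ R ≤ ((c * t : ℝ≥0) : ℝ≥0∞) ^ (R - 1) * ∫⁻ x, ‖g x‖ₑ := by
    rw [← lintegral_const_mul'' _ hg.aestronglyMeasurable.enorm]
    refine lintegral_mono fun x => ?_
    rw [hsplit]
    gcongr
    exact hgt x
  have htR0 : (t : ℝ≥0∞) ^ (R - 1) ≠ 0 := by simp [ENNReal.rpow_eq_zero_iff, ht.ne']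
  have htRt : (t : ℝ≥0∞) ^ (R - 1) ≠ ∞ := ENNReal.rpow_ne_top_of_nonneg hR1.le ENNReal.coe_ne_top
  have hTn : ‖T‖ₑ ^ R = ((‖T‖₊ ^ R : ℝ≥0) : ℝ≥0∞) := by
    rw [ENNReal.coe_rpow_of_nonneg _ hR0.le]; rfl
  rw [← ENNReal.mul_le_mul_iff_right htR0 htRt]
  calc (t : ℝ≥0∞) ^ (R - 1) * (t * volume {x | t < ‖opFn T g x‖ₑ})
      = t ^ R * volume {x | t < ‖opFn T g x‖ₑ} := by rw [← mul_assoc, ← hsplit]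
    _ ≤ ‖T‖ₑ ^ R * (((c * t : ℝ≥0) : ℝ≥0∞) ^ (R - 1) * ∫⁻ x, ‖g x‖ₑ) :=
        h1.trans (mul_le_mul' le_rfl h2)
    _ = _ := by
        rw [hTn, ENNReal.coe_mul c, ENNReal.mul_rpow_of_nonneg _ _ hR1.le, ENNReal.coe_mul,
          ENNReal.coe_rpow_of_nonneg c hR1.le]
        ring

/-- The weak type `(1, 1)` estimate for bounded functions with bounded support. -/
theorem exists_weak_one_one (hr : 1 < r) (hr' : r < ∞) (hK : IsKernel B b σ K C θ)
    (hT : IsRepresentedBy T K) :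
    ∃ C₁ : ℝ≥0, ∀ f : E → B₁, IsTest f → ∀ t : ℝ≥0, 0 < t →
      t * volume {x | (t : ℝ≥0∞) < ‖opFn T f x‖ₑ} ≤ C₁ * ∫⁻ x, ‖f x‖ₑ := by
  have hσ := h.one_le
  have hb0 := h.pos
  have hR0 : 0 < r.toReal := ENNReal.toReal_pos (zero_lt_one.trans hr).ne' hr'.ne
  set τ : ℤ := 1 + 2 * σ with hτ
  set A : ℝ≥0 := C * b * (1 - θ)⁻¹ with hA
  set c₁ : ℝ≥0 := ‖T‖₊ ^ r.toReal * (b ^ τ) ^ (r.toReal - 1) with hc₁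
  set c₂ : ℝ≥0 := b ^ (τ + 2 * σ) * (b ^ τ + 2) with hc₂
  -- The factor 3 comes from splitting the level among three parts of `f`; `c₁` is for the good
  -- part, `2 * A` for the bad part off the enlarged balls, `c₂` for the volume of those balls.
  refine ⟨3 * (c₁ + (2 * A + c₂)), fun f hf t' ht' => ?_⟩
  by_cases hf0 : ∫⁻ x, ‖f x‖ₑ = 0
  · have h0 : f =ᵐ[volume] 0 := by
      rw [lintegral_eq_zero_iff' hf.aestronglyMeasurable.enorm] at hf0
      exact hf0.mono fun x hx => by simpa using hx
    have h1 : volume {x | (t' : ℝ≥0∞) < ‖opFn T f x‖ₑ} = 0 := by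
      have h2 : ∀ᵐ x, ¬ ((t' : ℝ≥0∞) < ‖opFn T f x‖ₑ) := by
        rw [opFn_congr T h0]
        filter_upwards [opFn_zero T] with x hx
        rw [hx]; simp
      rw [ae_iff] at h2; simpa using h2
    rw [h1]; simp
  have hfi : Integrable f volume := memLp_one_iff_integrable.1 (hf.memLp_volume h 1)
  have hft : ∫⁻ x, ‖f x‖ₑ ≠ ∞ := hfi.2.ne
  obtain ⟨t, htt⟩ : ∃ t : ℝ≥0, t = t' / 3 := ⟨_, rfl⟩
  have ht : 0 < t := by rw [htt]; positivity
  have ht0 : (t : ℝ≥0∞) ≠ 0 := by simpa using ht.ne'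
  have ht3 : t' = 3 * t := by rw [htt, mul_div_cancel₀ _ (by norm_num)]
  obtain ⟨Ω, u, P, hΩo, hΩ, hfΩ, huc, hud, hVΩ, hPm, hPU, hPd, hPun, havg⟩ :=
    h.exists_cz_covering hf.aestronglyMeasurable.enorm hf0 hft ht
  have hcount : Countable u := huc.to_subtype
  set V : u → Set E := fun c => bl B c.1.1 c.1.2 with hV
  have hVm : ∀ c, MeasurableSet (V c) := fun c => h.measurableSet_bl _ _
  have hVd : Pairwise (fun c d => Disjoint (V c) (V d)) := fun c d hcd =>
    hud c.2 d.2 (fun hcon => hcd (Subtype.ext hcon))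
  have hVU : ∀ c : u, V c ⊆ bl B c.1.1 (c.1.2 + τ) := fun c => h.bl_mono _ (by lia)
  -- The integral of `f` over the piece `P c` is spread over the ball `V c`. A piece may have
  -- arbitrarily small measure, whereas the balls `V c` are disjoint and comparable in volume to
  -- their enlargements; hence the good part is bounded by `b^τ t`.
  let a : u → B₁ := fun c => ((volume (V c)).toReal⁻¹ : ℝ) • ∫ x in P c, f x
  have haV : ∀ c, ‖a c‖ₑ * volume (V c) ≤ ∫⁻ x in P c, ‖f x‖ₑ := by
    intro c
    have hv0 : volume (V c) ≠ 0 := h.volume_bl_ne_zero _ _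
    have hvt : volume (V c) ≠ ∞ := h.volume_bl_ne_top _ _
    have h1 : ‖((volume (V c)).toReal⁻¹ : ℝ)‖ₑ = (volume (V c))⁻¹ := by
      rw [← ENNReal.toReal_inv, Real.enorm_of_nonneg ENNReal.toReal_nonneg,
        ENNReal.ofReal_toReal (ENNReal.inv_ne_top.2 hv0)]
    calc ‖a c‖ₑ * volume (V c)
        = ‖∫ x in P c, f x‖ₑ * ((volume (V c))⁻¹ * volume (V c)) := by
          simp only [a]; rw [enorm_smul, h1]; ring
      _ = ‖∫ x in P c, f x‖ₑ := by rw [ENNReal.inv_mul_cancel hv0 hvt, mul_one]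
      _ ≤ _ := enorm_integral_le_lintegral_enorm _
  have hat : ∀ c, ‖a c‖ₑ ≤ (b ^ τ * t : ℝ≥0) := by
    intro c
    have hv0 : volume (V c) ≠ 0 := h.volume_bl_ne_zero _ _
    have hvt : volume (V c) ≠ ∞ := h.volume_bl_ne_top _ _
    rw [← ENNReal.mul_le_mul_iff_left hv0 hvt]
    refine (haV c).trans ((lintegral_mono_set (hPU c)).trans ((havg c).trans (le_of_eq ?_)))
    rw [h.volume_bl_add c.1.1 c.1.1, ENNReal.coe_mul]; ring
  let bf : u → E → B₁ := fun c => (P c).indicator f - (V c).indicator (fun _ => a c)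
  have hPt : ∀ c, IsTest ((P c).indicator f) := fun c => hf.indicator (hPm c)
  have hVt : ∀ c, IsTest ((V c).indicator fun _ => a c) := fun c =>
    IsTest.const_indicator (hVm c) (h.isBounded_bl _ _) _
  have hbt : ∀ c, IsTest (bf c) := fun c => (hPt c).sub (hVt c)
  have hbs : ∀ c : u, Function.support (bf c) ⊆ bl B c.1.1 (c.1.2 + τ) := by
    intro c x hx
    by_contra hcon
    refine hx ?_
    have h1 : x ∉ P c := fun hxP => hcon (hPU c hxP)
    have h2 : x ∉ V c := fun hxV => hcon (hVU c hxV)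
    simp [bf, h1, h2]
  have hb0' : ∀ c, ∫ x, bf c x = 0 := by
    intro c
    have hv0 : volume (V c) ≠ 0 := h.volume_bl_ne_zero _ _
    have hvt : volume (V c) ≠ ∞ := h.volume_bl_ne_top _ _
    have i1 := memLp_one_iff_integrable.1 ((hPt c).memLp_volume h 1)
    have i2 := memLp_one_iff_integrable.1 ((hVt c).memLp_volume h 1)
    have : ∫ x, bf c x = (∫ x, (P c).indicator f x) - ∫ x, (V c).indicator (fun _ => a c) x :=
      integral_sub i1 i2
    rw [this, integral_indicator (hPm c), integral_indicator (hVm c), setIntegral_const,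
      Measure.real, smul_smul, mul_inv_cancel₀ (ENNReal.toReal_ne_zero.2 ⟨hv0, hvt⟩), one_smul,
      sub_self]
  have hb1 : ∀ c, ∫⁻ x, ‖bf c x‖ₑ ≤ 2 * ∫⁻ x in P c, ‖f x‖ₑ := by
    intro c
    calc ∫⁻ x, ‖bf c x‖ₑ
        ≤ ∫⁻ x, ((P c).indicator (fun x => ‖f x‖ₑ) x + (V c).indicator (fun _ => ‖a c‖ₑ) x) := by
          refine lintegral_mono fun x => ?_
          rw [← enorm_indicator_eq_indicator_enorm, ← enorm_indicator_eq_indicator_enorm]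
          exact enorm_sub_le
      _ = (∫⁻ x in P c, ‖f x‖ₑ) + ‖a c‖ₑ * volume (V c) := by
          rw [lintegral_add_right _ (measurable_const.indicator (hVm c)),
            lintegral_indicator (hPm c), lintegral_indicator_const (hVm c)]
      _ ≤ _ := by rw [two_mul]; exact add_le_add le_rfl (haV c)
  have hPsum : ∀ s : Finset u, ∑ c ∈ s, ∫⁻ x in P c, ‖f x‖ₑ ≤ ∫⁻ x in Ω, ‖f x‖ₑ := by
    intro s
    rw [← hPun, lintegral_iUnion hPm hPd]
    exact ENNReal.sum_le_tsum s
  set Ωs : Set E := ⋃ c : u, bl B c.1.1 (c.1.2 + τ + 2 * σ) with hΩs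
  have hΩsm : MeasurableSet Ωs := MeasurableSet.iUnion fun c => h.measurableSet_bl _ _
  have hΩsv : t * volume Ωs ≤ c₂ * ∫⁻ x, ‖f x‖ₑ := by
    calc t * volume Ωs ≤ t * ∑' c : u, volume (bl B c.1.1 (c.1.2 + τ + 2 * σ)) :=
          mul_le_mul' le_rfl (measure_iUnion_le _)
      _ = t * ((b ^ (τ + 2 * σ) : ℝ≥0) * ∑' c : u, volume (V c)) := by
          rw [← ENNReal.tsum_mul_left (a := ((b ^ (τ + 2 * σ) : ℝ≥0) : ℝ≥0∞))]
          congr 2 with c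
          rw [add_assoc, h.volume_bl_add c.1.1 c.1.1]
      _ ≤ t * ((b ^ (τ + 2 * σ) : ℝ≥0) * volume Ω) := by
          refine mul_le_mul' le_rfl (mul_le_mul' le_rfl ?_)
          rw [← measure_iUnion hVd hVm]
          exact measure_mono (iUnion_subset hVΩ)
      _ = (b ^ (τ + 2 * σ) : ℝ≥0) * (t * volume Ω) := by ring
      _ ≤ (b ^ (τ + 2 * σ) : ℝ≥0) * ((b ^ τ + 2 : ℝ≥0) * ∫⁻ x, ‖f x‖ₑ) :=
          mul_le_mul' le_rfl hΩ
      _ = _ := by rw [hc₂, ENNReal.coe_mul, mul_assoc]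
  -- the bad part
  have hbad : ∀ s : Finset u, t * volume {x | (t : ℝ≥0∞) < ‖opFn T (∑ c ∈ s, bf c) x‖ₑ} ≤
      (2 * A + c₂ : ℝ≥0) * ∫⁻ x, ‖f x‖ₑ := by
    intro s
    have hms := measurable_enorm_opFn T (∑ c ∈ s, bf c)
    have h1 : ∫⁻ x in Ωsᶜ, ‖opFn T (∑ c ∈ s, bf c) x‖ₑ ≤ (2 * A : ℝ≥0) * ∫⁻ x, ‖f x‖ₑ := by
      calc ∫⁻ x in Ωsᶜ, ‖opFn T (∑ c ∈ s, bf c) x‖ₑ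
          ≤ ∫⁻ x in Ωsᶜ, ∑ c ∈ s, ‖opFn T (bf c) x‖ₑ := by
            refine lintegral_mono_ae (ae_restrict_of_ae ?_)
            filter_upwards [opFn_sum T s fun c => (hbt c).memLp_volume h r] with x hx
            rw [hx, Finset.sum_apply]
            exact enorm_sum_le _ _
        _ = ∑ c ∈ s, ∫⁻ x in Ωsᶜ, ‖opFn T (bf c) x‖ₑ :=
            lintegral_finsetSum _ fun c _ => measurable_enorm_opFn T _
        _ ≤ ∑ c ∈ s, (2 * A : ℝ≥0) * ∫⁻ x in P c, ‖f x‖ₑ := by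
            refine Finset.sum_le_sum fun c _ => ?_
            calc ∫⁻ x in Ωsᶜ, ‖opFn T (bf c) x‖ₑ
                ≤ ∫⁻ x in (bl B c.1.1 (c.1.2 + τ + 2 * σ))ᶜ, ‖opFn T (bf c) x‖ₑ :=
                  lintegral_mono_set (compl_subset_compl.2 (subset_iUnion
                    (fun c : u => bl B c.1.1 (c.1.2 + τ + 2 * σ)) c))
              _ ≤ A * (2 * ∫⁻ x in P c, ‖f x‖ₑ) :=
                  (h.lintegral_opFn_atom_le hK hT (hbt c) (hbs c) (hb0' c)).trans
                    (mul_le_mul' le_rfl (hb1 c))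
              _ = _ := by push_cast; ring
        _ ≤ _ := by
            rw [← Finset.mul_sum]
            exact mul_le_mul' le_rfl ((hPsum s).trans (setLIntegral_le_lintegral _ _))
    have h2 : t * volume ({x | (t : ℝ≥0∞) < ‖opFn T (∑ c ∈ s, bf c) x‖ₑ} ∩ Ωsᶜ) ≤
        (2 * A : ℝ≥0) * ∫⁻ x, ‖f x‖ₑ := by
      refine le_trans ?_ h1
      rw [← Measure.restrict_apply (show MeasurableSet
        {x | (t : ℝ≥0∞) < ‖opFn T (∑ c ∈ s, bf c) x‖ₑ} from hms measurableSet_Ioi)]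
      refine le_trans (mul_le_mul' le_rfl (measure_mono fun x hx => ?_))
        (mul_meas_ge_le_lintegral₀ hms.aemeasurable t)
      exact le_of_lt (show (t : ℝ≥0∞) < _ from hx)
    calc t * volume {x | (t : ℝ≥0∞) < ‖opFn T (∑ c ∈ s, bf c) x‖ₑ}
        ≤ t * (volume ({x | (t : ℝ≥0∞) < ‖opFn T (∑ c ∈ s, bf c) x‖ₑ} ∩ Ωsᶜ) + volume Ωs) := by
          refine mul_le_mul' le_rfl ((measure_mono fun x hx => ?_).trans (measure_union_le _ _))
          by_cases hxΩ : x ∈ Ωs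
          · exact Or.inr hxΩ
          · exact Or.inl ⟨hx, hxΩ⟩
      _ ≤ _ := by
          rw [mul_add, ENNReal.coe_add, add_mul]
          exact add_le_add h2 hΩsv
  -- the good part
  let g : Finset u → E → B₁ := fun s =>
    Ωᶜ.indicator f + ∑ c ∈ s, (V c).indicator fun _ => a c
  have hgt : ∀ s, IsTest (g s) := fun s =>
    (hf.indicator hΩo.measurableSet.compl).add (IsTest.sum s hVt)
  have hgood : ∀ s : Finset u, t * volume {x | (t : ℝ≥0∞) < ‖opFn T (g s) x‖ₑ} ≤
      c₁ * ∫⁻ x, ‖f x‖ₑ := by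
    intro s
    have hbnd : ∀ x, ‖g s x‖ₑ ≤ (b ^ τ * t : ℝ≥0) := by
      intro x
      by_cases hx : x ∈ Ω
      · have h1 : Ωᶜ.indicator f x = 0 := indicator_of_notMem (notMem_compl_iff.2 hx) _
        simp only [g, Pi.add_apply, h1, zero_add, Finset.sum_apply]
        by_cases hex : ∃ c ∈ s, x ∈ V c
        · obtain ⟨c, hc, hxc⟩ := hex
          rw [Finset.sum_eq_single_of_mem c hc, indicator_of_mem hxc]
          · exact hat c
          · intro d _ hdc
            exact indicator_of_notMem (fun hxd => disjoint_left.1 (hVd hdc) hxd hxc) _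
        · rw [Finset.sum_eq_zero]
          · simp
          · intro c hc
            exact indicator_of_notMem (fun hxc => hex ⟨c, hc, hxc⟩) _
      · have h1 : ∀ c, (V c).indicator (fun _ => a c) x = 0 := fun c =>
          indicator_of_notMem (fun hcon => hx (hVΩ c hcon)) _
        simp only [g, Pi.add_apply, Finset.sum_apply, h1, Finset.sum_const_zero, add_zero]
        rw [indicator_of_mem (show x ∈ Ωᶜ from hx)]
        refine (hfΩ x hx).trans (ENNReal.coe_le_coe.2 ?_)
        exact le_mul_of_one_le_left' (one_le_zpow₀ h.one_lt.le (by lia))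
    have hint : ∫⁻ x, ‖g s x‖ₑ ≤ ∫⁻ x, ‖f x‖ₑ := by
      calc ∫⁻ x, ‖g s x‖ₑ
          ≤ ∫⁻ x, (Ωᶜ.indicator (fun x => ‖f x‖ₑ) x +
              ∑ c ∈ s, (V c).indicator (fun _ => ‖a c‖ₑ) x) := by
            refine lintegral_mono fun x => ?_
            simp only [g, Pi.add_apply, Finset.sum_apply]
            refine (enorm_add_le _ _).trans (add_le_add (enorm_indicator_eq_indicator_enorm _ _).le ?_)
            refine (enorm_sum_le _ _).trans (Finset.sum_le_sum fun c _ => ?_)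
            exact (enorm_indicator_eq_indicator_enorm _ _).le
        _ = (∫⁻ x in Ωᶜ, ‖f x‖ₑ) + ∑ c ∈ s, ‖a c‖ₑ * volume (V c) := by
            rw [lintegral_add_right _ (Finset.measurable_sum _ fun c _ =>
              measurable_const.indicator (hVm c)), lintegral_indicator hΩo.measurableSet.compl,
              lintegral_finsetSum _ fun c _ => measurable_const.indicator (hVm c)]
            simp only [lintegral_indicator_const (hVm _)]
        _ ≤ (∫⁻ x in Ωᶜ, ‖f x‖ₑ) + ∫⁻ x in Ω, ‖f x‖ₑ :=
            add_le_add le_rfl ((Finset.sum_le_sum fun c _ => haV c).trans (hPsum s))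
        _ = _ := by rw [add_comm, lintegral_add_compl _ hΩo.measurableSet]
    exact (h.measure_lt_opFn_le_of_bounded hr hr' (hgt s) ht hbnd).trans
      (mul_le_mul' le_rfl hint)
  -- the error
  let e : Finset u → E → B₁ := fun s => (Ω \ ⋃ c ∈ s, P c).indicator f
  have hem : ∀ s : Finset u, MeasurableSet (Ω \ ⋃ c ∈ s, P c) := fun s =>
    hΩo.measurableSet.diff (s.measurableSet_biUnion fun c _ => hPm c)
  have het : ∀ s, IsTest (e s) := fun s => hf.indicator (hem s)
  have hdec : ∀ s, f = g s + (∑ c ∈ s, bf c + e s) := by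
    intro s
    have hsum : ∑ c ∈ s, bf c = (⋃ c ∈ s, P c).indicator f -
        ∑ c ∈ s, (V c).indicator fun _ => a c := by
      simp only [bf, Finset.sum_sub_distrib]
      congr 1
      rw [Finset.indicator_biUnion s P fun c _ d _ hcd => hPd hcd]
      ext x; simp
    have hPΩ : (⋃ c ∈ s, P c) ⊆ Ω := iUnion₂_subset fun c _ => hPun ▸ subset_iUnion P c
    have h3 : f = Ωᶜ.indicator f + ((⋃ c ∈ s, P c).indicator f + e s) := by
      ext x
      simp only [e, Pi.add_apply]
      by_cases hx : x ∈ Ω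
      · by_cases hxP : x ∈ ⋃ c ∈ s, P c
        · rw [indicator_of_notMem (notMem_compl_iff.2 hx), indicator_of_mem hxP,
            indicator_of_notMem (fun hcon => hcon.2 hxP)]; simp
        · rw [indicator_of_notMem (notMem_compl_iff.2 hx), indicator_of_notMem hxP,
            indicator_of_mem (show x ∈ Ω \ ⋃ c ∈ s, P c from ⟨hx, hxP⟩)]; simp
      · rw [indicator_of_mem (show x ∈ Ωᶜ from hx),
          indicator_of_notMem (fun hcon => hx (hPΩ hcon)),
          indicator_of_notMem (fun hcon => hx hcon.1)]; simp
    rw [hsum]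
    conv_lhs => rw [h3]
    simp only [g]
    abel
  have herr : ∀ s, (t : ℝ≥0∞) ^ r.toReal * volume {x | (t : ℝ≥0∞) < ‖opFn T (e s) x‖ₑ} ≤
      ‖T‖ₑ ^ r.toReal * ∑' c : {c // c ∉ s}, ∫⁻ x in P c, ‖f x‖ₑ ^ r.toReal := by
    intro s
    refine (measure_lt_opFn_le T hr hr' ((het s).memLp_volume h r) ht).trans
      (mul_le_mul' le_rfl ?_)
    have h4 : ∀ x, ‖e s x‖ₑ ^ r.toReal =
        (Ω \ ⋃ c ∈ s, P c).indicator (fun x => ‖f x‖ₑ ^ r.toReal) x := by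
      intro x
      by_cases hx : x ∈ Ω \ ⋃ c ∈ s, P c
      · simp only [e, indicator_of_mem hx]
      · simp only [e, indicator_of_notMem hx, enorm_zero, ENNReal.zero_rpow_of_pos hR0]
    simp only [h4]
    rw [lintegral_indicator (hem s)]
    refine (lintegral_mono_set (t := ⋃ c : {c // c ∉ s}, P c) fun x hx => ?_).trans
      (lintegral_iUnion_le _ _)
    obtain ⟨c, hc⟩ := mem_iUnion.1 (hPun.symm ▸ hx.1 : x ∈ ⋃ c, P c)
    exact mem_iUnion.2 ⟨⟨c, fun hcs => hx.2 (mem_biUnion hcs hc)⟩, hc⟩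
  -- `T` is applied only to finite sums of bad pieces. The `L^r` mass of `f` on the remaining pieces
  -- tends to zero as the finite set grows, so Chebyshev's inequality removes the error in the
  -- limit.
  have hfR : ∑' c, ∫⁻ x in P c, ‖f x‖ₑ ^ r.toReal ≠ ∞ := by
    rw [← lintegral_iUnion hPm hPd]
    refine ((setLIntegral_le_lintegral _ _).trans_lt ?_).ne
    exact lintegral_rpow_enorm_lt_top_of_eLpNorm_lt_top (zero_lt_one.trans hr).ne' hr'.ne
      (hf.memLp_volume h r).2
  have hlim := ENNReal.tendsto_tsum_compl_atTop_zero hfR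
  have htR0 : (t : ℝ≥0∞) ^ r.toReal ≠ 0 := by simp [ENNReal.rpow_eq_zero_iff, ht.ne']
  have htRt : (t : ℝ≥0∞) ^ r.toReal ≠ ∞ :=
    ENNReal.rpow_ne_top_of_nonneg hR0.le ENNReal.coe_ne_top
  have hTt : ‖T‖ₑ ^ r.toReal ≠ ∞ := ENNReal.rpow_ne_top_of_nonneg hR0.le (by simp)
  have hlim' : Filter.Tendsto (fun s : Finset u => t * (((t : ℝ≥0∞) ^ r.toReal)⁻¹ *
      (‖T‖ₑ ^ r.toReal * ∑' c : {c // c ∉ s}, ∫⁻ x in P c, ‖f x‖ₑ ^ r.toReal)))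
      Filter.atTop (nhds 0) := by
    have h5 := ENNReal.Tendsto.const_mul (a := ‖T‖ₑ ^ r.toReal) hlim (Or.inr hTt)
    have h6 := ENNReal.Tendsto.const_mul (a := ((t : ℝ≥0∞) ^ r.toReal)⁻¹) h5
      (Or.inr (ENNReal.inv_ne_top.2 htR0))
    have h7 := ENNReal.Tendsto.const_mul (a := (t : ℝ≥0∞)) h6 (Or.inr ENNReal.coe_ne_top)
    simpa using h7
  have hmain : ∀ s : Finset u, t * volume {x | (t' : ℝ≥0∞) < ‖opFn T f x‖ₑ} ≤
      (c₁ + (2 * A + c₂) : ℝ≥0) * (∫⁻ x, ‖f x‖ₑ) + t * (((t : ℝ≥0∞) ^ r.toReal)⁻¹ *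
      (‖T‖ₑ ^ r.toReal * ∑' c : {c // c ∉ s}, ∫⁻ x in P c, ‖f x‖ₑ ^ r.toReal)) := by
    intro s
    have hsb : IsTest (∑ c ∈ s, bf c) := IsTest.sum s hbt
    have h8 : opFn T f =ᵐ[volume] opFn T (g s) + (opFn T (∑ c ∈ s, bf c) + opFn T (e s)) := by
      have h9 := opFn_add T ((hgt s).memLp_volume h r) ((hsb.add (het s)).memLp_volume h r)
      rw [← hdec s] at h9
      exact h9.trans (Filter.EventuallyEq.rfl.add
        (opFn_add T (hsb.memLp_volume h r) ((het s).memLp_volume h r)))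
    have h10 : volume {x | (t' : ℝ≥0∞) < ‖opFn T f x‖ₑ} ≤
        volume {x | (t : ℝ≥0∞) < ‖opFn T (g s) x‖ₑ} +
        (volume {x | (t : ℝ≥0∞) < ‖opFn T (∑ c ∈ s, bf c) x‖ₑ} +
        volume {x | (t : ℝ≥0∞) < ‖opFn T (e s) x‖ₑ}) := by
      refine le_trans (measure_mono_ae ?_) ((measure_union_le _ _).trans
        (add_le_add le_rfl (measure_union_le _ _)))
      filter_upwards [h8] with x hx hxt
      have hxt' : (t' : ℝ≥0∞) < ‖opFn T f x‖ₑ := hxt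
      by_contra hcon
      have hc1 : ¬ (t : ℝ≥0∞) < ‖opFn T (g s) x‖ₑ := fun hh => hcon (Or.inl hh)
      have hc2 : ¬ (t : ℝ≥0∞) < ‖opFn T (∑ c ∈ s, bf c) x‖ₑ := fun hh =>
        hcon (Or.inr (Or.inl hh))
      have hc3 : ¬ (t : ℝ≥0∞) < ‖opFn T (e s) x‖ₑ := fun hh => hcon (Or.inr (Or.inr hh))
      refine absurd hxt' (not_lt.2 ?_)
      rw [hx, ht3]
      calc _ ≤ ‖opFn T (g s) x‖ₑ + (‖opFn T (∑ c ∈ s, bf c) x‖ₑ + ‖opFn T (e s) x‖ₑ) :=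
            (enorm_add_le _ _).trans (add_le_add le_rfl (enorm_add_le _ _))
        _ ≤ t + (t + t) := add_le_add (not_lt.1 hc1) (add_le_add (not_lt.1 hc2) (not_lt.1 hc3))
        _ = _ := by push_cast; ring
    have h11 : volume {x | (t : ℝ≥0∞) < ‖opFn T (e s) x‖ₑ} ≤ ((t : ℝ≥0∞) ^ r.toReal)⁻¹ *
        (‖T‖ₑ ^ r.toReal * ∑' c : {c // c ∉ s}, ∫⁻ x in P c, ‖f x‖ₑ ^ r.toReal) := by
      rw [mul_comm, ← div_eq_mul_inv, ENNReal.le_div_iff_mul_le (Or.inl htR0) (Or.inl htRt),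
        mul_comm]
      exact herr s
    refine (mul_le_mul' le_rfl h10).trans ?_
    rw [mul_add, mul_add, ENNReal.coe_add c₁, add_mul, add_assoc]
    exact add_le_add (hgood s) (add_le_add (hbad s) (mul_le_mul' le_rfl h11))
  have hfinal : t * volume {x | (t' : ℝ≥0∞) < ‖opFn T f x‖ₑ} ≤
      (c₁ + (2 * A + c₂) : ℝ≥0) * ∫⁻ x, ‖f x‖ₑ := by
    have h12 := hlim'.const_add (((c₁ + (2 * A + c₂) : ℝ≥0) : ℝ≥0∞) * ∫⁻ x, ‖f x‖ₑ)
    rw [add_zero] at h12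
    exact ge_of_tendsto h12 (Filter.Eventually.of_forall hmain)
  calc t' * volume {x | (t' : ℝ≥0∞) < ‖opFn T f x‖ₑ}
      = 3 * (t * volume {x | (t' : ℝ≥0∞) < ‖opFn T f x‖ₑ}) := by
        rw [← mul_assoc]
        congr 1
        rw [ht3]; push_cast; rfl
    _ ≤ 3 * ((c₁ + (2 * A + c₂) : ℝ≥0) * ∫⁻ x, ‖f x‖ₑ) := mul_le_mul' le_rfl hfinal
    _ = _ := by rw [ENNReal.coe_mul 3, mul_assoc]; rfl

end IsBallFamily

end WeakType

/-! ### Good-λ inequalities and domination of `T` by the maximal function -/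

theorem lintegral_rpow_le_of_good_lambda {α : Type*} [MeasurableSpace α] {μ : Measure α} {q : ℝ}
    (hq : 0 < q) : ∃ η : ℝ≥0, 0 < η ∧ ∀ γ : ℝ≥0, 0 < γ → ∃ C : ℝ≥0,
      ∀ g M : α → ℝ≥0∞, Measurable g → Measurable M → ∫⁻ x, g x ^ q ∂μ ≠ ∞ →
      (∀ t : ℝ≥0, 0 < t → μ {x | ((4 * t : ℝ≥0) : ℝ≥0∞) < g x} ≤
        η * μ {x | (t : ℝ≥0∞) < g x} + μ {x | ((γ * t : ℝ≥0) : ℝ≥0∞) < M x}) →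
      ∫⁻ x, g x ^ q ∂μ ≤ C * ∫⁻ x, M x ^ q ∂μ := by
  have hlt := inv_four_rpow_lt_one hq
  have h1 : (1 - (4 : ℝ≥0∞)⁻¹ ^ q)⁻¹ ≠ ∞ := ENNReal.inv_ne_top.2 (tsub_pos_of_lt hlt).ne'
  have h1' : (1 - (4 : ℝ≥0∞)⁻¹ ^ q)⁻¹ ≠ 0 :=
    ENNReal.inv_ne_zero.2 ((tsub_le_self.trans_lt ENNReal.one_lt_top).ne)
  have h2 : (4 : ℝ≥0∞) ^ q ≠ ∞ := ENNReal.rpow_ne_top_of_nonneg hq.le (by norm_num)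
  have h2' : (4 : ℝ≥0∞) ^ q ≠ 0 := by
    rw [Ne, ENNReal.rpow_eq_zero_iff_of_pos hq]; norm_num
  obtain ⟨c, hc⟩ : ∃ c : ℝ≥0, (c : ℝ≥0∞) =
      4 ^ q * (4 ^ q * (1 - (4 : ℝ≥0∞)⁻¹ ^ q)⁻¹) :=
    ⟨_, ENNReal.coe_toNNReal (ENNReal.mul_ne_top h2 (ENNReal.mul_ne_top h2 h1))⟩
  have hc0 : 0 < c := by
    rw [← ENNReal.coe_pos, hc]
    exact pos_iff_ne_zero.2 (mul_ne_zero h2' (mul_ne_zero h2' h1'))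
  -- The constant `c` is the loss in passing from the integral to dyadic sums and back, including
  -- the shift by one level. This `η` leaves exactly half of the integral of `g ^ q` to be absorbed.
  -- It does not depend on `γ`, which is to be chosen after it.
  refine ⟨(2 * c)⁻¹, by positivity, fun γ hγ => ⟨2 * (c * (γ⁻¹) ^ q), ?_⟩⟩
  intro g M hg hM hfin hgl
  have hterm : ∀ k : ℤ, lev (k + 1) ^ q * μ {x | lev (k + 1) < g x} ≤
      4 ^ q * (((2 * c)⁻¹ : ℝ≥0) * (lev k ^ q * μ {x | lev k < g x}) +
        lev k ^ q * μ {x | lev k < (γ⁻¹ : ℝ≥0) * M x}) := by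
    intro k
    have h3 := hgl ((4 : ℝ≥0) ^ k) (by positivity)
    have h4 : ((4 * (4 : ℝ≥0) ^ k : ℝ≥0) : ℝ≥0∞) = lev (k + 1) := by
      rw [lev_succ, ENNReal.coe_mul]; rfl
    rw [h4] at h3
    have h5 : μ {x | ((γ * (4 : ℝ≥0) ^ k : ℝ≥0) : ℝ≥0∞) < M x} ≤
        μ {x | lev k < (γ⁻¹ : ℝ≥0) * M x} := by
      refine measure_mono fun x hx => ?_
      have hx' : ((γ * (4 : ℝ≥0) ^ k : ℝ≥0) : ℝ≥0∞) < M x := hx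
      show lev k < (γ⁻¹ : ℝ≥0) * M x
      rw [ENNReal.coe_inv hγ.ne', mul_comm, ← div_eq_mul_inv,
        ENNReal.lt_div_iff_mul_lt (Or.inl (by simpa using hγ.ne')) (Or.inl ENNReal.coe_ne_top),
        mul_comm]
      rwa [ENNReal.coe_mul] at hx'
    calc lev (k + 1) ^ q * μ {x | lev (k + 1) < g x}
        ≤ 4 ^ q * lev k ^ q * (((2 * c)⁻¹ : ℝ≥0) * μ {x | lev k < g x} +
          μ {x | lev k < (γ⁻¹ : ℝ≥0) * M x}) := by
          rw [lev_succ, ENNReal.mul_rpow_of_nonneg _ _ hq.le, ← lev_succ]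
          exact mul_le_mul' le_rfl (h3.trans (add_le_add le_rfl h5))
      _ = _ := by ring
  have hsum : ∀ G : α → ℝ≥0∞, Measurable G → ∑' k, lev k ^ q * μ {x | lev k < G x} ≤
      (1 - (4 : ℝ≥0∞)⁻¹ ^ q)⁻¹ * ∫⁻ x, G x ^ q ∂μ := by
    intro G hG
    rw [← lintegral_dyadicSum q hG.aemeasurable, ← lintegral_const_mul _ (hG.pow_const q)]
    exact lintegral_mono fun x => dyadicSum_le hq _
  have hmain : ∫⁻ x, g x ^ q ∂μ ≤ ((2 * c)⁻¹ : ℝ≥0) * (c * ∫⁻ x, g x ^ q ∂μ) +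
      c * ((γ⁻¹ ^ q : ℝ≥0) * ∫⁻ x, M x ^ q ∂μ) := by
    calc ∫⁻ x, g x ^ q ∂μ ≤ ∫⁻ x, 4 ^ q * dyadicSum q (g x) ∂μ :=
          lintegral_mono fun x => rpow_le_dyadicSum hq _
      _ = 4 ^ q * ∑' k, lev (k + 1) ^ q * μ {x | lev (k + 1) < g x} := by
          rw [lintegral_const_mul (f := fun x => dyadicSum q (g x)) _
            ((measurable_dyadicSum q).comp hg), lintegral_dyadicSum q hg.aemeasurable,
            ← (Equiv.addRight (1 : ℤ)).tsum_eq]; rfl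
      _ ≤ 4 ^ q * (4 ^ q * (((2 * c)⁻¹ : ℝ≥0) * ∑' k, lev k ^ q * μ {x | lev k < g x} +
            ∑' k, lev k ^ q * μ {x | lev k < (γ⁻¹ : ℝ≥0) * M x})) := by
          refine mul_le_mul' le_rfl ((ENNReal.tsum_le_tsum hterm).trans (le_of_eq ?_))
          rw [ENNReal.tsum_mul_left, ENNReal.tsum_add, ENNReal.tsum_mul_left]
      _ ≤ 4 ^ q * (4 ^ q * (((2 * c)⁻¹ : ℝ≥0) *
            ((1 - (4 : ℝ≥0∞)⁻¹ ^ q)⁻¹ * ∫⁻ x, g x ^ q ∂μ) +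
            (1 - (4 : ℝ≥0∞)⁻¹ ^ q)⁻¹ * ∫⁻ x, ((γ⁻¹ : ℝ≥0) * M x) ^ q ∂μ)) :=
          mul_le_mul' le_rfl (mul_le_mul' le_rfl (add_le_add (mul_le_mul' le_rfl (hsum g hg))
            (hsum _ (hM.const_mul _))))
      _ = _ := by
          simp only [ENNReal.mul_rpow_of_nonneg _ _ hq.le]
          rw [lintegral_const_mul _ (hM.pow_const q), hc, ENNReal.coe_rpow_of_nonneg _ hq.le]
          ring
  have hhalf : ((2 * c)⁻¹ : ℝ≥0) * (c * ∫⁻ x, g x ^ q ∂μ) = 2⁻¹ * ∫⁻ x, g x ^ q ∂μ := by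
    rw [← mul_assoc, ← ENNReal.coe_mul, mul_inv, mul_assoc, inv_mul_cancel₀ hc0.ne', mul_one,
      ENNReal.coe_inv (by norm_num)]
    rfl
  rw [hhalf] at hmain
  set I := ∫⁻ x, g x ^ q ∂μ with hI
  set R := c * ((γ⁻¹ ^ q : ℝ≥0) * ∫⁻ x, M x ^ q ∂μ) with hR
  have h6 : 2⁻¹ * I ≤ R := by
    have h7 : 2⁻¹ * I + 2⁻¹ * I ≤ 2⁻¹ * I + R := by
      rw [← add_mul, ENNReal.inv_two_add_inv_two, one_mul]; exact hmain
    exact (ENNReal.add_le_add_iff_left (ENNReal.mul_ne_top (by simp) hfin)).1 h7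
  calc I = 2 * (2⁻¹ * I) := by
        rw [← mul_assoc, ENNReal.mul_inv_cancel (by norm_num) (by norm_num), one_mul]
    _ ≤ 2 * R := mul_le_mul' le_rfl h6
    _ = _ := by rw [hR]; push_cast; ring

section GoodLambda

set_option linter.unusedSectionVars false

variable {E : Type*} [NormedAddCommGroup E] [MeasureSpace E]
variable {B₁ B₂ : Type*} [NormedAddCommGroup B₁] [NormedSpace ℂ B₁]
  [NormedAddCommGroup B₂] [NormedSpace ℂ B₂]
variable {B : ℤ → Set E} {b : ℝ≥0} {σ : ℤ}
variable [BorelSpace E] [ProperSpace E]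

namespace IsBallFamily

variable (h : IsBallFamily b σ B)
include h

variable {K : E → E → B₁ →L[ℂ] B₂} {C θ : ℝ≥0} {r : ℝ≥0∞} [Fact (1 ≤ r)]
  {T : Lp B₁ r (volume : Measure E) →L[ℂ] Lp B₂ r (volume : Measure E)}
  [CompleteSpace B₁] [CompleteSpace B₂]

/-- The distant part of a function changes little under `T` on a ball. -/
theorem exists_approx_const (hK : IsKernel B b σ K C θ) (hT : IsRepresentedBy T K) {f : E → B₁}
    (hf : IsTest f) {c x₀ : E} {m : ℤ} (hx₀ : x₀ ∈ bl B c m) {s : ℝ≥0∞}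
    (hs : maxFn B volume (fun x => ‖f x‖ₑ) x₀ ≤ s) :
    ∃ I : B₂, ∀ᵐ x, x ∈ bl B c m →
      ‖opFn T ((bl B c (m + 2 * σ))ᶜ.indicator f) x - I‖ₑ ≤ (C * b * (1 - θ)⁻¹ : ℝ≥0) * s := by
  have hσ := h.one_le
  have hUm := h.measurableSet_bl c (m + 2 * σ)
  set f₂ := (bl B c (m + 2 * σ))ᶜ.indicator f with hf₂
  have hf₂t : IsTest f₂ := hf.indicator hUm.compl
  have hfi : Integrable f₂ volume := memLp_one_iff_integrable.1 (hf₂t.memLp_volume h 1)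
  have hts : tsupport f₂ ⊆ (bl B c (m + 2 * σ))ᶜ :=
    closure_minimal (by rw [hf₂]; exact support_indicator_subset)
      (h.isOpen_bl c (m + 2 * σ)).isClosed_compl
  have hvan : ∀ x ∈ bl B c m, ∀ y ∈ bl B x m, f₂ y = 0 := by
    intro x hx y hy
    refine indicator_of_notMem (notMem_compl_iff.2 ?_) _
    exact h.bl_mono c (by lia) (h.mem_trans hx hy)
  -- The constant is the kernel integral at the centre, near which `f₂` vanishes. The averages
  -- entering the shell estimate are over balls about `c` that contain `x₀`, hence at most `Mf(x₀)`.
  refine ⟨∫ z, K c z (f₂ z), ?_⟩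
  filter_upwards [hT f₂ hf₂t] with x hx hxU
  rw [hx fun hcon => hts hcon (h.bl_mono c (by lia) hxU)]
  rw [← integral_sub (h.integrable_kernel_apply hK x hfi (hvan x hxU))
    (h.integrable_kernel_apply hK c hfi (hvan c (h.mem_self c m)))]
  refine (enorm_integral_le_lintegral_enorm _).trans ?_
  refine le_trans (lintegral_mono fun z => ?_) (h.lintegral_shellSum_mul_le hK.lt_one
    (F := fun z => ‖f z‖ₑ) (c := c) (m := m) (s := s) hf.aestronglyMeasurable.enorm ?_)
  · by_cases hz : z ∈ bl B c (m + 2 * σ)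
    · have : f₂ z = 0 := indicator_of_notMem (notMem_compl_iff.2 hz) _
      simp [this]
    · have h1 := (h.enorm_sub_le_shellSum hK hxU hz).1
      have h2 : f₂ z = f z := indicator_of_mem (show z ∈ (bl B c (m + 2 * σ))ᶜ from hz) _
      calc ‖K x z (f₂ z) - K c z (f₂ z)‖ₑ = ‖(K c z - K x z) (f z)‖ₑ := by
            rw [← enorm_neg, neg_sub, _root_.sub_apply, h2]
        _ ≤ ‖K c z - K x z‖ₑ * ‖f z‖ₑ := ContinuousLinearMap.le_opENorm _ _
        _ ≤ _ := mul_le_mul' h1 le_rfl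
  · intro l hl
    exact (ENNReal.div_le_iff_le_mul (Or.inl (h.volume_bl_ne_zero _ _))
      (Or.inl (h.volume_bl_ne_top _ _))).1
      ((lintegral_div_le_maxFn _ (h.bl_mono c hl hx₀)).trans hs)

/-- Split `f = f₁ + f₂` at index `m + 2σ`. On the ball `T f₂` is within `t/2` of a constant `I`. The
set `{‖T f₁‖ > t}` is too small to cover `Y`, so some `y ∈ Y` has both `‖T f‖ ≤ t` and `‖T f₁‖ ≤ t`,
whence `‖I‖ ≤ 5t/2`. Wherever `‖T f₁‖ ≤ t` on the ball, `‖T f‖ ≤ t + 5t/2 + t/2 = 4t`. The set `Y`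
takes the place of maximal truncations. -/
theorem measure_inter_bl_le (hK : IsKernel B b σ K C θ) (hT : IsRepresentedBy T K) {C₁ : ℝ≥0}
    (hC₁ : ∀ f : E → B₁, IsTest f → ∀ t : ℝ≥0, 0 < t →
      t * volume {x | (t : ℝ≥0∞) < ‖opFn T f x‖ₑ} ≤ C₁ * ∫⁻ x, ‖f x‖ₑ)
    {f : E → B₁} (hf : IsTest f) {c x₀ : E} {m : ℤ} (hx₀ : x₀ ∈ bl B c m) {γ t : ℝ≥0}
    (ht : 0 < t) (hγ : (C * b * (1 - θ)⁻¹) * γ ≤ 1 / 2)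
    (hM : maxFn B volume (fun x => ‖f x‖ₑ) x₀ ≤ (γ * t : ℝ≥0)) {Y : Set E} (hYU : Y ⊆ bl B c m)
    (hYt : ∀ y ∈ Y, ‖opFn T f y‖ₑ ≤ t)
    (hY : (C₁ * γ * b ^ (2 * σ) : ℝ≥0) * volume (bl B c m) < volume Y) :
    volume ({x | ((4 * t : ℝ≥0) : ℝ≥0∞) < ‖opFn T f x‖ₑ} ∩ bl B c m) ≤
      (C₁ * γ * b ^ (2 * σ) : ℝ≥0) * volume (bl B c m) := by
  have hσ := h.one_le
  have ht0 : (t : ℝ≥0∞) ≠ 0 := by simpa using ht.ne'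
  have hUm := h.measurableSet_bl c (m + 2 * σ)
  set f₁ := (bl B c (m + 2 * σ)).indicator f with hf₁
  set f₂ := (bl B c (m + 2 * σ))ᶜ.indicator f with hf₂
  have hf₁t : IsTest f₁ := hf.indicator hUm
  have hf₂t : IsTest f₂ := hf.indicator hUm.compl
  have hadd : f₁ + f₂ = f := indicator_self_add_compl _ _
  have hTadd : opFn T f =ᵐ[volume] opFn T f₁ + opFn T f₂ := by
    have := opFn_add T (hf₁t.memLp_volume h r) (hf₂t.memLp_volume h r)
    rwa [hadd] at this
  obtain ⟨I, hI⟩ := h.exists_approx_const hK hT hf hx₀ hM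
  have hhalf : (C * b * (1 - θ)⁻¹ : ℝ≥0) * ((γ * t : ℝ≥0) : ℝ≥0∞) ≤ (t / 2 : ℝ≥0) := by
    rw [← ENNReal.coe_mul, ENNReal.coe_le_coe, ← mul_assoc]
    refine (mul_le_mul' hγ le_rfl).trans (le_of_eq ?_)
    ring
  have hweak : volume {x | (t : ℝ≥0∞) < ‖opFn T f₁ x‖ₑ} ≤
      (C₁ * γ * b ^ (2 * σ) : ℝ≥0) * volume (bl B c m) := by
    rw [← ENNReal.mul_le_mul_iff_right ht0 ENNReal.coe_ne_top]
    refine (hC₁ f₁ hf₁t t ht).trans ?_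
    have h1 : ∫⁻ x, ‖f₁ x‖ₑ ≤ (γ * t : ℝ≥0) * volume (bl B c (m + 2 * σ)) := by
      simp only [hf₁, enorm_indicator_eq_indicator_enorm]
      rw [lintegral_indicator hUm]
      exact (ENNReal.div_le_iff_le_mul (Or.inl (h.volume_bl_ne_zero _ _))
        (Or.inl (h.volume_bl_ne_top _ _))).1
        ((lintegral_div_le_maxFn _ (h.bl_mono c (by lia) hx₀)).trans hM)
    refine (mul_le_mul' le_rfl h1).trans (le_of_eq ?_)
    rw [h.volume_bl_add c c m (2 * σ)]
    push_cast; ring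
  have hI' : ‖I‖ₑ ≤ (t + t + t / 2 : ℝ≥0) := by
    have hfreq : ∃ᵐ y, y ∈ Y ∧ ‖opFn T f₁ y‖ₑ ≤ t := by
      intro hcon
      refine absurd (measure_mono_ae ?_ : volume Y ≤ volume {x | (t : ℝ≥0∞) < ‖opFn T f₁ x‖ₑ})
        (not_le.2 (hweak.trans_lt hY))
      filter_upwards [hcon] with y hy hyY
      exact not_le.1 fun hle => hy ⟨hyY, hle⟩
    obtain ⟨y, ⟨hyY, hy1⟩, hyadd, hyI⟩ := (hfreq.and_eventually (hTadd.and hI)).exists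
    have hyI' := (hyI (hYU hyY)).trans hhalf
    have h2 : I = opFn T f y - opFn T f₁ y - (opFn T f₂ y - I) := by
      rw [hyadd, Pi.add_apply]; abel
    rw [h2, ENNReal.coe_add, ENNReal.coe_add]
    exact enorm_sub_le.trans (add_le_add (enorm_sub_le.trans (add_le_add (hYt y hyY) hy1)) hyI')
  refine le_trans (measure_mono_ae ?_) hweak
  filter_upwards [hTadd, hI] with x hxadd hxI hx
  have hx4 : ((4 * t : ℝ≥0) : ℝ≥0∞) < ‖opFn T f x‖ₑ := hx.1
  by_contra hcon
  have hx1 : ‖opFn T f₁ x‖ₑ ≤ t := not_lt.1 hcon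
  refine absurd hx4 (not_lt.2 ?_)
  have h3 : opFn T f x = opFn T f₁ x + (I + (opFn T f₂ x - I)) := by
    rw [hxadd, Pi.add_apply]; abel
  have h4 : (4 * t : ℝ≥0) = t + ((t + t + t / 2) + t / 2) := by ring
  rw [h3, h4, ENNReal.coe_add, ENNReal.coe_add (t + t + t / 2)]
  exact (enorm_add_le _ _).trans (add_le_add hx1 ((enorm_add_le _ _).trans
    (add_le_add hI' ((hxI hx.2).trans hhalf))))

/-- The good-`λ` inequality. -/
theorem exists_good_lambda {μ : Measure E} {p : ℝ} {Cμ : ℝ≥0} (hμ : IsComparable B μ p Cμ)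
    (hr : 1 < r) (hr' : r < ∞) (hK : IsKernel B b σ K C θ) (hT : IsRepresentedBy T K)
    {η : ℝ≥0} (hη : 0 < η) :
    ∃ γ : ℝ≥0, 0 < γ ∧ ∀ f : E → B₁, IsTest f → ∀ t : ℝ≥0, 0 < t →
      μ {x | ((4 * t : ℝ≥0) : ℝ≥0∞) < ‖opFn T f x‖ₑ ∧
        maxFn B volume (fun x => ‖f x‖ₑ) x ≤ (γ * t : ℝ≥0)} ≤
        η * μ {x | (t : ℝ≥0∞) < ‖opFn T f x‖ₑ} := by
  obtain ⟨C₁, hC₁⟩ := h.exists_weak_one_one hr hr' hK hT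
  have hσ := h.one_le
  have hb0 := h.pos
  have hR0 : 0 < r.toReal := ENNReal.toReal_pos (zero_lt_one.trans hr).ne' hr'.ne
  have hlf : IsLocallyFiniteMeasure (volume : Measure E) :=
    h.isLocallyFiniteMeasure _ h.volume_bl_ne_top
  have hlfμ : IsLocallyFiniteMeasure μ := h.isLocallyFiniteMeasure _ hμ.ne_top
  set τ : ℤ := 1 + 2 * σ with hτ
  -- `D` bounds the `μ`-measure of an enlarged ball by that of the part of the original ball inside
  -- `O`: doubling, then comparability with share `1/(2b)`.
  set D : ℝ≥0 := Cμ * (b ^ τ) ^ p * (Cμ * (2 * b) ^ p) with hD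
  obtain ⟨ε, hε, hsmall⟩ := h.exists_small hμ (η := η / (D + 1)) (by positivity)
  set A : ℝ≥0 := C * b * (1 - θ)⁻¹ with hA
  -- The first entry is for `exists_small`; the second makes the exceptional set at most a quarter
  -- of the original ball, less than the half lying outside `O`.
  set ε' : ℝ≥0 := min ε ((b ^ τ)⁻¹ / 4) with hε'
  have hε'0 : 0 < ε' := lt_min hε (by positivity)
  set γ : ℝ≥0 := min (1 / 2 / (A + 1)) (ε' / (C₁ * b ^ (2 * σ) + 1)) with hγ
  have hγ0 : 0 < γ := lt_min (by positivity) (by positivity)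
  have hγA : A * γ ≤ 1 / 2 := by
    calc A * γ ≤ (A + 1) * (1 / 2 / (A + 1)) := mul_le_mul' le_self_add (min_le_left _ _)
      _ = 1 / 2 := mul_div_cancel₀ _ (by positivity)
  have hγε : C₁ * γ * b ^ (2 * σ) ≤ ε' := by
    calc C₁ * γ * b ^ (2 * σ) = C₁ * b ^ (2 * σ) * γ := by ring
      _ ≤ (C₁ * b ^ (2 * σ) + 1) * (ε' / (C₁ * b ^ (2 * σ) + 1)) :=
        mul_le_mul' le_self_add (min_le_right _ _)
      _ = ε' := mul_div_cancel₀ _ (by positivity)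
  refine ⟨γ, hγ0, fun f hf t ht => ?_⟩
  set S : Set E := {x | (t : ℝ≥0∞) < ‖opFn T f x‖ₑ} with hS
  set G : Set E := {x | ((4 * t : ℝ≥0) : ℝ≥0∞) < ‖opFn T f x‖ₑ ∧
        maxFn B volume (fun x => ‖f x‖ₑ) x ≤ (γ * t : ℝ≥0)} with hG
  by_cases hSt : μ S = ∞
  · rw [hSt, ENNReal.mul_top (by simpa using hη.ne')]; exact le_top
  have hSv : volume S ≠ ∞ := by
    intro hcon
    have h1 := measure_lt_opFn_le T hr hr' (hf.memLp_volume h r) ht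
    rw [← hS, hcon, ENNReal.mul_top (by simp [ENNReal.rpow_eq_zero_iff, ht.ne'])] at h1
    refine ENNReal.mul_ne_top (ENNReal.rpow_ne_top_of_nonneg hR0.le (by simp)) ?_
      (top_le_iff.1 h1)
    exact (lintegral_rpow_enorm_lt_top_of_eLpNorm_lt_top (zero_lt_one.trans hr).ne' hr'.ne
      (hf.memLp_volume h r).2).ne
  -- The neighbourhood of `S` must have `μ`-measure close to that of `S` for the conclusion, and
  -- finite volume for the selection of balls; two open sets are intersected.
  have hopen : ∀ δ : ℝ≥0, 0 < δ → μ G ≤ η * (μ S + δ) := by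
    intro δ hδ
    obtain ⟨O₁, hSO₁, hO₁, hO₁lt⟩ := S.exists_isOpen_lt_of_lt (μ := μ) (μ S + δ)
      (ENNReal.lt_add_right hSt (by simpa using hδ.ne'))
    obtain ⟨O₂, hSO₂, hO₂, hO₂lt⟩ := S.exists_isOpen_lt_of_lt (μ := volume) (volume S + 1)
      (ENNReal.lt_add_right hSv one_ne_zero)
    set O := O₁ ∩ O₂ with hO
    have hOo : IsOpen O := hO₁.inter hO₂
    have hOv : volume O ≠ ∞ := ((measure_mono inter_subset_right).trans_lt
      (hO₂lt.trans_le le_top)).ne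
    have hSO : S ⊆ O := subset_inter hSO₁ hSO₂
    have hGS : G ⊆ S := by
      intro x hx
      refine lt_of_le_of_lt ?_ hx.1
      rw [ENNReal.coe_le_coe]
      exact le_mul_of_one_le_left' (by norm_num)
    obtain ⟨u, huc, hud, hcov, hu⟩ := h.exists_selection hOo hOv
    have hcount : Countable u := huc.to_subtype
    have hlocal : ∀ c : u, μ (G ∩ bl B c.1.1 (c.1.2 + τ)) ≤
        (η / (D + 1) : ℝ≥0) * μ (bl B c.1.1 (c.1.2 + τ)) := by
      intro c
      rcases (G ∩ bl B c.1.1 (c.1.2 + τ)).eq_empty_or_nonempty with hemp | ⟨x₀, hx₀⟩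
      · rw [hemp]; simp
      have hvU : volume (bl B c.1.1 (c.1.2 + τ)) =
          ((b ^ τ : ℝ≥0) : ℝ≥0∞) * volume (bl B c.1.1 c.1.2) := h.volume_bl_add _ _ _ _
      have hY : (C₁ * γ * b ^ (2 * σ) : ℝ≥0) * volume (bl B c.1.1 (c.1.2 + τ)) <
          volume (bl B c.1.1 c.1.2 \ O) := by
        have h1 := (hu c c.2).2.2
        have hv0 := h.volume_bl_ne_zero c.1.1 c.1.2
        have hvt := h.volume_bl_ne_top c.1.1 c.1.2
        have h2 : (C₁ * γ * b ^ (2 * σ) : ℝ≥0) * volume (bl B c.1.1 (c.1.2 + τ)) ≤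
            (1 / 4 : ℝ≥0) * volume (bl B c.1.1 c.1.2) := by
          rw [hvU, ← mul_assoc, ← ENNReal.coe_mul]
          refine mul_le_mul' (ENNReal.coe_le_coe.2 ?_) le_rfl
          refine (mul_le_mul' (hγε.trans (min_le_right _ _)) le_rfl).trans (le_of_eq ?_)
          have := (h.zpow_pos' τ).ne'
          field_simp
        refine h2.trans_lt ?_
        have h3 : (1 / 2 : ℝ≥0) * volume (bl B c.1.1 c.1.2) ≤ volume (bl B c.1.1 c.1.2 \ O) := by
          refine (mul_le_mul' le_rfl h1).trans (le_of_eq ?_)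
          rw [← mul_assoc, ← ENNReal.coe_mul]
          norm_num
        refine lt_of_lt_of_le (ENNReal.mul_lt_mul_left hv0 hvt ?_) h3
        rw [ENNReal.coe_lt_coe, ← NNReal.coe_lt_coe]
        norm_num
      have h4 := h.measure_inter_bl_le hK hT hC₁ hf hx₀.2 ht hγA hx₀.1.2
        (sdiff_subset.trans (h.bl_mono _ (by lia))) (fun y hy => by
          by_contra hcon
          exact hy.2 (hSO (not_le.1 hcon))) hY
      refine hsmall _ _ _ inter_subset_right ?_
      refine (measure_mono (inter_subset_inter_left _ fun x hx => hx.1)).trans (h4.trans ?_)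
      exact mul_le_mul' (ENNReal.coe_le_coe.2 (hγε.trans (min_le_left _ _))) le_rfl
    calc μ G ≤ μ (⋃ c : u, G ∩ bl B c.1.1 (c.1.2 + τ)) := by
          refine measure_mono fun x hx => ?_
          obtain ⟨c, hc, hxc⟩ := mem_iUnion₂.1 (hcov (hSO (hGS hx)))
          exact mem_iUnion.2 ⟨⟨c, hc⟩, hx, hxc⟩
      _ ≤ ∑' c : u, μ (G ∩ bl B c.1.1 (c.1.2 + τ)) := measure_iUnion_le _
      _ ≤ ∑' c : u, (η / (D + 1) : ℝ≥0) * (D * μ (bl B c.1.1 c.1.2 ∩ O)) := by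
          refine ENNReal.tsum_le_tsum fun c => (hlocal c).trans (mul_le_mul' le_rfl ?_)
          refine (h.isDoublingFor hμ c.1.1 c.1.2).trans ?_
          rw [hD, ENNReal.coe_mul (Cμ * (b ^ τ) ^ p), mul_assoc]
          exact mul_le_mul' le_rfl (h.measure_bl_le hμ ((h.measurableSet_bl _ _).inter
            hOo.measurableSet) inter_subset_left (hu c c.2).2.1)
      _ = (η / (D + 1) * D : ℝ≥0) * μ (⋃ c ∈ u, bl B c.1 c.2 ∩ O) := by
          rw [ENNReal.tsum_mul_left, ENNReal.tsum_mul_left, measure_biUnion huc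
            (hud.mono fun c => inter_subset_left) fun c _ =>
            (h.measurableSet_bl _ _).inter hOo.measurableSet, ENNReal.coe_mul (η / (D + 1)) D,
            mul_assoc]
      _ ≤ η * μ O₁ := by
          refine mul_le_mul' (ENNReal.coe_le_coe.2 ?_) (measure_mono ?_)
          · rw [div_mul_eq_mul_div]
            refine div_le_of_le_mul₀ (by positivity) (by positivity) ?_
            exact mul_le_mul' le_rfl le_self_add
          · exact iUnion₂_subset fun c _ => inter_subset_right.trans inter_subset_left
      _ ≤ η * (μ S + δ) := mul_le_mul' le_rfl hO₁lt.le
  refine ENNReal.le_of_forall_pos_le_add fun δ hδ _ => ?_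
  have h1 := hopen (δ / η) (by positivity)
  rwa [mul_add, ← ENNReal.coe_mul, mul_div_cancel₀ _ hη.ne'] at h1

/-- Only the size of the kernel is used. For `x` in the shell of index `m + 2σ + i` the kernel is at
most `C b^{-(m+σ+i)}` on the support, while a ball containing `x` and the support has volume
`b^{m+2σ+i+1}`; the quotient is `b^{σ+1}`. This gives the a priori finiteness in both absorption
arguments. -/
theorem exists_enorm_opFn_le_maxFn (hK : IsKernel B b σ K C θ) (hT : IsRepresentedBy T K)
    {f : E → B₁} (hf : IsTest f) : ∃ k : ℤ, ∀ᵐ x, x ∉ bl B 0 k →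
      ‖opFn T f x‖ₑ ≤ (C * b ^ (σ + 1) : ℝ≥0) * maxFn B volume (fun x => ‖f x‖ₑ) x := by
  have hσ := h.one_le
  have hb0 := h.pos
  obtain ⟨m, hm⟩ := h.exists_subset_bl hf.bounded 0
  have hts : tsupport f ⊆ bl B 0 (m + σ) := (closure_mono hm).trans (h.closure_bl_subset 0 m)
  refine ⟨m + 2 * σ, ?_⟩
  filter_upwards [hT f hf] with x hx hxm
  rw [hx fun hcon => hxm (h.bl_mono 0 (by lia) (hts hcon))]
  obtain ⟨i, hi, hi'⟩ := h.exists_shell hxm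
  have hKx : ∀ y, ‖K x y (f y)‖ₑ ≤ ((C * (b ^ (m + σ + i))⁻¹ : ℝ≥0) : ℝ≥0∞) * ‖f y‖ₑ := by
    intro y
    by_cases hy : f y = 0
    · simp [hy]
    refine (ContinuousLinearMap.le_opENorm _ _).trans (mul_le_mul' ?_ le_rfl)
    refine ENNReal.coe_le_coe.2 (hK.size x y (m + σ + i) fun hxy => hi ?_)
    have := h.mem_trans (h.bl_mono 0 (by lia : m ≤ m + σ + i) (hm hy)) hxy
    exact h.bl_mono 0 (by lia) this
  have hint : ∫⁻ y in bl B 0 (m + 2 * σ + i + 1), ‖f y‖ₑ = ∫⁻ y, ‖f y‖ₑ := by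
    refine setLIntegral_eq_of_support_subset ?_
    intro y hy
    refine h.bl_mono 0 (by lia : m ≤ _) (hm ?_)
    simpa using hy
  have hV0 := h.volume_bl_ne_zero (0 : E) (m + 2 * σ + i + 1)
  have hVt := h.volume_bl_ne_top (0 : E) (m + 2 * σ + i + 1)
  calc ‖∫ y, K x y (f y)‖ₑ ≤ ∫⁻ y, ((C * (b ^ (m + σ + i))⁻¹ : ℝ≥0) : ℝ≥0∞) * ‖f y‖ₑ :=
        (enorm_integral_le_lintegral_enorm _).trans (lintegral_mono hKx)
    _ = ((C * (b ^ (m + σ + i))⁻¹ : ℝ≥0) : ℝ≥0∞) * ∫⁻ y, ‖f y‖ₑ :=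
        lintegral_const_mul'' _ hf.aestronglyMeasurable.enorm
    _ = (C * b ^ (σ + 1) : ℝ≥0) * ((∫⁻ y in bl B 0 (m + 2 * σ + i + 1), ‖f y‖ₑ) /
          volume (bl B (0 : E) (m + 2 * σ + i + 1))) := by
        have h1 : ((C * (b ^ (m + σ + i))⁻¹ : ℝ≥0) : ℝ≥0∞) = (C * b ^ (σ + 1) : ℝ≥0) *
            (volume (bl B (0 : E) (m + 2 * σ + i + 1)))⁻¹ := by
          rw [h.volume_bl, ← ENNReal.coe_inv (h.zpow_pos' _).ne', ← ENNReal.coe_mul,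
            ENNReal.coe_inj, mul_assoc]
          congr 1
          rw [show m + 2 * σ + i + 1 = (σ + 1) + (m + σ + i) by ring, zpow_add₀ hb0.ne' (σ + 1),
            mul_inv, ← mul_assoc, mul_inv_cancel₀ (h.zpow_pos' _).ne', one_mul]
        rw [hint, h1, div_eq_mul_inv]; ring
    _ ≤ _ := mul_le_mul' le_rfl (lintegral_div_le_maxFn _ hi')

/-- Absorption needs a finite integral, so `‖T f‖` is first cut off at height `N`: it is then
bounded on a ball of finite `μ`-measure and dominated by `M` elsewhere. The cut-off preserves the
good-λ inequality, because the left side is empty when `N ≤ 4t` and `{‖T f‖ > t}` is unchanged when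
`N > t`. Monotone convergence lets `N` tend to infinity. -/
theorem exists_strong_bound {μ : Measure E} {p : ℝ} {Cμ : ℝ≥0} (hμ : IsComparable B μ p Cμ)
    (hr : 1 < r) (hr' : r < ∞) (hK : IsKernel B b σ K C θ) (hT : IsRepresentedBy T K)
    {q : ℝ} (hq : 0 < q) :
    ∃ C' : ℝ≥0, ∀ f : E → B₁, IsTest f →
      ∫⁻ x, ‖opFn T f x‖ₑ ^ q ∂μ ≤ C' * ∫⁻ x, maxFn B volume (fun x => ‖f x‖ₑ) x ^ q ∂μ := by
  obtain ⟨η, hη, H⟩ := lintegral_rpow_le_of_good_lambda (μ := μ) hq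
  obtain ⟨γ, hγ, hgl⟩ := h.exists_good_lambda hμ hr hr' hK hT hη
  obtain ⟨C', hC'⟩ := H γ hγ
  -- A nonzero constant makes the bound trivial when the integral of `M ^ q` is infinite.
  refine ⟨C' + 1, fun f hf => ?_⟩
  set M := maxFn B volume (fun x => ‖f x‖ₑ) with hM
  have hMm : Measurable M := h.measurable_maxFn _
  have hTm := measurable_enorm_opFn T f
  by_cases hMt : ∫⁻ x, M x ^ q ∂μ = ∞
  · rw [hMt, ENNReal.mul_top (by simp)]; exact le_top
  obtain ⟨k, hk⟩ := h.exists_enorm_opFn_le_maxFn hK hT hf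
  have hN : ∀ N : ℕ, ∫⁻ x, min ‖opFn T f x‖ₑ N ^ q ∂μ ≤ C' * ∫⁻ x, M x ^ q ∂μ := by
    intro N
    refine hC' _ M (hTm.min measurable_const) hMm ?_ ?_
    · have hle : ∫⁻ x, min ‖opFn T f x‖ₑ N ^ q ∂μ ≤
          ∫⁻ x, ((bl B 0 k).indicator (fun _ => (N : ℝ≥0∞) ^ q) x +
            ((C * b ^ (σ + 1) : ℝ≥0) : ℝ≥0∞) ^ q * M x ^ q) ∂μ := by
        refine lintegral_mono_ae ?_
        filter_upwards [hμ.ac.ae_le hk] with x hx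
        by_cases hxk : x ∈ bl B 0 k
        · rw [indicator_of_mem hxk]
          exact (ENNReal.rpow_le_rpow (min_le_right _ _) hq.le).trans le_self_add
        · rw [← ENNReal.mul_rpow_of_nonneg _ _ hq.le]
          exact (ENNReal.rpow_le_rpow ((min_le_left _ _).trans (hx hxk)) hq.le).trans le_add_self
      refine (hle.trans_lt ?_).ne
      rw [lintegral_add_right _ ((hMm.pow_const q).const_mul _),
        lintegral_indicator_const (h.measurableSet_bl 0 k),
        lintegral_const_mul _ (hMm.pow_const q)]
      refine ENNReal.add_lt_top.2 ⟨ENNReal.mul_lt_top ?_ (hμ.ne_top 0 k).lt_top,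
        ENNReal.mul_lt_top ?_ (lt_top_iff_ne_top.2 hMt)⟩
      · exact ENNReal.rpow_lt_top_of_nonneg hq.le (by simp)
      · exact ENNReal.rpow_lt_top_of_nonneg hq.le ENNReal.coe_ne_top
    · intro t ht
      by_cases hNt : (N : ℝ≥0∞) ≤ (4 * t : ℝ≥0)
      · have : {x | ((4 * t : ℝ≥0) : ℝ≥0∞) < min ‖opFn T f x‖ₑ N} = ∅ := by
          ext x
          simp only [mem_ofPred_eq, lt_min_iff, mem_empty_iff_false, iff_false, not_and]
          exact fun _ => not_lt.2 hNt
        rw [this]; simp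
      · have hNt' : (t : ℝ≥0∞) < N := by
          refine lt_of_le_of_lt ?_ (not_le.1 hNt)
          rw [ENNReal.coe_le_coe]
          exact le_mul_of_one_le_left' (by norm_num)
        calc μ {x | ((4 * t : ℝ≥0) : ℝ≥0∞) < min ‖opFn T f x‖ₑ N}
            ≤ μ ({x | ((4 * t : ℝ≥0) : ℝ≥0∞) < ‖opFn T f x‖ₑ ∧ M x ≤ (γ * t : ℝ≥0)} ∪
                {x | ((γ * t : ℝ≥0) : ℝ≥0∞) < M x}) := by
              refine measure_mono fun x hx => ?_
              have hx' := (lt_min_iff.1 (show _ < min ‖opFn T f x‖ₑ N from hx)).1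
              by_cases hxM : M x ≤ (γ * t : ℝ≥0)
              · exact Or.inl ⟨hx', hxM⟩
              · exact Or.inr (not_le.1 hxM)
          _ ≤ _ := (measure_union_le _ _).trans (add_le_add ((hgl f hf t ht).trans
              (mul_le_mul' le_rfl (measure_mono fun x hx => lt_min hx hNt'))) le_rfl)
  have hlim : Filter.Tendsto (fun N : ℕ => ∫⁻ x, min ‖opFn T f x‖ₑ N ^ q ∂μ) Filter.atTop
      (nhds (∫⁻ x, ‖opFn T f x‖ₑ ^ q ∂μ)) := by
    refine lintegral_tendsto_of_tendsto_of_monotone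
      (fun N => ((hTm.min measurable_const).pow_const q).aemeasurable)
      (Filter.Eventually.of_forall fun x => ?_) (Filter.Eventually.of_forall fun x => ?_)
    · intro N N' hNN'
      simp only
      gcongr
    · refine tendsto_const_nhds.congr' ?_
      obtain ⟨N₀, hN₀⟩ := ENNReal.exists_nat_gt (show ‖opFn T f x‖ₑ ≠ ∞ by simp)
      filter_upwards [Filter.eventually_ge_atTop N₀] with N hN
      rw [min_eq_left (hN₀.le.trans (by exact_mod_cast hN))]
  refine (le_of_tendsto' hlim hN).trans (mul_le_mul' (ENNReal.coe_le_coe.2 ?_) le_rfl)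
  exact le_self_add

/-- The good-λ argument with a supremum in place of an integral. Restricting to levels `t ≤ t₀`
makes the supremum finite beforehand. With `η = 1/8`, the identity `t · 1/8 = (1/2)(t/4)` allows
half of it to be absorbed. -/
theorem exists_weak_bound {μ : Measure E} {p : ℝ} {Cμ : ℝ≥0} (hμ : IsComparable B μ p Cμ)
    (hr : 1 < r) (hr' : r < ∞) (hK : IsKernel B b σ K C θ) (hT : IsRepresentedBy T K) :
    ∃ C' : ℝ≥0, ∀ f : E → B₁, IsTest f → ∀ w : ℝ≥0∞, w ≠ ∞ →
      (∀ s : ℝ≥0, s * μ {x | (s : ℝ≥0∞) < maxFn B volume (fun x => ‖f x‖ₑ) x} ≤ w) →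
      ∀ t : ℝ≥0, t * μ {x | (t : ℝ≥0∞) < ‖opFn T f x‖ₑ} ≤ C' * w := by
  obtain ⟨γ, hγ, hgl⟩ := h.exists_good_lambda hμ hr hr' hK hT (η := 1 / 8) (by positivity)
  refine ⟨8 * γ⁻¹, fun f hf w hw hM t₀ => ?_⟩
  set M := maxFn B volume (fun x => ‖f x‖ₑ) with hMdef
  obtain ⟨k, hk⟩ := h.exists_enorm_opFn_le_maxFn hK hT hf
  set a : ℝ≥0∞ := ⨆ (t : ℝ≥0) (_ : t ≤ t₀), t * μ {x | (t : ℝ≥0∞) < ‖opFn T f x‖ₑ} with ha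
  have hle_a : ∀ t ≤ t₀, t * μ {x | (t : ℝ≥0∞) < ‖opFn T f x‖ₑ} ≤ a := fun t ht =>
    le_iSup₂_of_le t ht le_rfl
  have hat : a ≠ ∞ := by
    set c : ℝ≥0 := C * b ^ (σ + 1) + 1 with hc
    have hc0 : (c : ℝ≥0∞) ≠ 0 := by simp [hc]
    have hle : a ≤ t₀ * μ (bl B 0 k) + c * w := by
      refine iSup₂_le fun t ht => ?_
      have h1 : μ {x | (t : ℝ≥0∞) < ‖opFn T f x‖ₑ} ≤
          μ (bl B 0 k ∪ {x | ((t / c : ℝ≥0) : ℝ≥0∞) < M x}) := by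
        refine measure_mono_ae ?_
        filter_upwards [hμ.ac.ae_le hk] with x hx hxt
        by_cases hxk : x ∈ bl B 0 k
        · exact Or.inl hxk
        · refine Or.inr ?_
          show ((t / c : ℝ≥0) : ℝ≥0∞) < M x
          rw [ENNReal.coe_div (by positivity)]
          refine ENNReal.div_lt_of_lt_mul ?_
          rw [mul_comm]
          refine (lt_of_lt_of_le (show (t : ℝ≥0∞) < _ from hxt) (hx hxk)).trans_le ?_
          exact mul_le_mul' (ENNReal.coe_le_coe.2 le_self_add) le_rfl
      calc t * μ {x | (t : ℝ≥0∞) < ‖opFn T f x‖ₑ}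
          ≤ t * (μ (bl B 0 k) + μ {x | ((t / c : ℝ≥0) : ℝ≥0∞) < M x}) :=
            mul_le_mul' le_rfl (h1.trans (measure_union_le _ _))
        _ = t * μ (bl B 0 k) + c * ((t / c : ℝ≥0) * μ {x | ((t / c : ℝ≥0) : ℝ≥0∞) < M x}) := by
            rw [mul_add, ← mul_assoc (c : ℝ≥0∞), ← ENNReal.coe_mul,
              mul_div_cancel₀ _ (by positivity)]
        _ ≤ _ := add_le_add (mul_le_mul' (ENNReal.coe_le_coe.2 ht) le_rfl)
            (mul_le_mul' le_rfl (hM _))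
    refine (hle.trans_lt (ENNReal.add_lt_top.2 ⟨?_, ?_⟩)).ne
    · exact ENNReal.mul_lt_top ENNReal.coe_lt_top (hμ.ne_top 0 k).lt_top
    · exact ENNReal.mul_lt_top ENNReal.coe_lt_top (lt_top_iff_ne_top.2 hw)
  have hstep : a ≤ 2⁻¹ * a + (4 * γ⁻¹ : ℝ≥0) * w := by
    refine iSup₂_le fun t ht => ?_
    rcases eq_or_lt_of_le (zero_le : 0 ≤ t) with rfl | ht0
    · simp
    have h4 : 4 * (t / 4) = t := mul_div_cancel₀ _ (by norm_num)
    have h1 : μ {x | (t : ℝ≥0∞) < ‖opFn T f x‖ₑ} ≤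
        (1 / 8 : ℝ≥0) * μ {x | ((t / 4 : ℝ≥0) : ℝ≥0∞) < ‖opFn T f x‖ₑ} +
          μ {x | ((γ * (t / 4) : ℝ≥0) : ℝ≥0∞) < M x} := by
      have h2 := hgl f hf (t / 4) (by positivity)
      rw [h4] at h2
      refine le_trans (measure_mono fun x hx => ?_)
        ((measure_union_le _ _).trans (add_le_add h2 le_rfl))
      by_cases hxM : M x ≤ (γ * (t / 4) : ℝ≥0)
      · exact Or.inl ⟨hx, hxM⟩
      · exact Or.inr (not_le.1 hxM)
    have h5 : (t : ℝ≥0∞) * ((1 / 8 : ℝ≥0) : ℝ≥0∞) = 2⁻¹ * ((t / 4 : ℝ≥0) : ℝ≥0∞) := by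
      rw [show (2⁻¹ : ℝ≥0∞) = ((2⁻¹ : ℝ≥0) : ℝ≥0∞) by
        rw [ENNReal.coe_inv (by norm_num)]; rfl, ← ENNReal.coe_mul, ← ENNReal.coe_mul]
      congr 1
      ring
    have h6 : (t : ℝ≥0∞) = (4 * γ⁻¹ : ℝ≥0) * ((γ * (t / 4) : ℝ≥0) : ℝ≥0∞) := by
      rw [← ENNReal.coe_mul]
      congr 1
      field_simp
    calc t * μ {x | (t : ℝ≥0∞) < ‖opFn T f x‖ₑ}
        ≤ t * ((1 / 8 : ℝ≥0) * μ {x | ((t / 4 : ℝ≥0) : ℝ≥0∞) < ‖opFn T f x‖ₑ}) +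
          t * μ {x | ((γ * (t / 4) : ℝ≥0) : ℝ≥0∞) < M x} := by
          rw [← mul_add]; exact mul_le_mul' le_rfl h1
      _ = 2⁻¹ * (((t / 4 : ℝ≥0) : ℝ≥0∞) * μ {x | ((t / 4 : ℝ≥0) : ℝ≥0∞) < ‖opFn T f x‖ₑ}) +
          (4 * γ⁻¹ : ℝ≥0) * (((γ * (t / 4) : ℝ≥0) : ℝ≥0∞) *
            μ {x | ((γ * (t / 4) : ℝ≥0) : ℝ≥0∞) < M x}) := by
          rw [← mul_assoc, h5, mul_assoc]
          congr 1
          rw [← mul_assoc, ← h6]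
      _ ≤ _ := by
          refine add_le_add (mul_le_mul' le_rfl (hle_a _ (le_trans ?_ ht)))
            (mul_le_mul' le_rfl (hM _))
          exact div_le_self zero_le (by norm_num)
  have h7 : 2⁻¹ * a ≤ (4 * γ⁻¹ : ℝ≥0) * w := by
    have h8 : 2⁻¹ * a + 2⁻¹ * a ≤ 2⁻¹ * a + (4 * γ⁻¹ : ℝ≥0) * w := by
      rw [← add_mul, ENNReal.inv_two_add_inv_two, one_mul]; exact hstep
    exact (ENNReal.add_le_add_iff_left (ENNReal.mul_ne_top (by simp) hat)).1 h8
  calc t₀ * μ {x | (t₀ : ℝ≥0∞) < ‖opFn T f x‖ₑ} ≤ a := hle_a t₀ le_rfl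
    _ = 2 * (2⁻¹ * a) := by
        rw [← mul_assoc, ENNReal.mul_inv_cancel (by norm_num) (by norm_num), one_mul]
    _ ≤ 2 * ((4 * γ⁻¹ : ℝ≥0) * w) := mul_le_mul' le_rfl h7
    _ = _ := by
        rw [← mul_assoc]
        congr 1
        push_cast
        rw [← mul_assoc]
        norm_num

end IsBallFamily

end GoodLambda

/-! ### The weak `L¹` quasi-norm -/

section WeakL1

variable {α : Type*} [MeasurableSpace α] {μ : Measure α}
variable {F : Type*} [NormedAddCommGroup F]

theorem weakL1Norm_eq (g : α → F) :
    weakL1Norm g μ = ⨆ t : ℝ≥0, (t : ℝ≥0∞) * μ {x | (t : ℝ≥0∞) < ‖g x‖ₑ} := by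
  simp only [weakL1Norm, enorm_eq_nnnorm, ENNReal.coe_lt_coe]
  rfl

theorem weakL1Norm_le_iff {g : α → F} {W : ℝ≥0∞} :
    weakL1Norm g μ ≤ W ↔ ∀ t : ℝ≥0, (t : ℝ≥0∞) * μ {x | (t : ℝ≥0∞) < ‖g x‖ₑ} ≤ W := by
  rw [weakL1Norm_eq, iSup_le_iff]

theorem mul_measure_le_weakL1Norm (g : α → F) (t : ℝ≥0) :
    (t : ℝ≥0∞) * μ {x | (t : ℝ≥0∞) < ‖g x‖ₑ} ≤ weakL1Norm g μ :=
  weakL1Norm_le_iff.1 le_rfl t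

theorem weakL1Norm_congr {g g' : α → F} (hg : g =ᵐ[μ] g') :
    weakL1Norm g μ = weakL1Norm g' μ := by
  rw [weakL1Norm_eq, weakL1Norm_eq]
  refine iSup_congr fun t => ?_
  congr 1
  refine measure_congr ?_
  filter_upwards [hg] with x hx
  exact congrArg (fun y : F => (t : ℝ≥0∞) < ‖y‖ₑ) hx

theorem weakL1Norm_neg (g : α → F) : weakL1Norm (-g) μ = weakL1Norm g μ := by
  simp [weakL1Norm]

theorem weakL1Norm_add_le (f g : α → F) :
    weakL1Norm (f + g) μ ≤ 2 * (weakL1Norm f μ + weakL1Norm g μ) := by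
  refine weakL1Norm_le_iff.2 fun t => ?_
  have hsub : {x | (t : ℝ≥0∞) < ‖(f + g) x‖ₑ} ⊆
      {x | ((t / 2 : ℝ≥0) : ℝ≥0∞) < ‖f x‖ₑ} ∪ {x | ((t / 2 : ℝ≥0) : ℝ≥0∞) < ‖g x‖ₑ} := by
    intro x hx
    by_contra hcon
    rw [mem_union, not_or] at hcon
    have h1 : ‖f x‖ₑ ≤ ((t / 2 : ℝ≥0) : ℝ≥0∞) := not_lt.1 hcon.1
    have h2 : ‖g x‖ₑ ≤ ((t / 2 : ℝ≥0) : ℝ≥0∞) := not_lt.1 hcon.2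
    refine absurd (show (t : ℝ≥0∞) < _ from hx) (not_lt.2 ?_)
    refine (enorm_add_le _ _).trans ((add_le_add h1 h2).trans_eq ?_)
    rw [← ENNReal.coe_add, add_halves]
  calc (t : ℝ≥0∞) * μ {x | (t : ℝ≥0∞) < ‖(f + g) x‖ₑ}
      ≤ t * (μ {x | ((t / 2 : ℝ≥0) : ℝ≥0∞) < ‖f x‖ₑ} +
          μ {x | ((t / 2 : ℝ≥0) : ℝ≥0∞) < ‖g x‖ₑ}) :=
        mul_le_mul' le_rfl ((measure_mono hsub).trans (measure_union_le _ _))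
    _ = 2 * (((t / 2 : ℝ≥0) : ℝ≥0∞) * μ {x | ((t / 2 : ℝ≥0) : ℝ≥0∞) < ‖f x‖ₑ} +
          ((t / 2 : ℝ≥0) : ℝ≥0∞) * μ {x | ((t / 2 : ℝ≥0) : ℝ≥0∞) < ‖g x‖ₑ}) := by
        rw [← mul_add, ← mul_assoc]
        congr 1
        rw [← ENNReal.coe_ofNat, ← ENNReal.coe_mul, mul_div_cancel₀ _ two_ne_zero]
    _ ≤ _ := mul_le_mul' le_rfl
        (add_le_add (mul_measure_le_weakL1Norm f _) (mul_measure_le_weakL1Norm g _))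

theorem weakL1Norm_sub_le (f g u : α → F) :
    weakL1Norm (f - g) μ ≤ 2 * (weakL1Norm (f - u) μ + weakL1Norm (g - u) μ) := by
  have h : f - g = (f - u) + -(g - u) := by abel
  rw [h, ← weakL1Norm_neg (g - u)]
  exact weakL1Norm_add_le _ _

theorem weakL1Norm_const_smul_le [NormedSpace ℂ F] (c : ℂ) (g : α → F) :
    weakL1Norm (c • g) μ ≤ ‖c‖ₑ * weakL1Norm g μ := by
  refine weakL1Norm_le_iff.2 fun t => ?_
  rcases eq_or_ne c 0 with rfl | hc
  · simp
  have hc0 : ‖c‖₊ ≠ 0 := by simpa using hc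
  have hset : {x | (t : ℝ≥0∞) < ‖(c • g) x‖ₑ} ⊆ {x | ((‖c‖₊⁻¹ * t : ℝ≥0) : ℝ≥0∞) < ‖g x‖ₑ} := by
    intro x hx
    have hx' : (t : ℝ≥0∞) < ‖c • g x‖ₑ := hx
    rw [enorm_smul, enorm_eq_nnnorm, enorm_eq_nnnorm, ← ENNReal.coe_mul, ENNReal.coe_lt_coe] at hx'
    show ((‖c‖₊⁻¹ * t : ℝ≥0) : ℝ≥0∞) < ‖g x‖ₑ
    rw [enorm_eq_nnnorm, ENNReal.coe_lt_coe]
    exact (inv_mul_lt_iff₀ (pos_iff_ne_zero.2 hc0)).2 hx'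
  calc (t : ℝ≥0∞) * μ {x | (t : ℝ≥0∞) < ‖(c • g) x‖ₑ}
      ≤ t * μ {x | ((‖c‖₊⁻¹ * t : ℝ≥0) : ℝ≥0∞) < ‖g x‖ₑ} :=
        mul_le_mul' le_rfl (measure_mono hset)
    _ = ‖c‖ₑ * (((‖c‖₊⁻¹ * t : ℝ≥0) : ℝ≥0∞) *
          μ {x | ((‖c‖₊⁻¹ * t : ℝ≥0) : ℝ≥0∞) < ‖g x‖ₑ}) := by
        rw [← mul_assoc]
        congr 1
        rw [enorm_eq_nnnorm, ← ENNReal.coe_mul, mul_inv_cancel_left₀ hc0]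
    _ ≤ _ := mul_le_mul' le_rfl (mul_measure_le_weakL1Norm g _)

theorem ae_eq_zero_of_weakL1Norm_eq_zero {g : α → F} (hg : weakL1Norm g μ = 0) :
    g =ᵐ[μ] 0 := by
  have h1 : ∀ n : ℕ, ∀ᵐ x ∂μ, ‖g x‖ ≤ (1 / ((n : ℝ) + 1)) := by
    intro n
    have h0 : (0 : ℝ) < 1 / ((n : ℝ) + 1) := by positivity
    have h2 := weakL1Norm_le_iff.1 hg.le (1 / ((n : ℝ≥0) + 1))
    rw [nonpos_iff_eq_zero, mul_eq_zero] at h2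
    have h3 := h2.resolve_left (by rw [ENNReal.coe_eq_zero]; positivity)
    rw [ae_iff]
    refine measure_mono_null (fun x hx => ?_) h3
    have hx' : ¬ ‖g x‖ ≤ 1 / ((n : ℝ) + 1) := hx
    show ((1 / ((n : ℝ≥0) + 1) : ℝ≥0) : ℝ≥0∞) < ‖g x‖ₑ
    rw [enorm_eq_nnnorm, ENNReal.coe_lt_coe, ← NNReal.coe_lt_coe]
    push_cast
    exact not_le.1 hx'
  filter_upwards [ae_all_iff.2 h1] with x hx
  have : ‖g x‖ ≤ 0 := ge_of_tendsto' tendsto_one_div_add_atTop_nhds_zero_nat hx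
  simpa using this

/-- Two functions with common weak-type approximants are equal almost everywhere. -/
theorem ae_eq_of_forall_exists_weakL1Norm_le {g g' : α → F}
    (H : ∀ ε : ℝ≥0, 0 < ε → ∃ u : α → F,
      weakL1Norm (g - u) μ ≤ ε ∧ weakL1Norm (g' - u) μ ≤ ε) : g =ᵐ[μ] g' := by
  have h0 : weakL1Norm (g - g') μ = 0 := by
    rw [← nonpos_iff_eq_zero]
    refine ENNReal.le_of_forall_pos_le_add fun ε hε _ => ?_
    obtain ⟨u, hu, hu'⟩ := H (ε / 4) (by positivity)
    refine (weakL1Norm_sub_le g g' u).trans ?_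
    rw [zero_add]
    calc 2 * (weakL1Norm (g - u) μ + weakL1Norm (g' - u) μ)
        ≤ 2 * (((ε / 4 : ℝ≥0) : ℝ≥0∞) + ((ε / 4 : ℝ≥0) : ℝ≥0∞)) :=
          mul_le_mul' le_rfl (add_le_add hu hu')
      _ = ε := by
          rw [← ENNReal.coe_add, ← ENNReal.coe_ofNat, ← ENNReal.coe_mul]
          congr 1
          ring
  filter_upwards [ae_eq_zero_of_weakL1Norm_eq_zero h0] with x hx
  exact sub_eq_zero.1 hx

/-- Fatou's lemma for the weak `L¹` quasi-norm. -/
theorem weakL1Norm_le_of_tendsto_ae {G : ℕ → α → F} {g : α → F} {W : ℝ≥0∞}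
    (hG : ∀ᵐ x ∂μ, Filter.Tendsto (fun i => G i x) Filter.atTop (nhds (g x)))
    (hW : ∀ᶠ i in Filter.atTop, weakL1Norm (G i) μ ≤ W) : weakL1Norm g μ ≤ W := by
  obtain ⟨N, hN⟩ := Filter.eventually_atTop.1 hW
  refine weakL1Norm_le_iff.2 fun t => ?_
  -- Up to a null set, the superlevel set of the limit lies in the increasing union of these sets,
  -- and each is contained in the superlevel set of every later `G i`.
  set s : ℕ → Set α := fun n => {x | ∀ i, n ≤ i → (t : ℝ≥0∞) < ‖G i x‖ₑ} with hs
  have hmono : Monotone s := fun n m hnm x hx i hi => hx i (hnm.trans hi)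
  have hle : μ {x | (t : ℝ≥0∞) < ‖g x‖ₑ} ≤ μ (⋃ n, s n) := by
    refine measure_mono_ae ?_
    filter_upwards [hG] with x hx hxt
    have h1 : Filter.Tendsto (fun i => ‖G i x‖ₑ) Filter.atTop (nhds ‖g x‖ₑ) :=
      (continuous_enorm.tendsto _).comp hx
    obtain ⟨n, hn⟩ := Filter.eventually_atTop.1
      (h1.eventually (lt_mem_nhds (show (t : ℝ≥0∞) < ‖g x‖ₑ from hxt)))
    exact mem_iUnion.2 ⟨n, fun i hi => hn i hi⟩
  refine (mul_le_mul' le_rfl hle).trans ?_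
  rw [hmono.measure_iUnion, ENNReal.mul_iSup]
  refine iSup_le fun n => ?_
  refine le_trans (mul_le_mul' le_rfl (measure_mono fun x hx => ?_))
    ((mul_measure_le_weakL1Norm (G (max n N)) t).trans (hN _ (le_max_right _ _)))
  exact (show ∀ i, n ≤ i → (t : ℝ≥0∞) < ‖G i x‖ₑ from hx) _ (le_max_left _ _)

end WeakL1

/-! ### Approximation by test functions -/

section Approximation

theorem tendsto_eLpNorm_sub_of_dominated {α F : Type*} [MeasurableSpace α] {μ : Measure α}
    [NormedAddCommGroup F] {p : ℝ≥0∞} (hp : p ≠ 0) (hp' : p ≠ ∞) {f : α → F} (hf : MemLp f p μ)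
    {G : ℕ → α → F} (hG : ∀ j, AEStronglyMeasurable (G j) μ)
    (hle : ∀ j, ∀ᵐ x ∂μ, ‖G j x‖ₑ ≤ ‖f x‖ₑ)
    (hlim : ∀ᵐ x ∂μ, Filter.Tendsto (fun j => G j x) Filter.atTop (nhds (f x))) :
    Filter.Tendsto (fun j => eLpNorm (G j - f) p μ) Filter.atTop (nhds 0) := by
  have hpp : 0 < p.toReal := ENNReal.toReal_pos hp hp'
  have key : Filter.Tendsto (fun j => ∫⁻ x, ‖(G j - f) x‖ₑ ^ p.toReal ∂μ) Filter.atTop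
      (nhds (∫⁻ _, 0 ∂μ)) := by
    refine tendsto_lintegral_of_dominated_convergence'
      (fun x => (2 * ‖f x‖ₑ) ^ p.toReal) (fun j => ?_) (fun j => ?_) ?_ ?_
    · exact ((hG j).sub hf.1).enorm.pow_const _
    · filter_upwards [hle j] with x hx
      refine ENNReal.rpow_le_rpow ?_ hpp.le
      refine (enorm_sub_le (a := G j x) (b := f x)).trans ?_
      rw [two_mul]
      exact add_le_add hx le_rfl
    · have h2 := lintegral_rpow_enorm_lt_top_of_eLpNorm_lt_top hp hp' hf.2
      simp only [ENNReal.mul_rpow_of_nonneg _ _ hpp.le]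
      rw [lintegral_const_mul'' _ (hf.1.enorm.pow_const _)]
      exact ENNReal.mul_ne_top (ENNReal.rpow_ne_top_of_nonneg hpp.le (by simp)) h2.ne
    · filter_upwards [hlim] with x hx
      have h1 : Filter.Tendsto (fun j => G j x - f x) Filter.atTop (nhds 0) := by
        simpa using hx.sub_const (f x)
      have h2 := ((continuous_enorm.tendsto _).comp h1)
      have h3 := (ENNReal.continuous_rpow_const (y := p.toReal)).tendsto ‖(0 : F)‖ₑ |>.comp h2
      simpa [Function.comp_def, ENNReal.zero_rpow_of_pos hpp] using h3
  rw [lintegral_zero] at key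
  simp only [eLpNorm_eq_lintegral_rpow_enorm_toReal hp hp']
  have h4 := (ENNReal.continuous_rpow_const (y := 1 / p.toReal)).tendsto 0 |>.comp key
  simpa [Function.comp_def, hpp] using h4

variable {E : Type*} [NormedAddCommGroup E] [MeasureSpace E] [BorelSpace E]
variable {B₁ B₂ : Type*} [NormedAddCommGroup B₁] [NormedSpace ℂ B₁]
  [NormedAddCommGroup B₂] [NormedSpace ℂ B₂]
variable {B : ℤ → Set E} {b : ℝ≥0} {σ : ℤ}

namespace IsBallFamily

variable (h : IsBallFamily b σ B)
include h

-- Truncation in height and in space refers to no exponent, and the same construction serves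
-- `L^r(dx)` and `L^p(μ)`.
omit [NormedSpace ℂ B₁] in
theorem exists_isTest_seq {f : E → B₁} (hf : AEStronglyMeasurable f volume) :
    ∃ G : ℕ → E → B₁, (∀ j, IsTest (G j)) ∧ (∀ j, ∀ᵐ x, ‖G j x‖ₑ ≤ ‖f x‖ₑ) ∧
      ∀ᵐ x, Filter.Tendsto (fun j => G j x) Filter.atTop (nhds (f x)) := by
  set f' := hf.mk f with hf'
  have hsm : StronglyMeasurable f' := hf.stronglyMeasurable_mk
  set s : ℕ → Set E := fun j => bl B 0 j ∩ {x | ‖f' x‖ ≤ j} with hs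
  have hms : ∀ j, MeasurableSet (s j) := fun j =>
    (h.measurableSet_bl 0 j).inter (measurableSet_le hsm.norm.measurable measurable_const)
  refine ⟨fun j => (s j).indicator f', fun j => ⟨?_, ?_⟩, fun j => ?_, ?_⟩
  · refine memLp_top_of_bound (hsm.indicator (hms j)).aestronglyMeasurable j
      (Filter.Eventually.of_forall fun x => ?_)
    show ‖(s j).indicator f' x‖ ≤ j
    by_cases hx : x ∈ s j
    · rw [indicator_of_mem hx]; exact hx.2
    · rw [indicator_of_notMem hx]; simp
  · exact (h.isBounded_bl 0 j).subset
      (Set.support_indicator_subset.trans inter_subset_left)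
  · filter_upwards [hf.ae_eq_mk] with x hx
    rw [hx]
    by_cases hxs : x ∈ s j
    · rw [indicator_of_mem hxs]
    · rw [indicator_of_notMem hxs]; simp
  · filter_upwards [hf.ae_eq_mk] with x hx
    rw [hx]
    refine tendsto_const_nhds.congr' ?_
    have hxu : x ∈ ⋃ k : ℕ, bl B 0 k := by rw [h.iUnion_bl]; trivial
    obtain ⟨k, hk⟩ := mem_iUnion.1 hxu
    obtain ⟨m, hm⟩ := exists_nat_ge ‖f' x‖
    filter_upwards [Filter.eventually_ge_atTop (max k m)] with j hj
    have hxs : x ∈ s j := by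
      refine ⟨h.bl_mono 0 (by exact_mod_cast (le_max_left k m).trans hj) hk, ?_⟩
      exact hm.trans (by exact_mod_cast (le_max_right k m).trans hj)
    rw [indicator_of_mem hxs]

variable {r : ℝ≥0∞} [Fact (1 ≤ r)]
variable (T : Lp B₁ r (volume : Measure E) →L[ℂ] Lp B₂ r (volume : Measure E))

/-- Approximation of a function and of its image under `T`, along test functions. -/
theorem exists_isTest_seq_opFn [ProperSpace E] (hr' : r < ∞) {f : E → B₁}
    (hf : MemLp f r volume) :
    ∃ G : ℕ → E → B₁, (∀ j, IsTest (G j)) ∧ (∀ j, ∀ᵐ x, ‖G j x‖ₑ ≤ ‖f x‖ₑ) ∧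
      ∀ᵐ x, Filter.Tendsto (fun j => opFn T (G j) x) Filter.atTop (nhds (opFn T f x)) := by
  have hr0 : r ≠ 0 := (zero_lt_one.trans_le (Fact.out (p := 1 ≤ r))).ne'
  obtain ⟨G, hG, hle, hlim⟩ := h.exists_isTest_seq hf.1
  have hGm : ∀ j, MemLp (G j) r volume := fun j => (hG j).memLp_volume h r
  have h1 := tendsto_eLpNorm_sub_of_dominated hr0 hr'.ne hf
    (fun j => (hG j).aestronglyMeasurable) hle hlim
  have h2 : Filter.Tendsto (fun j => eLpNorm (opFn T (G j) - opFn T f) r volume) Filter.atTop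
      (nhds 0) := by
    refine tendsto_of_tendsto_of_tendsto_of_le_of_le tendsto_const_nhds
      (by simpa using ENNReal.Tendsto.const_mul (a := ‖T‖ₑ) h1 (Or.inr (by simp)))
      (fun _ => zero_le) fun j => ?_
    rw [← eLpNorm_congr_ae (opFn_sub T (hGm j) hf)]
    exact eLpNorm_opFn_le T ((hGm j).sub hf)
  obtain ⟨ns, -, hns⟩ := (tendstoInMeasure_of_tendsto_eLpNorm hr0
    (fun j => (opFn_stronglyMeasurable T (G j)).aestronglyMeasurable)
    (opFn_stronglyMeasurable T f).aestronglyMeasurable h2).exists_seq_tendsto_ae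
  exact ⟨fun i => G (ns i), fun i => hG _, fun i => hle _, hns⟩

/-- Fatou's lemma on the left and the domination of the approximants by `f` on the right; `f` is not
required to lie in `L^p(μ)`. -/
theorem eLpNorm_opFn_le_of_isTest [ProperSpace E] (hr' : r < ∞) {μ : Measure E}
    (hμ : μ ≪ volume) {p : ℝ≥0∞} {C : ℝ≥0}
    (H : ∀ f : E → B₁, IsTest f → eLpNorm (opFn T f) p μ ≤ C * eLpNorm f p μ)
    {f : E → B₁} (hf : MemLp f r volume) :
    eLpNorm (opFn T f) p μ ≤ C * eLpNorm f p μ := by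
  obtain ⟨G, hG, hle, hlim⟩ := h.exists_isTest_seq_opFn T hr' hf
  refine (Lp.eLpNorm_lim_le_liminf_eLpNorm
    (fun j => (opFn_stronglyMeasurable T (G j)).aestronglyMeasurable) _ (hμ hlim)).trans ?_
  refine Filter.liminf_le_of_frequently_le' (Filter.Frequently.of_forall fun j => ?_)
  refine (H _ (hG j)).trans (mul_le_mul' le_rfl (eLpNorm_mono_enorm_ae ?_))
  exact hμ (hle j)

theorem weakL1Norm_opFn_le_of_isTest [ProperSpace E] (hr' : r < ∞) {μ : Measure E}
    (hμ : μ ≪ volume) {C : ℝ≥0}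
    (H : ∀ f : E → B₁, IsTest f → weakL1Norm (opFn T f) μ ≤ C * eLpNorm f 1 μ)
    {f : E → B₁} (hf : MemLp f r volume) :
    weakL1Norm (opFn T f) μ ≤ C * eLpNorm f 1 μ := by
  obtain ⟨G, hG, hle, hlim⟩ := h.exists_isTest_seq_opFn T hr' hf
  refine weakL1Norm_le_of_tendsto_ae (hμ hlim) (Filter.Eventually.of_forall fun j => ?_)
  exact (H _ (hG j)).trans (mul_le_mul' le_rfl (eLpNorm_mono_enorm_ae (hμ (hle j))))

omit [NormedSpace ℂ B₁] in
theorem exists_isTest_tendsto_eLpNorm {μ : Measure E} (hμ : μ ≪ volume) (hμ' : volume ≪ μ)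
    {p : ℝ≥0∞} (hp : p ≠ 0) (hp' : p ≠ ∞) {f : E → B₁} (hf : MemLp f p μ) :
    ∃ G : ℕ → E → B₁, (∀ j, IsTest (G j)) ∧
      Filter.Tendsto (fun j => eLpNorm (G j - f) p μ) Filter.atTop (nhds 0) := by
  obtain ⟨G, hG, hle, hlim⟩ := h.exists_isTest_seq (hf.1.mono_ac hμ')
  exact ⟨G, hG, tendsto_eLpNorm_sub_of_dominated hp hp' hf
    (fun j => (hG j).aestronglyMeasurable.mono_ac hμ) (fun j => hμ (hle j)) (hμ hlim)⟩

end IsBallFamily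

end Approximation

/-! ### Extension of `T` to the weighted spaces -/

section Extension

set_option linter.unusedSectionVars false

variable {E : Type*} [NormedAddCommGroup E] [MeasureSpace E]
variable {B₁ B₂ : Type*} [NormedAddCommGroup B₁] [NormedSpace ℂ B₁]
  [NormedAddCommGroup B₂] [NormedSpace ℂ B₂]
variable {r : ℝ≥0∞} [Fact (1 ≤ r)]
variable (T : Lp B₁ r (volume : Measure E) →L[ℂ] Lp B₂ r (volume : Measure E))

theorem opFn_const_smul (c : ℂ) {f : E → B₁} (hf : MemLp f r volume) :
    opFn T (c • f) =ᵐ[volume] c • opFn T f := by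
  rw [opFn_of_memLp T hf, opFn_of_memLp T (hf.const_smul c), MemLp.toLp_const_smul, map_smul]
  exact Lp.coeFn_smul _ _

variable {μ : Measure E} {p : ℝ≥0∞}

/-- The elements of `L^p(μ)` that also belong to `L^r(volume)`. -/
def lpInter (B₁ : Type*) [NormedAddCommGroup B₁] [NormedSpace ℂ B₁] (r p : ℝ≥0∞)
    (hμ : volume ≪ μ) : Submodule ℂ (Lp B₁ p μ) where
  carrier := {F | MemLp F r volume}
  add_mem' {F G} hF hG := by
    have hF' : MemLp F r volume := hF
    have hG' : MemLp G r volume := hG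
    exact (hF'.add hG').ae_eq (hμ.ae_eq (Lp.coeFn_add F G)).symm
  zero_mem' := (MemLp.zero (ε := B₁)).ae_eq (hμ.ae_eq (Lp.coeFn_zero B₁ p μ)).symm
  smul_mem' c F hF := by
    have hF' : MemLp F r volume := hF
    exact (hF'.const_smul c).ae_eq (hμ.ae_eq (Lp.coeFn_smul c F)).symm

/-- The operator `T` as a map on `L^r(volume) ∩ L^p(μ)`. -/
noncomputable def opLp (hμ : μ ≪ volume) (hμ' : volume ≪ μ)
    (H : ∀ f : E → B₁, MemLp f r volume → MemLp f p μ → MemLp (opFn T f) p μ) :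
    lpInter B₁ r p hμ' →ₗ[ℂ] Lp B₂ p μ where
  toFun F := (H F F.2 (Lp.memLp F.1)).toLp (opFn T F)
  map_add' F G := by
    rw [← MemLp.toLp_add]
    refine MemLp.toLp_congr _ _ (hμ ?_)
    have h1 : ((F + G : lpInter B₁ r p hμ') : E → B₁) =ᵐ[volume] (F : E → B₁) + (G : E → B₁) :=
      hμ' (Lp.coeFn_add F.1 G.1)
    rw [opFn_congr T h1]
    exact opFn_add T F.2 G.2
  map_smul' c F := by
    rw [RingHom.id_apply, ← MemLp.toLp_const_smul]
    refine MemLp.toLp_congr _ _ (hμ ?_)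
    have h1 : ((c • F : lpInter B₁ r p hμ') : E → B₁) =ᵐ[volume] c • (F : E → B₁) :=
      hμ' (Lp.coeFn_smul c F.1)
    rw [opFn_congr T h1]
    exact opFn_const_smul T c F.2

variable {B : ℤ → Set E} {b : ℝ≥0} {σ : ℤ}

namespace IsBallFamily

variable [BorelSpace E] [ProperSpace E]
variable (h : IsBallFamily b σ B)
include h

theorem dense_lpInter [Fact (1 ≤ p)] (hμ : μ ≪ volume) (hμ' : volume ≪ μ)
    (hfin : ∀ x k, μ (bl B x k) ≠ ∞) (hp' : p ≠ ∞) :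
    Dense (lpInter B₁ r p hμ' : Set (Lp B₁ p μ)) := by
  have hp0 : p ≠ 0 := (zero_lt_one.trans_le (Fact.out (p := 1 ≤ p))).ne'
  intro F
  obtain ⟨G, hG, hlim⟩ := h.exists_isTest_tendsto_eLpNorm hμ hμ' hp0 hp' (Lp.memLp F)
  have hGm : ∀ j, MemLp (G j) p μ := fun j => (hG j).memLp h μ hμ hfin p
  refine mem_closure_of_tendsto (f := fun j => (hGm j).toLp (G j)) (b := Filter.atTop) ?_
    (Filter.Eventually.of_forall fun j => ?_)
  · have := (Lp.tendsto_Lp_iff_tendsto_eLpNorm'' G hGm F (Lp.memLp F)).2 hlim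
    rwa [Lp.toLp_coeFn] at this
  · exact ((hG j).memLp_volume h r).ae_eq (hμ'.ae_eq (hGm j).coeFn_toLp).symm

/-- Extension by continuity from the dense subspace `L^r ∩ L^p(μ)`. -/
theorem existsUnique_strong_extension [CompleteSpace B₂] [Fact (1 ≤ p)] (hμ : μ ≪ volume)
    (hμ' : volume ≪ μ) (hfin : ∀ x k, μ (bl B x k) ≠ ∞) (hp' : p ≠ ∞) {C : ℝ≥0}
    (H : ∀ f : E → B₁, MemLp f r volume → eLpNorm (opFn T f) p μ ≤ C * eLpNorm f p μ) :
    ∃! S : Lp B₁ p μ →L[ℂ] Lp B₂ p μ, ∀ (f : E → B₁) (hf : MemLp f r volume)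
      (hfw : MemLp f p μ), S (hfw.toLp f) =ᵐ[μ] T (hf.toLp f) := by
  have hdense := h.dense_lpInter (B₁ := B₁) (r := r) hμ hμ' hfin hp'
  have H' : ∀ f : E → B₁, MemLp f r volume → MemLp f p μ → MemLp (opFn T f) p μ :=
    fun f hf hfp => ⟨(opFn_stronglyMeasurable T f).aestronglyMeasurable,
      (H f hf).trans_lt (ENNReal.mul_lt_top ENNReal.coe_lt_top hfp.2)⟩
  set V := lpInter B₁ r p hμ' with hV
  have hdr : DenseRange V.subtype := by simpa [DenseRange] using hdense
  have hnorm : ∃ C : ℝ, ∀ F : V, ‖opLp T hμ hμ' H' F‖ ≤ C * ‖V.subtype F‖ := by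
    refine ⟨C, fun F => ?_⟩
    have h1 := H F F.2
    change ‖(H' F F.2 (Lp.memLp F.1)).toLp (opFn T F)‖ ≤ C * ‖(F : Lp B₁ p μ)‖
    rw [Lp.norm_toLp, Lp.norm_def, ← ENNReal.coe_toReal C, ← ENNReal.toReal_mul]
    exact ENNReal.toReal_mono (ENNReal.mul_ne_top (by simp) (Lp.eLpNorm_ne_top _)) h1
  refine ⟨(opLp T hμ hμ' H').extendOfNorm V.subtype, fun f hf hfw => ?_, fun S hS => ?_⟩
  · have hcoe : (hfw.toLp f : E → B₁) =ᵐ[volume] f := hμ' hfw.coeFn_toLp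
    have hmem : hfw.toLp f ∈ V := hf.ae_eq hcoe.symm
    have h1 := LinearMap.extendOfNorm_eq hdr hnorm ⟨hfw.toLp f, hmem⟩
    change (opLp T hμ hμ' H').extendOfNorm V.subtype (hfw.toLp f) =
      (H' _ hmem (Lp.memLp _)).toLp (opFn T (hfw.toLp f)) at h1
    rw [h1]
    refine (MemLp.coeFn_toLp _).trans ?_
    rw [opFn_congr T hcoe, opFn_of_memLp T hf]
  · refine ContinuousLinearMap.ext fun F => ?_
    refine congrFun (Continuous.ext_on hdense S.continuous
      (ContinuousLinearMap.continuous _) fun F hF => ?_) F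
    have h1 := LinearMap.extendOfNorm_eq hdr hnorm ⟨F, hF⟩
    change (opLp T hμ hμ' H').extendOfNorm V.subtype F =
      (H' _ hF (Lp.memLp _)).toLp (opFn T F) at h1
    rw [h1]
    refine Lp.ext ?_
    have h2 := hS F hF (Lp.memLp F)
    rw [Lp.toLp_coeFn] at h2
    refine h2.trans ?_
    rw [← opFn_of_memLp T hF]
    exact (MemLp.coeFn_toLp _).symm

end IsBallFamily

/-- `g` is the weak-type extension of `T` at `F`. -/
structure IsWeakExt (μ : Measure E) (C : ℝ≥0) (F : E → B₁) (g : E → B₂) : Prop where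
  aestronglyMeasurable : AEStronglyMeasurable g μ
  le : ∀ f : E → B₁, MemLp f r volume → MemLp f 1 μ →
    weakL1Norm (g - opFn T f) μ ≤ C * eLpNorm (F - f) 1 μ

variable {T}

theorem IsWeakExt.congr {C : ℝ≥0} {F F' : E → B₁} {g : E → B₂} (hg : IsWeakExt T μ C F g)
    (hF : F =ᵐ[μ] F') : IsWeakExt T μ C F' g := by
  refine ⟨hg.aestronglyMeasurable, fun f hf hfw => (hg.le f hf hfw).trans_eq ?_⟩
  rw [eLpNorm_congr_ae (hF.sub Filter.EventuallyEq.rfl)]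

theorem isWeakExt_opFn {C : ℝ≥0} (hμ : μ ≪ volume)
    (H : ∀ f : E → B₁, MemLp f r volume → weakL1Norm (opFn T f) μ ≤ C * eLpNorm f 1 μ)
    {f : E → B₁} (hf : MemLp f r volume) : IsWeakExt T μ C f (opFn T f) := by
  refine ⟨(opFn_stronglyMeasurable T f).aestronglyMeasurable, fun f' hf' _ => ?_⟩
  rw [← weakL1Norm_congr (hμ (opFn_sub T hf hf'))]
  exact H _ (hf.sub hf')

namespace IsBallFamily

variable [BorelSpace E] [ProperSpace E]
variable (h : IsBallFamily b σ B)
include h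

omit [NormedSpace ℂ B₁] in
theorem exists_isTest_eLpNorm_sub_le (hμ : μ ≪ volume) (hμ' : volume ≪ μ) {F : E → B₁}
    (hF : MemLp F 1 μ) {ε : ℝ≥0∞} (hε : 0 < ε) :
    ∃ f : E → B₁, IsTest f ∧ eLpNorm (F - f) 1 μ ≤ ε := by
  obtain ⟨G, hG, hlim⟩ := h.exists_isTest_tendsto_eLpNorm hμ hμ' one_ne_zero ENNReal.one_ne_top hF
  obtain ⟨j, hj⟩ := (hlim.eventually (ge_mem_nhds hε)).exists
  exact ⟨G j, hG j, by rwa [eLpNorm_sub_comm]⟩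

/-- The inequality in `IsWeakExt` replaces continuity for a norm: a test function `f` close to `F`
makes both `g` and `g'` weakly close to `T f`. The constants may differ, which is needed for
comparison with an arbitrary competing operator. -/
theorem isWeakExt_unique (hμ : μ ≪ volume) (hμ' : volume ≪ μ)
    (hfin : ∀ x k, μ (bl B x k) ≠ ∞) {C C' : ℝ≥0} {F : E → B₁} (hF : MemLp F 1 μ)
    {g g' : E → B₂} (hg : IsWeakExt T μ C F g) (hg' : IsWeakExt T μ C' F g') : g =ᵐ[μ] g' := by
  refine ae_eq_of_forall_exists_weakL1Norm_le fun ε hε => ?_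
  have hc : 0 < ε / (C + C' + 1) := by positivity
  obtain ⟨f, hf, hle⟩ := h.exists_isTest_eLpNorm_sub_le hμ hμ' hF (ENNReal.coe_pos.2 hc)
  have hfr := hf.memLp_volume h r
  have hfw := hf.memLp h μ hμ hfin 1
  have key : ∀ c : ℝ≥0, c ≤ C + C' + 1 → (c : ℝ≥0∞) * eLpNorm (F - f) 1 μ ≤ ε := by
    intro c hcle
    refine (mul_le_mul' (ENNReal.coe_le_coe.2 hcle) hle).trans ?_
    rw [← ENNReal.coe_mul, mul_div_cancel₀ _ (by positivity)]
  refine ⟨opFn T f, (hg.le f hfr hfw).trans (key C ?_), (hg'.le f hfr hfw).trans (key C' ?_)⟩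
  · rw [add_assoc]; exact le_self_add
  · rw [add_comm C, add_assoc]; exact le_self_add

theorem isWeakExt_add (hμ : μ ≪ volume) (hμ' : volume ≪ μ)
    (hfin : ∀ x k, μ (bl B x k) ≠ ∞) {C : ℝ≥0} {F F' : E → B₁} (hF : MemLp F 1 μ)
    (hF' : MemLp F' 1 μ) {g g' g'' : E → B₂} (hg : IsWeakExt T μ C F g)
    (hg' : IsWeakExt T μ C F' g') (hg'' : IsWeakExt T μ C (F + F') g'') : g'' =ᵐ[μ] g + g' := by
  refine ae_eq_of_forall_exists_weakL1Norm_le fun ε hε => ?_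
  -- Two approximation errors, each with factor `C`, and the quasi-triangle factor 2 give `4C`; the
  -- 1 avoids division by zero.
  have hc : 0 < ε / (4 * C + 1) := by positivity
  obtain ⟨f, hf, hle⟩ := h.exists_isTest_eLpNorm_sub_le hμ hμ' hF (ENNReal.coe_pos.2 hc)
  obtain ⟨f', hf', hle'⟩ := h.exists_isTest_eLpNorm_sub_le hμ hμ' hF' (ENNReal.coe_pos.2 hc)
  have hfr := hf.memLp_volume h r
  have hfw := hf.memLp h μ hμ hfin 1
  have hfr' := hf'.memLp_volume h r
  have hfw' := hf'.memLp h μ hμ hfin 1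
  have key : (2 : ℝ≥0∞) * (C * ((ε / (4 * C + 1) : ℝ≥0) : ℝ≥0∞) +
      C * ((ε / (4 * C + 1) : ℝ≥0) : ℝ≥0∞)) ≤ ε := by
    rw [← ENNReal.coe_ofNat, ← ENNReal.coe_mul, ← ENNReal.coe_add, ← ENNReal.coe_mul,
      ENNReal.coe_le_coe]
    calc 2 * (C * (ε / (4 * C + 1)) + C * (ε / (4 * C + 1)))
        = (4 * C) * (ε / (4 * C + 1)) := by ring
      _ ≤ (4 * C + 1) * (ε / (4 * C + 1)) := mul_le_mul' le_self_add le_rfl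
      _ = ε := mul_div_cancel₀ _ (by positivity)
  have hadd := hμ (opFn_add T hfr hfr')
  refine ⟨opFn T (f + f'), ?_, ?_⟩
  · refine (hg''.le _ (hfr.add hfr') (hfw.add hfw')).trans (le_trans ?_ key)
    have h1 : F + F' - (f + f') = (F - f) + (F' - f') := by abel
    rw [h1]
    refine (mul_le_mul' le_rfl ((eLpNorm_add_le (hF.sub hfw).1 (hF'.sub hfw').1 le_rfl).trans
      (add_le_add hle hle'))).trans ?_
    rw [mul_add]
    exact le_mul_of_one_le_left' one_le_two
  · rw [weakL1Norm_congr (g' := (g - opFn T f) + (g' - opFn T f'))]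
    · refine (weakL1Norm_add_le _ _).trans (le_trans ?_ key)
      refine mul_le_mul' le_rfl (add_le_add ?_ ?_)
      · exact (hg.le f hfr hfw).trans (mul_le_mul' le_rfl hle)
      · exact (hg'.le f' hfr' hfw').trans (mul_le_mul' le_rfl hle')
    · filter_upwards [hadd] with x hx
      simp only [Pi.sub_apply, Pi.add_apply] at hx ⊢
      rw [hx]
      abel

theorem isWeakExt_smul (hμ : μ ≪ volume) (hμ' : volume ≪ μ)
    (hfin : ∀ x k, μ (bl B x k) ≠ ∞) {C : ℝ≥0} {F : E → B₁} (hF : MemLp F 1 μ) (c : ℂ)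
    {g g' : E → B₂} (hg : IsWeakExt T μ C F g)
    (hg' : IsWeakExt T μ C (c • F) g') : g' =ᵐ[μ] c • g := by
  refine ae_eq_of_forall_exists_weakL1Norm_le fun ε hε => ?_
  have hc : 0 < ε / (‖c‖₊ * C + 1) := by positivity
  obtain ⟨f, hf, hle⟩ := h.exists_isTest_eLpNorm_sub_le hμ hμ' hF (ENNReal.coe_pos.2 hc)
  have hfr := hf.memLp_volume h r
  have hfw := hf.memLp h μ hμ hfin 1
  have key : ‖c‖ₑ * (C * eLpNorm (F - f) 1 μ) ≤ ε := by
    refine (mul_le_mul' le_rfl (mul_le_mul' le_rfl hle)).trans ?_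
    rw [enorm_eq_nnnorm, ← ENNReal.coe_mul, ← ENNReal.coe_mul, ENNReal.coe_le_coe, ← mul_assoc]
    refine (mul_le_mul' (le_self_add (b := 1)) le_rfl).trans_eq ?_
    exact mul_div_cancel₀ _ (by positivity)
  have hsm := hμ (opFn_const_smul T c hfr)
  refine ⟨opFn T (c • f), ?_, ?_⟩
  · refine (hg'.le _ (hfr.const_smul c) (hfw.const_smul c)).trans (le_trans ?_ key)
    rw [← smul_sub, eLpNorm_const_smul]
    exact (mul_left_comm _ _ _).le
  · rw [weakL1Norm_congr (g' := c • (g - opFn T f))]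
    · exact (weakL1Norm_const_smul_le c _).trans
        ((mul_le_mul' le_rfl (hg.le f hfr hfw)).trans key)
    · filter_upwards [hsm] with x hx
      simp only [Pi.sub_apply, Pi.smul_apply] at hx ⊢
      rw [hx, smul_sub]

/-- Approximants with `L¹` errors `4^{-j}` have images whose differences exceed `2^{-j}` on sets of
measure at most `2C · 2^{-j}`. By Borel–Cantelli the images converge almost everywhere, and Fatou's
lemma for the quasi-norm transfers the inequality to the limit. -/
theorem exists_isWeakExt [CompleteSpace B₂] (hμ : μ ≪ volume) (hμ' : volume ≪ μ)
    (hfin : ∀ x k, μ (bl B x k) ≠ ∞) {C : ℝ≥0}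
    (H : ∀ f : E → B₁, MemLp f r volume → weakL1Norm (opFn T f) μ ≤ C * eLpNorm f 1 μ)
    {F : E → B₁} (hF : MemLp F 1 μ) : ∃ g : E → B₂, IsWeakExt T μ C F g := by
  have hex : ∀ j : ℕ, ∃ f : E → B₁, IsTest f ∧
      eLpNorm (F - f) 1 μ ≤ (((1 / 4 : ℝ≥0) ^ j : ℝ≥0) : ℝ≥0∞) := fun j =>
    h.exists_isTest_eLpNorm_sub_le hμ hμ' hF (ENNReal.coe_pos.2 (by positivity))
  choose f hf hle using hex
  have hfr : ∀ j, MemLp (f j) r volume := fun j => (hf j).memLp_volume h r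
  have hfw : ∀ j, MemLp (f j) 1 μ := fun j => (hf j).memLp h μ hμ hfin 1
  have hstep : ∀ j, weakL1Norm (opFn T (f j) - opFn T (f (j + 1))) μ ≤
      ((C * 2 * (1 / 4) ^ j : ℝ≥0) : ℝ≥0∞) := by
    intro j
    refine ((isWeakExt_opFn hμ H (hfr j)).le _ (hfr _) (hfw _)).trans ?_
    rw [mul_assoc, ENNReal.coe_mul]
    refine mul_le_mul' le_rfl ?_
    have h1 : f j - f (j + 1) = (f j - F) + (F - f (j + 1)) := by abel
    rw [h1]
    refine (eLpNorm_add_le ((hfw j).sub hF).1 (hF.sub (hfw _)).1 le_rfl).trans ?_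
    rw [eLpNorm_sub_comm]
    refine (add_le_add (hle j) (hle (j + 1))).trans ?_
    rw [← ENNReal.coe_add, ENNReal.coe_le_coe, two_mul]
    refine add_le_add le_rfl (pow_le_pow_of_le_one zero_le ?_ (Nat.le_succ j))
    rw [← NNReal.coe_le_coe]; norm_num
  have hBC : ∀ᵐ x ∂μ, ∀ᶠ j in Filter.atTop,
      x ∉ {x | (((1 / 2 : ℝ≥0) ^ j : ℝ≥0) : ℝ≥0∞) <
        ‖(opFn T (f j) - opFn T (f (j + 1))) x‖ₑ} := by
    refine ae_eventually_notMem ?_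
    have hb : ∀ j : ℕ, μ {x | (((1 / 2 : ℝ≥0) ^ j : ℝ≥0) : ℝ≥0∞) <
        ‖(opFn T (f j) - opFn T (f (j + 1))) x‖ₑ} ≤ ((C * 2 * (1 / 2) ^ j : ℝ≥0) : ℝ≥0∞) := by
      intro j
      have h2 := (mul_measure_le_weakL1Norm (μ := μ) (opFn T (f j) - opFn T (f (j + 1)))
        ((1 / 2 : ℝ≥0) ^ j)).trans (hstep j)
      have hpos : (0 : ℝ≥0) < (1 / 2) ^ j := by positivity
      have h3 : ((C * 2 * (1 / 4) ^ j : ℝ≥0) : ℝ≥0∞) =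
          (((1 / 2 : ℝ≥0) ^ j : ℝ≥0) : ℝ≥0∞) * ((C * 2 * (1 / 2) ^ j : ℝ≥0) : ℝ≥0∞) := by
        rw [← ENNReal.coe_mul]
        congr 1
        have : (1 / 4 : ℝ≥0) = 1 / 2 * (1 / 2) := by
          rw [← NNReal.coe_inj]; norm_num
        rw [this, mul_pow]
        ring
      rw [h3] at h2
      exact (ENNReal.mul_le_mul_iff_right (by simp) ENNReal.coe_ne_top).1 h2
    refine ne_top_of_le_ne_top ?_ (ENNReal.tsum_le_tsum hb)
    refine ENNReal.tsum_coe_ne_top_iff_summable.2 (Summable.mul_left _ ?_)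
    exact NNReal.summable_geometric (by rw [← NNReal.coe_lt_coe]; norm_num)
  have hlim : ∀ᵐ x ∂μ, ∃ l : B₂,
      Filter.Tendsto (fun j => opFn T (f j) x) Filter.atTop (nhds l) := by
    filter_upwards [hBC] with x hx
    refine cauchySeq_tendsto_of_complete (cauchySeq_of_summable_dist ?_)
    refine Summable.of_norm_bounded_eventually_nat
      (summable_geometric_of_lt_one (r := 1 / 2) (by norm_num) (by norm_num)) ?_
    filter_upwards [hx] with j hj
    have hj' : ‖(opFn T (f j) - opFn T (f (j + 1))) x‖ₑ ≤
        (((1 / 2 : ℝ≥0) ^ j : ℝ≥0) : ℝ≥0∞) := not_lt.1 hj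
    rw [enorm_eq_nnnorm, ENNReal.coe_le_coe, ← NNReal.coe_le_coe] at hj'
    rw [Real.norm_of_nonneg dist_nonneg, dist_eq_norm]
    simpa using hj'
  obtain ⟨g, hgm, hg⟩ := exists_stronglyMeasurable_limit_of_tendsto_ae
    (fun j => (opFn_stronglyMeasurable T (f j)).aestronglyMeasurable) hlim
  refine ⟨g, hgm.aestronglyMeasurable, fun u hu huw => ?_⟩
  have hmain : ∀ m : ℕ, weakL1Norm (g - opFn T u) μ ≤
      C * (((1 / 4 : ℝ≥0) ^ m : ℝ≥0) + eLpNorm (F - u) 1 μ) := by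
    intro m
    refine weakL1Norm_le_of_tendsto_ae (G := fun j => opFn T (f j) - opFn T u) ?_ ?_
    · filter_upwards [hg] with x hx
      exact hx.sub_const _
    · filter_upwards [Filter.eventually_ge_atTop m] with j hj
      refine ((isWeakExt_opFn hμ H (hfr j)).le u hu huw).trans (mul_le_mul' le_rfl ?_)
      have h1 : f j - u = (f j - F) + (F - u) := by abel
      rw [h1]
      refine (eLpNorm_add_le ((hfw j).sub hF).1 (hF.sub huw).1 le_rfl).trans
        (add_le_add ?_ le_rfl)
      rw [eLpNorm_sub_comm]
      refine (hle j).trans (ENNReal.coe_le_coe.2 (pow_le_pow_of_le_one zero_le ?_ hj))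
      rw [← NNReal.coe_le_coe]; norm_num
  have h4 : Filter.Tendsto (fun m : ℕ => (((1 / 4 : ℝ≥0) ^ m : ℝ≥0) : ℝ≥0∞)) Filter.atTop
      (nhds 0) := by
    rw [← ENNReal.coe_zero, ENNReal.tendsto_coe]
    exact NNReal.tendsto_pow_atTop_nhds_zero_of_lt_one (by rw [← NNReal.coe_lt_coe]; norm_num)
  have h5 := ENNReal.Tendsto.const_mul (a := (C : ℝ≥0∞))
    (h4.add (tendsto_const_nhds (x := eLpNorm (F - u) 1 μ))) (Or.inr ENNReal.coe_ne_top)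
  rw [zero_add] at h5
  exact ge_of_tendsto' h5 hmain

variable (T)

/-- The bound is the defining inequality at `f = 0`; linearity and agreement with `T` follow from
uniqueness of weak extensions. A competitor satisfies the same inequality with its own constant, by
its bound applied to `F - u`, so it coincides with `S`. -/
theorem existsUnique_weak_extension [CompleteSpace B₂] (hμ : μ ≪ volume) (hμ' : volume ≪ μ)
    (hfin : ∀ x k, μ (bl B x k) ≠ ∞) {C : ℝ≥0}
    (H : ∀ f : E → B₁, MemLp f r volume → weakL1Norm (opFn T f) μ ≤ C * eLpNorm f 1 μ) :
    ∃! S : Lp B₁ 1 μ →ₗ[ℂ] (E →ₘ[μ] B₂),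
      (∃ C : ℝ≥0, ∀ f : Lp B₁ 1 μ, weakL1Norm (S f) μ ≤ C * eLpNorm f 1 μ) ∧
      ∀ (f : E → B₁) (hf : MemLp f r volume) (hfw : MemLp f 1 μ),
        S (hfw.toLp f) =ᵐ[μ] T (hf.toLp f) := by
  choose g hg using fun F : Lp B₁ 1 μ => h.exists_isWeakExt hμ hμ' hfin H (Lp.memLp F)
  have hgm : ∀ F, AEStronglyMeasurable (g F) μ := fun F => (hg F).aestronglyMeasurable
  let S : Lp B₁ 1 μ →ₗ[ℂ] (E →ₘ[μ] B₂) :=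
    { toFun := fun F => AEEqFun.mk (g F) (hgm F)
      map_add' := fun F F' => by
        rw [AEEqFun.mk_add_mk, AEEqFun.mk_eq_mk]
        exact h.isWeakExt_add hμ hμ' hfin (Lp.memLp F) (Lp.memLp F') (hg F) (hg F')
          ((hg (F + F')).congr (Lp.coeFn_add F F'))
      map_smul' := fun c F => by
        rw [RingHom.id_apply, AEEqFun.smul_mk c (g F) (hgm F), AEEqFun.mk_eq_mk]
        exact h.isWeakExt_smul hμ hμ' hfin (Lp.memLp F) c (hg F)
          ((hg (c • F)).congr (Lp.coeFn_smul c F)) }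
  have hS : ∀ F, S F =ᵐ[μ] g F := fun F => AEEqFun.coeFn_mk _ _
  refine ⟨S, ⟨⟨C, fun F => ?_⟩, fun f hf hfw => ?_⟩, fun S' hS' => ?_⟩
  · have h1 := (hg F).le 0 MemLp.zero MemLp.zero
    rw [sub_zero] at h1
    refine le_trans (le_of_eq (weakL1Norm_congr ?_)) h1
    filter_upwards [hS F, hμ (opFn_zero T)] with x hx hx0
    rw [hx, Pi.sub_apply, hx0]
    simp
  · refine (hS _).trans ?_
    rw [← opFn_of_memLp T hf]
    exact h.isWeakExt_unique hμ hμ' hfin hfw ((hg _).congr hfw.coeFn_toLp)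
      (isWeakExt_opFn hμ H hf)
  · obtain ⟨⟨C', hC'⟩, hagree⟩ := hS'
    refine LinearMap.ext fun F => AEEqFun.ext ?_
    refine Filter.EventuallyEq.trans ?_ (hS F).symm
    refine h.isWeakExt_unique (T := T) (C := C') hμ hμ' hfin (Lp.memLp F) ?_ (hg F)
    refine ⟨(S' F).aestronglyMeasurable, fun u hu huw => ?_⟩
    have h1 := hC' (F - huw.toLp u)
    rw [map_sub] at h1
    have h2 : weakL1Norm ((S' F : E → B₂) - opFn T u) μ =
        weakL1Norm (S' F - S' (huw.toLp u) : E →ₘ[μ] B₂) μ := by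
      refine weakL1Norm_congr ?_
      rw [opFn_of_memLp T hu]
      filter_upwards [AEEqFun.coeFn_sub (S' F) (S' (huw.toLp u)), hagree u hu huw] with x hx hx'
      rw [hx, Pi.sub_apply, Pi.sub_apply, hx']
    rw [h2]
    refine h1.trans_eq ?_
    congr 1
    refine eLpNorm_congr_ae ((Lp.coeFn_sub _ _).trans ?_)
    exact Filter.EventuallyEq.rfl.sub huw.coeFn_toLp

end IsBallFamily

end Extension

/-! ### The dilated ellipsoids and the step quasi-norm -/

section Dilations

variable {n : ℕ} {A : Matrix (Fin n) (Fin n) ℝ} {Δ : Set (EuclideanSpace ℝ (Fin n))}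

theorem toEuclideanLin_mul_apply (M N : Matrix (Fin n) (Fin n) ℝ)
    (x : EuclideanSpace ℝ (Fin n)) :
    Matrix.toEuclideanLin (M * N) x = Matrix.toEuclideanLin M (Matrix.toEuclideanLin N x) := by
  simp [Matrix.toLpLin_apply]

theorem toEuclideanLin_zpow_add_apply (hA : IsUnit A.det) (k l : ℤ)
    (x : EuclideanSpace ℝ (Fin n)) :
    Matrix.toEuclideanLin (A ^ (k + l)) x =
      Matrix.toEuclideanLin (A ^ k) (Matrix.toEuclideanLin (A ^ l) x) := by
  rw [Matrix.zpow_add hA, toEuclideanLin_mul_apply]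

theorem toEuclideanLin_zpow_zero_apply (x : EuclideanSpace ℝ (Fin n)) :
    Matrix.toEuclideanLin (A ^ (0 : ℤ)) x = x := by
  simp

theorem continuous_toEuclideanLin (M : Matrix (Fin n) (Fin n) ℝ) :
    Continuous (Matrix.toEuclideanLin M) :=
  LinearMap.continuous_of_finiteDimensional _

theorem isBounded_image_toEuclideanLin (M : Matrix (Fin n) (Fin n) ℝ)
    {s : Set (EuclideanSpace ℝ (Fin n))} (hs : Bornology.IsBounded s) :
    Bornology.IsBounded (Matrix.toEuclideanLin M '' s) :=
  (LinearMap.toContinuousLinearMap (Matrix.toEuclideanLin M)).lipschitz.isBounded_image hs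

theorem mem_dilatedBall_iff (hA : IsUnit A.det) {k : ℤ} {x : EuclideanSpace ℝ (Fin n)} :
    x ∈ dilatedBall A Δ k ↔ Matrix.toEuclideanLin (A ^ (-k)) x ∈ Δ := by
  constructor
  · rintro ⟨y, hy, rfl⟩
    rwa [← toEuclideanLin_zpow_add_apply hA, neg_add_cancel, toEuclideanLin_zpow_zero_apply]
  · intro hx
    refine ⟨_, hx, ?_⟩
    rw [← toEuclideanLin_zpow_add_apply hA, add_neg_cancel, toEuclideanLin_zpow_zero_apply]

theorem mem_dilatedBall_add_iff (hA : IsUnit A.det) {k l : ℤ} {x : EuclideanSpace ℝ (Fin n)} :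
    x ∈ dilatedBall A Δ (k + l) ↔ Matrix.toEuclideanLin (A ^ (-k)) x ∈ dilatedBall A Δ l := by
  rw [mem_dilatedBall_iff hA, mem_dilatedBall_iff hA, ← toEuclideanLin_zpow_add_apply hA,
    neg_add, add_comm]

theorem dilatedBall_zero : dilatedBall A Δ 0 = Δ := by
  ext x
  simp [dilatedBall]

theorem det_zpow (k : ℤ) : (A ^ k).det = A.det ^ k := by
  cases k with
  | ofNat k => simp
  | negSucc k =>
    rw [zpow_negSucc, zpow_negSucc, Matrix.det_nonsing_inv, Matrix.det_pow,
      Ring.inverse_eq_inv']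

theorem volume_dilatedBall (hvol : volume Δ = 1) (k : ℤ) :
    volume (dilatedBall A Δ k) = ((‖A.det‖₊ ^ k : ℝ≥0) : ℝ≥0∞) := by
  rw [dilatedBall, Measure.addHaar_image_linearMap, hvol, mul_one, LinearMap.det_toLpLin,
    det_zpow, ← Real.norm_eq_abs, ofReal_norm, enorm_eq_nnnorm, nnnorm_zpow]

namespace IsAdmissibleEllipsoid

variable (hΔ : IsAdmissibleEllipsoid A Δ)
include hΔ

theorem isOpen : IsOpen Δ := by
  obtain ⟨P, -, rfl⟩ := hΔ.ellipsoid
  exact isOpen_lt (continuous_toEuclideanLin P).norm continuous_const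

theorem zero_mem : (0 : EuclideanSpace ℝ (Fin n)) ∈ Δ := by
  obtain ⟨P, -, rfl⟩ := hΔ.ellipsoid
  simp

theorem neg_mem {x : EuclideanSpace ℝ (Fin n)} (hx : x ∈ Δ) : -x ∈ Δ := by
  obtain ⟨P, -, rfl⟩ := hΔ.ellipsoid
  simpa only [mem_ofPred_eq, map_neg, norm_neg] using hx

theorem convex : Convex ℝ Δ := by
  obtain ⟨P, -, rfl⟩ := hΔ.ellipsoid
  have h1 : {x | ‖Matrix.toEuclideanLin P x‖ < 1} =
      Matrix.toEuclideanLin P ⁻¹' Metric.ball 0 1 := by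
    ext x; simp
  rw [h1]
  exact (convex_ball _ _).linear_preimage _

theorem isBounded : Bornology.IsBounded Δ := by
  obtain ⟨P, hP, rfl⟩ := hΔ.ellipsoid
  refine (isBounded_image_toEuclideanLin P⁻¹ (Metric.isBounded_ball (x := 0) (r := 1))).subset
    fun x hx => ⟨Matrix.toEuclideanLin P x, by simpa using hx, ?_⟩
  rw [← toEuclideanLin_mul_apply, Matrix.nonsing_inv_mul _ (isUnit_iff_ne_zero.2 hP)]
  simp

theorem smul_mem {c : ℝ} (hc : 0 ≤ c) (hc1 : c ≤ 1) {x : EuclideanSpace ℝ (Fin n)}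
    (hx : x ∈ Δ) : c • x ∈ Δ := by
  have := hΔ.convex.smul_mem_of_zero_mem hΔ.zero_mem hx ⟨hc, hc1⟩
  exact this

/-- Volumes in `rΔ ⊆ AΔ` give `r^n ≤ |det A|`. -/
theorem one_lt_nnnorm_det (hn : 0 < n) : 1 < ‖A.det‖₊ := by
  obtain ⟨r, hr, -, hsub⟩ := hΔ.nested
  have h1 := measure_mono (μ := volume) hsub
  rw [Measure.addHaar_smul, Measure.addHaar_image_linearMap, hΔ.volume_eq_one, mul_one, mul_one,
    LinearMap.det_toLpLin, finrank_euclideanSpace_fin] at h1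
  have h2 := (ENNReal.ofReal_le_ofReal_iff (abs_nonneg _)).1 h1
  rw [← NNReal.coe_lt_coe, coe_nnnorm, NNReal.coe_one, Real.norm_eq_abs]
  refine lt_of_lt_of_le ?_ h2
  rw [abs_of_nonneg (by positivity)]
  exact one_lt_pow₀ hr hn.ne'

theorem isUnit_det (hn : 0 < n) : IsUnit A.det := by
  rw [isUnit_iff_ne_zero, ← nnnorm_pos]
  exact zero_lt_one.trans (hΔ.one_lt_nnnorm_det hn)

/-- The inclusion `A⁻¹(rΔ) ⊆ Δ` is iterated. This quantitative contraction gives the nesting of the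
balls, their shrinking to the origin and their exhausting the space. -/
theorem exists_pow_smul_mem (hn : 0 < n) : ∃ r : ℝ, 1 < r ∧ ∀ (k : ℕ) (x), x ∈ Δ →
    r ^ k • Matrix.toEuclideanLin (A ^ (-k : ℤ)) x ∈ Δ := by
  have hA := hΔ.isUnit_det hn
  obtain ⟨r, hr, -, hsub⟩ := hΔ.nested
  have hstep : ∀ x ∈ Δ, r • Matrix.toEuclideanLin (A ^ (-1 : ℤ)) x ∈ Δ := by
    intro x hx
    obtain ⟨y, hy, hyx⟩ := hsub (smul_mem_smul_set (a := r) hx)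
    rw [← map_smul, ← hyx]
    have h1 := toEuclideanLin_zpow_add_apply hA (-1) 1 y
    rw [zpow_one, neg_add_cancel, toEuclideanLin_zpow_zero_apply] at h1
    rwa [← h1]
  refine ⟨r, hr, fun k => ?_⟩
  induction k with
  | zero => intro x hx; simpa [Matrix.toLpLin_apply] using hx
  | succ k ih =>
    intro x hx
    have h1 := hstep _ (ih x hx)
    rw [map_smul, smul_smul, ← toEuclideanLin_zpow_add_apply hA] at h1
    rw [pow_succ']
    have h2 : (-((k + 1 : ℕ) : ℤ)) = -1 + -(k : ℤ) := by push_cast; ring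
    rwa [h2]

theorem dilatedBall_mono (hn : 0 < n) : Monotone (dilatedBall A Δ) := by
  have hA := hΔ.isUnit_det hn
  obtain ⟨r, hr, hmem⟩ := hΔ.exists_pow_smul_mem hn
  have hr0 : 0 < r := zero_lt_one.trans hr
  refine monotone_int_of_le_succ fun k x hx => ?_
  rw [mem_dilatedBall_iff hA] at hx
  have h1 := hΔ.smul_mem (inv_nonneg.2 hr0.le) (inv_le_one_of_one_le₀ hr.le) (hmem 1 _ hx)
  rw [pow_one, smul_smul, inv_mul_cancel₀ hr0.ne', one_smul,
    ← toEuclideanLin_zpow_add_apply hA] at h1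
  rw [mem_dilatedBall_iff hA, neg_add, add_comm]
  exact h1

theorem exists_dilatedBall_subset_ball (hn : 0 < n) {ε : ℝ} (hε : 0 < ε) :
    ∃ k, dilatedBall A Δ k ⊆ Metric.ball 0 ε := by
  have hA := hΔ.isUnit_det hn
  obtain ⟨r, hr, hmem⟩ := hΔ.exists_pow_smul_mem hn
  have hr0 : 0 < r := zero_lt_one.trans hr
  obtain ⟨R, hR⟩ := hΔ.isBounded.subset_ball 0
  obtain ⟨k, hk⟩ := pow_unbounded_of_one_lt (R / ε) hr
  refine ⟨-k, ?_⟩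
  rintro _ ⟨x, hx, rfl⟩
  have h1 := hR (hmem k x hx)
  rw [mem_ball_zero_iff, norm_smul, Real.norm_of_nonneg (by positivity)] at h1
  rw [mem_ball_zero_iff]
  rw [div_lt_iff₀ hε] at hk
  exact lt_of_mul_lt_mul_left (h1.trans hk) (by positivity)

theorem exists_ball_subset_dilatedBall (hn : 0 < n) (R : ℝ) :
    ∃ k, Metric.ball 0 R ⊆ dilatedBall A Δ k := by
  have hA := hΔ.isUnit_det hn
  obtain ⟨r, hr, hmem⟩ := hΔ.exists_pow_smul_mem hn
  have hr0 : 0 < r := zero_lt_one.trans hr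
  obtain ⟨δ, hδ, hsub⟩ := Metric.isOpen_iff.1 hΔ.isOpen 0 hΔ.zero_mem
  obtain ⟨k, hk⟩ := pow_unbounded_of_one_lt (R / δ) hr
  rw [div_lt_iff₀ hδ] at hk
  refine ⟨k, fun x hx => ?_⟩
  rw [mem_ball_zero_iff] at hx
  have hrk : 0 < r ^ k := by positivity
  have h1 : (r ^ k)⁻¹ • x ∈ Δ := by
    refine hsub ?_
    rw [mem_ball_zero_iff, norm_smul, Real.norm_of_nonneg (by positivity),
      inv_mul_lt_iff₀ hrk]
    exact hx.trans hk
  have h2 := hmem k _ h1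
  rw [map_smul, smul_smul, mul_inv_cancel₀ hrk.ne', one_smul] at h2
  rwa [mem_dilatedBall_iff hA]

/-- The infimum of a set of integers is attained only if the set is nonempty and bounded below. The
balls exhaust the space, so it is nonempty; an index at most zero would give `2Δ ⊆ Δ` and hence `2^n
≤ 1`. -/
theorem doublingIndex_spec (hn : 0 < n) :
    1 ≤ doublingIndex A Δ ∧ (2 : ℝ) • Δ ⊆ dilatedBall A Δ (doublingIndex A Δ) := by
  have hA := hΔ.isUnit_det hn
  set s : Set ℤ := {s : ℤ | (2 : ℝ) • dilatedBall A Δ 0 ⊆ dilatedBall A Δ s} with hs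
  have hlb : ∀ k ∈ s, 1 ≤ k := by
    intro k hk
    by_contra hcon
    have h1 : (2 : ℝ) • dilatedBall A Δ 0 ⊆ dilatedBall A Δ 0 :=
      Subset.trans hk (hΔ.dilatedBall_mono hn (by lia))
    have h2 := measure_mono (μ := volume) h1
    rw [dilatedBall_zero, Measure.addHaar_smul, hΔ.volume_eq_one, mul_one,
      finrank_euclideanSpace_fin, ENNReal.ofReal_le_one, abs_of_nonneg (by positivity)] at h2
    exact absurd h2 (not_le.2 (one_lt_pow₀ one_lt_two hn.ne'))
  have hne : s.Nonempty := by
    obtain ⟨R, hR⟩ := (hΔ.isBounded.smul₀ (2 : ℝ)).subset_ball 0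
    obtain ⟨k, hk⟩ := hΔ.exists_ball_subset_dilatedBall hn R
    refine ⟨k, ?_⟩
    show (2 : ℝ) • dilatedBall A Δ 0 ⊆ dilatedBall A Δ k
    rw [dilatedBall_zero]
    exact hR.trans hk
  have hmem : doublingIndex A Δ ∈ s := Int.csInf_mem hne ⟨1, hlb⟩
  refine ⟨hlb _ hmem, ?_⟩
  have h3 : (2 : ℝ) • dilatedBall A Δ 0 ⊆ dilatedBall A Δ (doublingIndex A Δ) := hmem
  rwa [dilatedBall_zero] at h3

/-- The dilates of an admissible ellipsoid form a ball family. -/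
theorem isBallFamily (hn : 0 < n) :
    IsBallFamily ‖A.det‖₊ (doublingIndex A Δ) (dilatedBall A Δ) := by
  have hA := hΔ.isUnit_det hn
  obtain ⟨hσ, hdouble⟩ := hΔ.doublingIndex_spec hn
  refine ⟨hΔ.one_lt_nnnorm_det hn, hσ, fun k => ?_,
    fun k => isBounded_image_toEuclideanLin _ hΔ.isBounded,
    fun k => ⟨0, hΔ.zero_mem, map_zero _⟩, fun k x hx => ?_, hΔ.dilatedBall_mono hn,
    fun k x y hx hy => ?_, fun ε hε => hΔ.exists_dilatedBall_subset_ball hn hε,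
    hΔ.exists_ball_subset_dilatedBall hn, fun x k => ?_⟩
  · have h1 : dilatedBall A Δ k = Matrix.toEuclideanLin (A ^ (-k)) ⁻¹' Δ := by
      ext x; exact mem_dilatedBall_iff hA
    rw [h1]
    exact hΔ.isOpen.preimage (continuous_toEuclideanLin _)
  · obtain ⟨y, hy, rfl⟩ := hx
    exact ⟨-y, hΔ.neg_mem hy, map_neg _ _⟩
  · rw [mem_dilatedBall_add_iff hA]
    rw [mem_dilatedBall_iff hA] at hx hy
    -- The sum is twice the midpoint, which lies in `Δ` by convexity.
    refine hdouble ⟨(1 / 2 : ℝ) • Matrix.toEuclideanLin (A ^ (-k)) x +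
      (1 / 2 : ℝ) • Matrix.toEuclideanLin (A ^ (-k)) y,
      hΔ.convex hx hy (by norm_num) (by norm_num) (by norm_num), ?_⟩
    show (2 : ℝ) • (_ + _) = _
    rw [smul_add, smul_smul, smul_smul, map_add]
    norm_num
  · rw [← volume_dilatedBall hΔ.volume_eq_one k]
    have h1 : {y | y - x ∈ dilatedBall A Δ k} = (fun y => y + -x) ⁻¹' dilatedBall A Δ k := by
      ext y; simp [sub_eq_add_neg]
    rw [h1, measure_preimage_add_right]

theorem exists_stepQuasiNorm_eq (hn : 0 < n) {x : EuclideanSpace ℝ (Fin n)} (hx : x ≠ 0) :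
    ∃ k : ℤ, x ∈ dilatedBall A Δ (k + 1) ∧ x ∉ dilatedBall A Δ k ∧
      stepQuasiNorm A Δ x = ((‖A.det‖₊ ^ k : ℝ≥0) : ℝ) := by
  have h := hΔ.isBallFamily hn
  have hex : ∃ k : ℤ, x ∈ dilatedBall A Δ (k + 1) \ dilatedBall A Δ k := by
    obtain ⟨k, hk⟩ := h.exists_subset_ball ‖x‖ (norm_pos_iff.2 hx)
    have hxk : x ∉ bl (dilatedBall A Δ) 0 k := by
      intro hmem
      have h1 : x ∈ dilatedBall A Δ k := by simpa [bl] using hmem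
      simpa using hk h1
    obtain ⟨i, hi, hi'⟩ := h.exists_shell hxk
    exact ⟨k + i, by simpa [bl] using hi', by simpa [bl] using hi⟩
  refine ⟨hex.choose, hex.choose_spec.1, hex.choose_spec.2, ?_⟩
  rw [stepQuasiNorm, dif_pos hex, NNReal.coe_zpow, coe_nnnorm, Real.norm_eq_abs]
  rfl

theorem stepQuasiNorm_zero (hn : 0 < n) : stepQuasiNorm A Δ 0 = 0 := by
  have h := hΔ.isBallFamily hn
  rw [stepQuasiNorm, dif_neg]
  rintro ⟨k, -, hk⟩
  exact hk (h.zero_mem k)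

theorem stepQuasiNorm_nonneg (hn : 0 < n) (x : EuclideanSpace ℝ (Fin n)) :
    0 ≤ stepQuasiNorm A Δ x := by
  rcases eq_or_ne x 0 with rfl | hx
  · rw [hΔ.stepQuasiNorm_zero hn]
  · obtain ⟨k, -, -, hk⟩ := hΔ.exists_stepQuasiNorm_eq hn hx
    rw [hk]
    exact NNReal.coe_nonneg _

theorem le_stepQuasiNorm (hn : 0 < n) {x : EuclideanSpace ℝ (Fin n)} {k : ℤ}
    (hx : x ∉ dilatedBall A Δ k) : ((‖A.det‖₊ ^ k : ℝ≥0) : ℝ) ≤ stepQuasiNorm A Δ x := by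
  have h := hΔ.isBallFamily hn
  have hx0 : x ≠ 0 := by rintro rfl; exact hx (h.zero_mem k)
  obtain ⟨j, hj, -, hjeq⟩ := hΔ.exists_stepQuasiNorm_eq hn hx0
  rw [hjeq, NNReal.coe_le_coe, h.zpow_le_iff]
  by_contra hcon
  exact hx (h.mono (by lia) hj)

theorem stepQuasiNorm_le (hn : 0 < n) {x : EuclideanSpace ℝ (Fin n)} {k : ℤ}
    (hx : x ∈ dilatedBall A Δ k) : stepQuasiNorm A Δ x ≤ ((‖A.det‖₊ ^ k : ℝ≥0) : ℝ) := by
  have h := hΔ.isBallFamily hn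
  rcases eq_or_ne x 0 with rfl | hx0
  · rw [hΔ.stepQuasiNorm_zero hn]
    exact NNReal.coe_nonneg _
  · obtain ⟨j, -, hj, hjeq⟩ := hΔ.exists_stepQuasiNorm_eq hn hx0
    rw [hjeq, NNReal.coe_le_coe, h.zpow_le_iff]
    by_contra hcon
    exact hj (h.mono (by lia) hx)

end IsAdmissibleEllipsoid

end Dilations

/-! ### From the stated hypotheses to kernels, dual pairs and `𝒜_1` weights -/

section Instances

variable {n : ℕ} {A : Matrix (Fin n) (Fin n) ℝ} {Δ : Set (EuclideanSpace ℝ (Fin n))}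

theorem vadd_dilatedBall (x : EuclideanSpace ℝ (Fin n)) (k : ℤ) :
    x +ᵥ dilatedBall A Δ k = bl (dilatedBall A Δ) x k := by
  ext y
  rw [mem_vadd_set_iff_neg_vadd_mem, vadd_eq_add, neg_add_eq_sub]
  rfl

section Kernel

variable {B₁ B₂ : Type*} [NormedAddCommGroup B₁] [NormedSpace ℂ B₁]
  [NormedAddCommGroup B₂] [NormedSpace ℂ B₂]

/-- Here `θ = b^{-ε}`. With `v = ρ(z-c) ≤ b^m` and `u = ρ(x-c) ≥ b^{m+2σ+i}` the separation
condition holds, and `v^ε / u^{1+ε} = u⁻¹ (v/u)^ε` with `v/u ≤ b^{-i}`. -/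
theorem IsStandardKernel.exists_isKernel (hΔ : IsAdmissibleEllipsoid A Δ) (hn : 0 < n)
    {K : EuclideanSpace ℝ (Fin n) → EuclideanSpace ℝ (Fin n) → B₁ →L[ℂ] B₂}
    (hK : IsStandardKernel A Δ K) :
    ∃ C θ : ℝ≥0, IsKernel (dilatedBall A Δ) ‖A.det‖₊ (doublingIndex A Δ) K C θ := by
  have h := hΔ.isBallFamily hn
  obtain ⟨C, ε, hC, hε, hsize, hreg⟩ := hK
  lift C to ℝ≥0 using hC.le
  have hlow := fun x k => hΔ.le_stepQuasiNorm hn (x := x) (k := k)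
  have hupp := fun x k => hΔ.stepQuasiNorm_le hn (x := x) (k := k)
  have hdil : dilationFactor A = (‖A.det‖₊ : ℝ) := rfl
  generalize ‖A.det‖₊ = b at h hlow hupp hdil ⊢
  have hb1 : 1 < b := h.one_lt
  have hb0 : 0 < b := h.pos
  refine ⟨C, b ^ (-ε), NNReal.rpow_lt_one_of_one_lt_of_neg hb1 (by linarith),
    fun x y k hxy => ?_, fun c z x m i hz hx => ?_⟩
  · have hmem : x - y ∉ dilatedBall A Δ k := hxy
    have hne : x ≠ y := by
      rintro rfl
      exact hmem (by rw [sub_self]; exact h.zero_mem k)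
    rw [← NNReal.coe_le_coe]
    push_cast
    rw [← div_eq_mul_inv, ← NNReal.coe_zpow]
    refine (hsize x y hne).trans (div_le_div_of_nonneg_left hC.le ?_ (hlow _ _ hmem))
    exact_mod_cast h.zpow_pos' k
  · have hxc : x - c ∉ dilatedBall A Δ (m + 2 * doublingIndex A Δ + i) := hx
    have hzc : z - c ∈ dilatedBall A Δ m := hz
    have hne : x ≠ c := by
      rintro rfl
      exact hxc (by rw [sub_self]; exact h.zero_mem _)
    set u := stepQuasiNorm A Δ (x - c) with hu
    set v := stepQuasiNorm A Δ (z - c) with hv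
    set l : ℤ := m + 2 * doublingIndex A Δ + i with hl
    have hul : ((b ^ l : ℝ≥0) : ℝ) ≤ u := hlow _ _ hxc
    have hvm : v ≤ ((b ^ m : ℝ≥0) : ℝ) := hupp _ _ hzc
    have hv0 : 0 ≤ v := hΔ.stepQuasiNorm_nonneg hn _
    have hbl : (0 : ℝ) < ((b ^ l : ℝ≥0) : ℝ) := by exact_mod_cast h.zpow_pos' l
    have hu0 : 0 < u := hbl.trans_le hul
    have hbR : (0 : ℝ) < b := by exact_mod_cast hb0
    have hbR1 : (1 : ℝ) < b := by exact_mod_cast hb1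
    have hcond : v ≤ dilationFactor A ^ (-2 * doublingIndex A Δ) * u := by
      rw [hdil]
      refine hvm.trans (le_trans ?_ (mul_le_mul_of_nonneg_left hul (by positivity)))
      rw [NNReal.coe_zpow, NNReal.coe_zpow, ← zpow_add₀ hbR.ne']
      exact zpow_le_zpow_right₀ hbR1.le (by lia)
    have h1 := hreg x c z hne hcond
    have hvu : v / u ≤ (b : ℝ) ^ (-(i : ℝ)) := by
      rw [div_le_iff₀ hu0]
      refine hvm.trans (le_trans ?_ (mul_le_mul_of_nonneg_left hul (by positivity)))
      rw [NNReal.coe_zpow, NNReal.coe_zpow, Real.rpow_neg hbR.le, Real.rpow_natCast,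
        ← zpow_natCast, ← zpow_neg, ← zpow_add₀ hbR.ne']
      exact zpow_le_zpow_right₀ hbR1.le (by have := h.one_le; lia)
    have h2 : v ^ ε / u ^ (1 + ε) = u⁻¹ * (v / u) ^ ε := by
      rw [Real.rpow_add hu0, Real.rpow_one, Real.div_rpow hv0 hu0.le]
      field_simp
    rw [← NNReal.coe_le_coe]
    push_cast
    refine h1.trans ?_
    rw [h2, mul_assoc]
    refine mul_le_mul_of_nonneg_left (mul_le_mul ?_ ?_ (by positivity) (by positivity)) hC.le
    · rw [← NNReal.coe_zpow]
      exact inv_anti₀ hbl hul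
    · refine (Real.rpow_le_rpow (by positivity) hvu hε.le).trans_eq ?_
      rw [← Real.rpow_mul hbR.le, ← Real.rpow_natCast, ← Real.rpow_mul hbR.le]
      congr 1
      ring

theorem IsCalderonZygmund.exists_isRepresentedBy (hΔ : IsAdmissibleEllipsoid A Δ) (hn : 0 < n)
    {r : ℝ≥0∞} [Fact (1 ≤ r)]
    {T : Lp B₁ r (volume : Measure (EuclideanSpace ℝ (Fin n))) →L[ℂ]
      Lp B₂ r (volume : Measure (EuclideanSpace ℝ (Fin n)))} (hT : IsCalderonZygmund A Δ T) :
    ∃ K C θ, IsKernel (dilatedBall A Δ) ‖A.det‖₊ (doublingIndex A Δ) K C θ ∧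
      IsRepresentedBy T K := by
  obtain ⟨K, hK, hrep⟩ := hT
  obtain ⟨C, θ, hKer⟩ := hK.exists_isKernel hΔ hn
  refine ⟨K, C, θ, hKer, fun f hf => ?_⟩
  have hfr := hf.memLp_volume (hΔ.isBallFamily hn) r
  rw [opFn_of_memLp T hfr]
  exact hrep f hf.memLp_top
    (Metric.isCompact_of_isClosed_isBounded isClosed_closure hf.bounded.closure) hfr

end Kernel

section Weights

variable {w : EuclideanSpace ℝ (Fin n) → ℝ≥0} {p : ℝ}

theorem weightMeasure_absolutelyContinuous (w : EuclideanSpace ℝ (Fin n) → ℝ≥0) :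
    weightMeasure w ≪ volume :=
  withDensity_absolutelyContinuous _ _

theorem absolutelyContinuous_weightMeasure (hw : AEMeasurable w volume)
    (hpos : ∀ᵐ x, w x ≠ 0) : volume ≪ weightMeasure w :=
  withDensity_absolutelyContinuous' hw.coe_nnreal_ennreal
    (hpos.mono fun x hx => by simpa using hx)

theorem weightMeasure_eq_zero (hw : ∀ᵐ x, w x = 0) : weightMeasure w = 0 := by
  rw [weightMeasure, withDensity_congr_ae (g := 0), withDensity_zero]
  filter_upwards [hw] with x hx
  simp [hx]

/-- A set which is not null meets some large centred ball in a set which is not null. -/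
theorem IsBallFamily.exists_measure_inter_bl_ne_zero {E : Type*} [NormedAddCommGroup E]
    [MeasureSpace E] {b : ℝ≥0} {σ : ℤ} {B : ℤ → Set E} (h : IsBallFamily b σ B) {s : Set E}
    (hs : volume s ≠ 0) : ∃ N : ℕ, ∀ k : ℕ, N ≤ k → volume (s ∩ bl B 0 k) ≠ 0 := by
  by_contra! hcon
  refine hs ?_
  have h1 : s = ⋃ k : ℕ, s ∩ bl B 0 k := by rw [← inter_iUnion, h.iUnion_bl, inter_univ]
  rw [h1]
  refine measure_iUnion_null fun N => ?_
  obtain ⟨k, hk, hk0⟩ := hcon N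
  exact measure_mono_null (inter_subset_inter_right _ (h.bl_mono 0 (by exact_mod_cast hk))) hk0

theorem lintegral_ne_zero_of_measure_ne_zero {α : Type*} [MeasurableSpace α] {μ : Measure α}
    {f : α → ℝ≥0∞} (hf : AEMeasurable f μ) {s : Set α} (hs : μ ({x | f x ≠ 0} ∩ s) ≠ 0) :
    ∫⁻ x in s, f x ∂μ ≠ 0 := by
  intro h0
  rw [lintegral_eq_zero_iff' hf.restrict] at h0
  refine hs ?_
  have h1 : (μ.restrict s) {x | f x ≠ 0} = 0 := h0
  exact le_antisymm ((Measure.le_restrict_apply _ _).trans h1.le) zero_le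

/-- A Muckenhoupt weight is zero almost everywhere or positive almost everywhere. -/
theorem IsMuckenhoupt.ae_eq_zero_or_ae_ne_zero (hΔ : IsAdmissibleEllipsoid A Δ) (hn : 0 < n)
    (hp : 1 ≤ p) (hw : IsMuckenhoupt A Δ p w) : (∀ᵐ x, w x = 0) ∨ ∀ᵐ x, w x ≠ 0 := by
  have h := hΔ.isBallFamily hn
  by_contra hcon
  obtain ⟨h1, h2⟩ := not_or.1 hcon
  rw [ae_iff] at h1 h2
  obtain ⟨N₁, hN₁⟩ := h.exists_measure_inter_bl_ne_zero h1
  obtain ⟨N₂, hN₂⟩ := h.exists_measure_inter_bl_ne_zero h2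
  have hk₁ := hN₁ (max N₁ N₂) (le_max_left _ _)
  have hk₂ := hN₂ (max N₁ N₂) (le_max_right _ _)
  set k : ℤ := ((max N₁ N₂ : ℕ) : ℤ) with hk
  have hwm := hw.aemeasurable.coe_nnreal_ennreal
  obtain ⟨C, hC⟩ := hw.bound
  have hC0 := hC 0 k
  rw [vadd_dilatedBall, setLAverage_eq] at hC0
  have hW : (∫⁻ y in bl (dilatedBall A Δ) 0 k, (w y : ℝ≥0∞)) /
      volume (bl (dilatedBall A Δ) 0 k) ≠ 0 := by
    refine (ENNReal.div_pos ?_ (h.volume_bl_ne_top 0 k)).ne'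
    exact lintegral_ne_zero_of_measure_ne_zero hwm (by simpa using hk₁)
  have hzero : volume ({x | w x = 0} ∩ bl (dilatedBall A Δ) 0 k) ≠ 0 := by simpa using hk₂
  -- On this ball both `{w = 0}` and `{w ≠ 0}` have positive measure: the average of `w` is nonzero
  -- and, as negative powers of zero are infinite, the second factor is `∞`, which contradicts the
  -- bound.
  suffices htop : (if p = 1 then
        essSup (fun y => (w y : ℝ≥0∞)⁻¹) (volume.restrict (bl (dilatedBall A Δ) 0 k))
      else
        (⨍⁻ y in bl (dilatedBall A Δ) 0 k, (w y : ℝ≥0∞) ^ (-1 / (p - 1)) ∂volume) ^ (p - 1)) =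
        ∞ by
    rw [htop, ENNReal.mul_top hW] at hC0
    simp at hC0
  split_ifs with hp1
  · by_contra hne
    have hlt : essSup (fun y => (w y : ℝ≥0∞)⁻¹)
        (volume.restrict (bl (dilatedBall A Δ) 0 k)) < ∞ := lt_top_iff_ne_top.2 hne
    have h3 := ae_lt_of_essSup_lt hlt
    refine hzero (le_antisymm ((Measure.le_restrict_apply _ _).trans ?_) zero_le)
    refine le_trans (measure_mono fun x hx => ?_) (ae_iff.1 h3).le
    have hx0 : w x = 0 := hx
    simp [hx0]
  · have hp1' : 0 < p - 1 := sub_pos.2 (lt_of_le_of_ne hp (Ne.symm hp1))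
    rw [setLAverage_eq]
    have hint : ∫⁻ y in bl (dilatedBall A Δ) 0 k, (w y : ℝ≥0∞) ^ (-1 / (p - 1)) = ∞ := by
      by_contra hne
      have h3 := ae_lt_top' (hwm.pow_const (-1 / (p - 1))).restrict hne
      refine hzero (le_antisymm ((Measure.le_restrict_apply _ _).trans ?_) zero_le)
      refine le_trans (measure_mono fun x hx => ?_) (ae_iff.1 h3).le
      have hx0 : w x = 0 := hx
      have hneg : -1 / (p - 1) < 0 := div_neg_of_neg_of_pos (by norm_num) hp1'
      simpa [hx0] using hneg
    rw [hint, ENNReal.top_div_of_ne_top (h.volume_bl_ne_top 0 k), ENNReal.top_rpow_of_pos hp1']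

theorem IsMuckenhoupt.exists_isDualPair (hΔ : IsAdmissibleEllipsoid A Δ) (hn : 0 < n)
    (hp : 1 < p) (hw : IsMuckenhoupt A Δ p w) (hpos : ∀ᵐ x, w x ≠ 0) :
    ∃ C : ℝ≥0, IsDualPair (dilatedBall A Δ) p (fun x => (w x : ℝ≥0∞))
      (fun x => (w x : ℝ≥0∞) ^ (-1 / (p - 1))) C := by
  have h := hΔ.isBallFamily hn
  obtain ⟨C, hC⟩ := hw.bound
  have hp1 : 0 < p - 1 := sub_pos.2 hp
  have hwm := hw.aemeasurable.coe_nnreal_ennreal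
  refine ⟨C, hp, hwm, hwm.pow_const _, ?_, fun x k => ?_⟩
  · filter_upwards [hpos] with x hx
    rw [← ENNReal.rpow_mul, div_mul_cancel₀ _ hp1.ne', ENNReal.rpow_neg_one]
    exact ENNReal.mul_inv_cancel (by simpa using hx) ENNReal.coe_ne_top
  · have h1 := hC x k
    rw [if_neg hp.ne', vadd_dilatedBall, setLAverage_eq, setLAverage_eq,
      ENNReal.div_rpow_of_nonneg _ _ hp1.le] at h1
    set v := volume (bl (dilatedBall A Δ) x k) with hv
    have hv0 : v ≠ 0 := h.volume_bl_ne_zero x k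
    have hvt : v ≠ ∞ := h.volume_bl_ne_top x k
    have hvp : v ^ p = v * v ^ (p - 1) := by
      conv_rhs => rw [← ENNReal.rpow_one v, ← ENNReal.rpow_mul, one_mul,
        ← ENNReal.rpow_add _ _ hv0 hvt]
      congr 1; ring
    have hv0' : v ^ (p - 1) ≠ 0 := (ENNReal.rpow_pos (pos_iff_ne_zero.2 hv0) hvt).ne'
    have hvt' : v ^ (p - 1) ≠ ∞ := ENNReal.rpow_ne_top_of_nonneg hp1.le hvt
    rw [hvp]
    set I := ∫⁻ y in bl (dilatedBall A Δ) x k, (w y : ℝ≥0∞)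
    set J := (∫⁻ y in bl (dilatedBall A Δ) x k, (w y : ℝ≥0∞) ^ (-1 / (p - 1))) ^ (p - 1)
    calc I * J = (I / v * v) * (J / v ^ (p - 1) * v ^ (p - 1)) := by
          rw [ENNReal.div_mul_cancel hv0 hvt, ENNReal.div_mul_cancel hv0' hvt']
      _ = (I / v * (J / v ^ (p - 1))) * (v * v ^ (p - 1)) := by ring
      _ ≤ C * (v * v ^ (p - 1)) := mul_le_mul' h1 le_rfl

theorem IsMuckenhoupt.exists_isAOne (hΔ : IsAdmissibleEllipsoid A Δ) (hn : 0 < n)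
    (hw : IsMuckenhoupt A Δ 1 w) (hpos : ∀ᵐ x, w x ≠ 0) :
    ∃ C : ℝ≥0, IsAOne (dilatedBall A Δ) (fun x => (w x : ℝ≥0∞)) C := by
  have h := hΔ.isBallFamily hn
  obtain ⟨C, hC⟩ := hw.bound
  refine ⟨C, hw.aemeasurable.coe_nnreal_ennreal, ?_, by simp, fun x k => ?_⟩
  · filter_upwards [hpos] with x hx
    simpa using hx
  · have h1 := hC x k
    rw [if_pos rfl, vadd_dilatedBall, setLAverage_eq] at h1
    set v := volume (bl (dilatedBall A Δ) x k) with hv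
    have hv0 : v ≠ 0 := h.volume_bl_ne_zero x k
    have hvt : v ≠ ∞ := h.volume_bl_ne_top x k
    refine le_trans (le_of_eq ?_) (mul_le_mul' h1 (le_refl v))
    rw [mul_right_comm, ENNReal.div_mul_cancel hv0 hvt]

end Weights

section ZeroMeasure

variable {E : Type*} [MeasurableSpace E] {B₁ B₂ : Type*} [NormedAddCommGroup B₁]
  [NormedSpace ℂ B₁] [NormedAddCommGroup B₂] [NormedSpace ℂ B₂] {μ : Measure E}

theorem existsUnique_clm_of_measure_eq_zero (hμ : μ = 0) {p : ℝ≥0∞} [Fact (1 ≤ p)]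
    {P : (Lp B₁ p μ →L[ℂ] Lp B₂ p μ) → Prop} (hP : ∀ S, P S) : ∃! S, P S := by
  subst hμ
  exact ⟨0, hP _, fun S _ => ContinuousLinearMap.ext fun F => Lp.ext (ae_iff.2 rfl)⟩

theorem existsUnique_linearMap_of_measure_eq_zero (hμ : μ = 0)
    {P : (Lp B₁ 1 μ →ₗ[ℂ] (E →ₘ[μ] B₂)) → Prop} (hP : ∀ S, P S) : ∃! S, P S := by
  subst hμ
  exact ⟨0, hP _, fun S _ => LinearMap.ext fun F => AEEqFun.ext (ae_iff.2 rfl)⟩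

end ZeroMeasure

end Instances

/-! ### Weighted bounds on test functions -/

section Bounds

variable {E : Type*} [NormedAddCommGroup E] [MeasureSpace E] [BorelSpace E] [ProperSpace E]
variable {B₁ B₂ : Type*} [NormedAddCommGroup B₁] [NormedSpace ℂ B₁] [CompleteSpace B₁]
  [NormedAddCommGroup B₂] [NormedSpace ℂ B₂] [CompleteSpace B₂]
variable {B : ℤ → Set E} {b : ℝ≥0} {σ : ℤ} {K : E → E → B₁ →L[ℂ] B₂} {C θ C₀ : ℝ≥0}
  {r : ℝ≥0∞} [Fact (1 ≤ r)] {W S : E → ℝ≥0∞}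
variable {T : Lp B₁ r (volume : Measure E) →L[ℂ] Lp B₂ r (volume : Measure E)}

namespace IsBallFamily

variable (h : IsBallFamily b σ B)
include h

/-- Weighted strong-type bound for Muckenhoupt weights, on test functions. -/
theorem exists_eLpNorm_opFn_le {p : ℝ≥0∞} (hp : p ≠ 0) (hp' : p ≠ ∞)
    (hW : IsDualPair B p.toReal W S C₀) (hr : 1 < r) (hr' : r < ∞)
    (hK : IsKernel B b σ K C θ) (hT : IsRepresentedBy T K) :
    ∃ C' : ℝ≥0, ∀ f : E → B₁, IsTest f →
      eLpNorm (opFn T f) p (volume.withDensity W) ≤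
        C' * eLpNorm f p (volume.withDensity W) := by
  have hpp : 0 < p.toReal := ENNReal.toReal_pos hp hp'
  obtain ⟨C₁, hC₁⟩ := h.exists_strong_bound (h.isComparable_of_isDualPair hW) hr hr' hK hT hpp
  obtain ⟨C₂, hC₂⟩ := h.exists_lintegral_maxFn_le hW
  refine ⟨(C₁ * C₂) ^ (1 / p.toReal), fun f hf => ?_⟩
  rw [eLpNorm_eq_lintegral_rpow_enorm_toReal hp hp', eLpNorm_eq_lintegral_rpow_enorm_toReal hp hp',
    ENNReal.coe_rpow_of_nonneg _ (by positivity),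
    ← ENNReal.mul_rpow_of_nonneg _ _ (by positivity)]
  refine ENNReal.rpow_le_rpow ?_ (by positivity)
  rw [ENNReal.coe_mul, mul_assoc]
  exact (hC₁ f hf).trans (mul_le_mul' le_rfl (hC₂ _ hf.aestronglyMeasurable.enorm))

/-- Weighted weak-type bound for `A₁` weights, on test functions. -/
theorem exists_weakL1Norm_opFn_le (hW : IsAOne B W C₀) (hr : 1 < r) (hr' : r < ∞)
    (hK : IsKernel B b σ K C θ) (hT : IsRepresentedBy T K) :
    ∃ C' : ℝ≥0, ∀ f : E → B₁, IsTest f →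
      weakL1Norm (opFn T f) (volume.withDensity W) ≤
        C' * eLpNorm f 1 (volume.withDensity W) := by
  have hcomp := h.isComparable_of_isAOne hW
  obtain ⟨C₁, hC₁⟩ := h.exists_weak_bound hcomp hr hr' hK hT
  obtain ⟨C₂, hC₂⟩ := h.exists_maxFn_weak_of_isAOne hW
  refine ⟨C₁ * C₂, fun f hf => ?_⟩
  have hfw := hf.memLp h _ hcomp.ac hcomp.ne_top 1
  rw [weakL1Norm_le_iff, ENNReal.coe_mul, mul_assoc]
  refine hC₁ f hf _ (ENNReal.mul_ne_top ENNReal.coe_ne_top hfw.2.ne) fun s => ?_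
  rw [eLpNorm_one_eq_lintegral_enorm]
  exact hC₂ _ hf.aestronglyMeasurable.enorm s

end IsBallFamily

end Bounds

end Anisotropic

/-! ### Conclusion -/

theorem theoremA1 {n : ℕ} (hn : 0 < n)
    (A : Matrix (Fin n) (Fin n) ℝ) (hA : Anisotropic.IsExpansive A)
    (Δ : Set (EuclideanSpace ℝ (Fin n))) (hΔ : Anisotropic.IsAdmissibleEllipsoid A Δ)
    {B₁ B₂ : Type*}
    [NormedAddCommGroup B₁] [NormedSpace ℂ B₁] [CompleteSpace B₁]
    [NormedAddCommGroup B₂] [NormedSpace ℂ B₂] [CompleteSpace B₂]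
    (r : ℝ≥0∞) [Fact (1 ≤ r)] (hr : 1 < r) (hr' : r < ∞)
    (T : Lp B₁ r (volume : Measure (EuclideanSpace ℝ (Fin n))) →L[ℂ]
      Lp B₂ r (volume : Measure (EuclideanSpace ℝ (Fin n))))
    (hT : Anisotropic.IsCalderonZygmund A Δ T) :
    (∀ (p : ℝ≥0∞) [Fact (1 ≤ p)], 1 < p → p < ∞ →
      ∀ w : EuclideanSpace ℝ (Fin n) → ℝ≥0, Anisotropic.IsMuckenhoupt A Δ p.toReal w →
        ∃! S : Lp B₁ p (Anisotropic.weightMeasure w) →L[ℂ] Lp B₂ p (Anisotropic.weightMeasure w),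
          ∀ (f : EuclideanSpace ℝ (Fin n) → B₁) (hf : MemLp f r volume)
            (hfw : MemLp f p (Anisotropic.weightMeasure w)),
            S (hfw.toLp f) =ᵐ[Anisotropic.weightMeasure w] T (hf.toLp f)) ∧
    (∀ w : EuclideanSpace ℝ (Fin n) → ℝ≥0, Anisotropic.IsMuckenhoupt A Δ 1 w →
      ∃! S : Lp B₁ 1 (Anisotropic.weightMeasure w) →ₗ[ℂ]
          (EuclideanSpace ℝ (Fin n) →ₘ[Anisotropic.weightMeasure w] B₂),
        (∃ C : ℝ≥0, ∀ f : Lp B₁ 1 (Anisotropic.weightMeasure w),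
          Anisotropic.weakL1Norm (S f) (Anisotropic.weightMeasure w) ≤
            C * eLpNorm f 1 (Anisotropic.weightMeasure w)) ∧
        ∀ (f : EuclideanSpace ℝ (Fin n) → B₁) (hf : MemLp f r volume)
          (hfw : MemLp f 1 (Anisotropic.weightMeasure w)),
          S (hfw.toLp f) =ᵐ[Anisotropic.weightMeasure w] T (hf.toLp f)) := by
  have h := hΔ.isBallFamily hn
  obtain ⟨K, C, θ, hK, hrep⟩ := hT.exists_isRepresentedBy hΔ hn
  refine ⟨fun p _ hp hp' w hw => ?_, fun w hw => ?_⟩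
  · have hp1 : 1 < p.toReal := by
      rw [← ENNReal.toReal_one]
      exact (ENNReal.toReal_lt_toReal ENNReal.one_ne_top hp'.ne).2 hp
    -- The null weight satisfies the Muckenhoupt condition because `0 · ∞ = 0`; its weighted spaces
    -- have a single element, so existence and uniqueness are trivial.
    rcases hw.ae_eq_zero_or_ae_ne_zero hΔ hn hp1.le with h0 | hpos
    · have hμ := Anisotropic.weightMeasure_eq_zero h0
      exact Anisotropic.existsUnique_clm_of_measure_eq_zero hμ fun S f hf hfw =>
        ae_iff.2 (congrFun (congrArg DFunLike.coe hμ) _)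
    · obtain ⟨C₀, hW⟩ := hw.exists_isDualPair hΔ hn hp1 hpos
      have hac := Anisotropic.weightMeasure_absolutelyContinuous w
      obtain ⟨C', hC'⟩ := h.exists_eLpNorm_opFn_le (zero_lt_one.trans hp).ne' hp'.ne hW hr hr'
        hK hrep
      exact h.existsUnique_strong_extension T hac
        (Anisotropic.absolutelyContinuous_weightMeasure hw.aemeasurable hpos)
        (h.isComparable_of_isDualPair hW).ne_top hp'.ne
        fun f hf => h.eLpNorm_opFn_le_of_isTest T hr' hac hC' hf
  · rcases hw.ae_eq_zero_or_ae_ne_zero hΔ hn le_rfl with h0 | hpos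
    · have hμ := Anisotropic.weightMeasure_eq_zero h0
      exact Anisotropic.existsUnique_linearMap_of_measure_eq_zero hμ fun S =>
        ⟨⟨0, fun f => by simp [Anisotropic.weakL1Norm, hμ]⟩, fun f hf hfw =>
          ae_iff.2 (congrFun (congrArg DFunLike.coe hμ) _)⟩
    · obtain ⟨C₀, hW⟩ := hw.exists_isAOne hΔ hn hpos
      have hac := Anisotropic.weightMeasure_absolutelyContinuous w
      obtain ⟨C', hC'⟩ := h.exists_weakL1Norm_opFn_le hW hr hr' hK hrep
      exact h.existsUnique_weak_extension T hac
        (Anisotropic.absolutelyContinuous_weightMeasure hw.aemeasurable hpos)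
        (h.isComparable_of_isAOne hW).ne_top
        fun f hf => h.weakL1Norm_opFn_le_of_isTest T hr' hac hC' hf
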